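/- Let $d\ge 3$ and $k\in\mathbb N$. Consider two infinite reservoirs $r\in\{I,II\}$ of free non-relativistic fermions in $\mathbb R^d$ with $k$ internal (spin/species) states, described on the fermionic Fock space $\mathcal H=\bigoplus_n h_n$ over $L^2(\mathbb R^d)\otimes\mathbb C^k\otimes\mathbb C^{\{I,II\}}$; creation and annihilation operators $a^*(X),a(X)$, $X=(x,s,r)$, of different reservoirs are taken to anticommute. The free dynamics is $\alpha^0_t(A)=e^{itH}Ae^{-itH}$, where $H$ acts on $n$-particle wave functions as $-\sum_{j=1}^n\Delta_j$. For kernels $w=(w_N)_{N\ge1}$, where for all labels $s,s'\in\{1,\dots,k\}^N$ and $r,r'\in\{I,II\}^N$ the function $w_N((\cdot,s,r),(\cdot,s',r'))$ is in $L^2(\mathbb R^{2dN})$, let $$W=\sum_{N\ge1}W_N,\qquad W_N=\int dX^{(N)}\int dY^{(N)}\;a^*(X_1)\cdots a^*(X_N)\,w_N(X^{(N)},Y^{(N)})\,a(Y_1)\cdots a(Y_N),$$ where $\int dX=\sum_{r}\sum_{s}\int_{\mathbb R^d}dx$, each $W_N$ is the bounded operator with these matrix elements between finite-particle vectors, and the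 sum converges in operator norm. Put $$\|w\|'=\sum_{N\ge1}N2^{(d+2)N}\sum_{s,s',r,r'}\bigl\|w_N\bigl((\cdot,s,r),(\cdot,s',r')\bigr)\bigr\|'_{2dN},$$ $$\|f\|'_M=2^{-3M/2}\langle f,B_0f\rangle^{1/2},\qquad B_y=\prod_{j=1}^M\Bigl(-\frac{\partial^2}{\partial x_j^2}+(x_j-y_j)^2+1\Bigr)^3 ,$$ where, for $f\in L^2(\mathbb R^M)$, $\langle f,B_yf\rangle^{1/2}\in[0,\infty]$ is understood in the sense of quadratic forms, i.e. as $\sup\{|\langle f,B_y\varphi\rangle| : \varphi \text{ Schwartz},\ \langle\varphi,B_y\varphi\rangle\le1\}$ (this is the literal expression if $f$ is a Schwartz function). Let $\|w\|''$ be defined in the same way, with $\|f\|'_M$ replaced by the translation-invariant functional $\|f\|''_M=2^{-3M/2}\inf_{y\in\mathbb R^M}\langle f,B_yf\rangle^{1/2}$. Let $w$ and $a$ be two families of kernels with $\|w\|'<\infty$ and $\|a\|'<\infty$. Then there are unique bounded operators $W$ and $A$ on $\mathcal H$ given by $w$ and $a$ as above. Write $\|W\|':=\|w\|'$, $\|A\|':=\|a\|'$,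 $W(t)=\alpha^0_{-t}(W)$, $D_0(t)A=A$ and, for $m\ge1$, $$D_m(t)A=\int_{t>t_m>\dots>t_1>0}dt_1\cdots dt_m\,[W(t_m),\dots,[W(t_1),A]\dots]\quad(t>0),$$ and the same with the integral over $0>t_1>\dots>t_m>t$ for $t<0$; these integrals converge in operator norm. Then for every $m\ge1$ $$\int_0^\infty\bigl\|[W(t),D_{m-1}(t)A]\bigr\|\,dt\le\frac1m\Bigl(\frac{8\pi d}{d-2}\Bigr)^m\|A\|'\,(\|W\|')^m,$$ and the same bound holds for $\int_{-\infty}^0\|[W(t),D_{m-1}(t)A]\|\,dt$. All of this also holds if $\|\cdot\|'$ is replaced by $\|\cdot\|''$ throughout, for $w$ and for $a$. -/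

import Mathlib

open MeasureTheory SchwartzMap FourierTransform LineDeriv
open scoped ENNReal ComplexInnerProductSpace

noncomputable section

namespace FreeFermions

/-! ### Points, sectors, permutations -/

/-- The discrete label `(s, r)` of a particle: its spin (or species) index `s`, one of `k` values,
and the reservoir `r ∈ {I, II}` that it belongs to. -/
abbrev Label (k : ℕ) : Type := Fin k × Fin 2

/-- A generalised point `X = (x, s, r)`. -/
abbrev Pt (d k : ℕ) : Type := EuclideanSpace ℝ (Fin d) × Label k

/-- The list of all coordinates of a family of points of `ℝ^d`. -/
def coords {ι : Type} [Fintype ι] {d : ℕ} (x : ι → EuclideanSpace ℝ (Fin d)) :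
    EuclideanSpace ℝ (ι × Fin d) :=
  WithLp.toLp 2 fun p => x p.1 p.2

/-- The Hilbert space `(L²(ℝ^d) ⊗ ℂ^k ⊗ ℂ²)^{⊗ n} = L²(ℝ^{nd}; (ℂ^k ⊗ ℂ²)^{⊗ n})` of `n`
distinguishable particles. -/
abbrev Sector (d k n : ℕ) : Type :=
  Lp (EuclideanSpace ℂ (Fin n → Label k)) 2
    (volume : Measure (EuclideanSpace ℝ (Fin n × Fin d)))

/-- The permutation `x ↦ (x_{σ 1}, …, x_{σ n})` of the positions of `n` particles. -/
def permPos (d n : ℕ) (σ : Equiv.Perm (Fin n)) :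
    EuclideanSpace ℝ (Fin n × Fin d) ≃ₗᵢ[ℝ] EuclideanSpace ℝ (Fin n × Fin d) :=
  LinearIsometryEquiv.piLpCongrLeft 2 ℝ ℝ (σ.symm.prodCongr (Equiv.refl (Fin d)))

theorem permPos_apply (d n : ℕ) (σ : Equiv.Perm (Fin n)) (x : EuclideanSpace ℝ (Fin n × Fin d))
    (j : Fin n) (i : Fin d) : permPos d n σ x (j, i) = x (σ j, i) := rfl

/-- The permutation of the labels of `n` particles. -/
def permLabel (k n : ℕ) (σ : Equiv.Perm (Fin n)) :
    EuclideanSpace ℂ (Fin n → Label k) ≃ₗᵢ[ℂ] EuclideanSpace ℂ (Fin n → Label k) :=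
  LinearIsometryEquiv.piLpCongrLeft 2 ℂ ℂ (σ.arrowCongr (Equiv.refl (Label k)))

theorem permLabel_apply (k n : ℕ) (σ : Equiv.Perm (Fin n))
    (v : EuclideanSpace ℂ (Fin n → Label k)) (s : Fin n → Label k) :
    permLabel k n σ v s = v (s ∘ σ) := rfl

/-- The permutation operator `(P_σ f)(X_1, …, X_n) = f(X_{σ 1}, …, X_{σ n})` on wave functions. -/
def permOp (d k n : ℕ) (σ : Equiv.Perm (Fin n)) : Sector d k n →L[ℂ] Sector d k n :=
  ((permLabel k n σ).toContinuousLinearEquiv.toContinuousLinearMap.compLpL 2 volume) ∘L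
    (Lp.compMeasurePreservingₗᵢ ℂ (permPos d n σ)
      (permPos d n σ).measurePreserving).toContinuousLinearMap

theorem permOp_ae (d k n : ℕ) (σ : Equiv.Perm (Fin n)) (f : Sector d k n) :
    permOp d k n σ f =ᵐ[volume] fun x => permLabel k n σ (f (permPos d n σ x)) := by
  filter_upwards [Lp.coeFn_compMeasurePreserving f (permPos d n σ).measurePreserving,
    (permLabel k n σ).toContinuousLinearEquiv.toContinuousLinearMap.coeFn_compLp
      (Lp.compMeasurePreserving (permPos d n σ) (permPos d n σ).measurePreserving f)] with x h1 h2
  rw [h1] at h2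
  exact h2

/-- The fermionic `n`-particle space: totally antisymmetric wave functions. -/
def fermi (d k n : ℕ) : Submodule ℂ (Sector d k n) :=
  ⨅ σ : Equiv.Perm (Fin n),
    LinearMap.ker (permOp d k n σ - ((Equiv.Perm.sign σ : ℤ) : ℂ) • 1 :
      Sector d k n →L[ℂ] Sector d k n).toLinearMap

theorem mem_fermi {d k n : ℕ} (f : Sector d k n) :
    f ∈ fermi d k n ↔ ∀ σ, permOp d k n σ f = ((Equiv.Perm.sign σ : ℤ) : ℂ) • f := by
  simp [fermi, sub_eq_zero]

instance (d k n : ℕ) : CompleteSpace (fermi d k n) := by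
  have h : IsClosed (fermi d k n : Set (Sector d k n)) := by
    unfold fermi
    rw [Submodule.coe_iInf]
    exact isClosed_iInter fun σ => ContinuousLinearMap.isClosed_ker _
  exact h.completeSpace_coe

/-- Fermionic Fock space `⊕_n h_n` over `L²(ℝ^d) ⊗ ℂ^k ⊗ ℂ²`. Up to the Klein-Jordan-Wigner
transformation, which makes the creation and annihilation operators of different reservoirs
anticommute, this is the tensor product of the Fock spaces of the two reservoirs. -/
def Fock (d k : ℕ) : Type := lp (fun n : ℕ => fermi d k n) 2

instance (d k : ℕ) : NormedAddCommGroup (Fock d k) :=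
  inferInstanceAs (NormedAddCommGroup (lp (fun n : ℕ => fermi d k n) 2))

instance (d k : ℕ) : InnerProductSpace ℂ (Fock d k) :=
  inferInstanceAs (InnerProductSpace ℂ (lp (fun n : ℕ => fermi d k n) 2))

instance (d k : ℕ) : CompleteSpace (Fock d k) :=
  inferInstanceAs (CompleteSpace (lp (fun n : ℕ => fermi d k n) 2))

/-- The `n`-particle component `ψ_n` of a Fock space vector `ψ = (ψ_n)_n`. -/
def Fock.component {d k : ℕ} (ψ : Fock d k) (n : ℕ) : fermi d k n :=
  (show lp (fun n : ℕ => fermi d k n) 2 from ψ) n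

theorem Fock.inner_eq {d k : ℕ} (φ ψ : Fock d k) :
    ⟪φ, ψ⟫ = ∑' n, ⟪φ.component n, ψ.component n⟫ := rfl

/-- The bounded operators on Fock space, with the operator norm. -/
abbrev Op (d k : ℕ) : Type := Fock d k →L[ℂ] Fock d k

/-! ### The free dynamics -/

/-- The function `e^{-it|2πξ|²}`. -/
def phaseFun (d n : ℕ) (t : ℝ) (ξ : EuclideanSpace ℝ (Fin n × Fin d)) : ℂ :=
  Complex.exp (((-(t * (2 * Real.pi * ‖ξ‖) ^ 2) : ℝ) : ℂ) * Complex.I)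

theorem norm_phaseFun (d n : ℕ) (t : ℝ) (ξ : EuclideanSpace ℝ (Fin n × Fin d)) :
    ‖phaseFun d n t ξ‖ = 1 := Complex.norm_exp_ofReal_mul_I _

theorem memLp_phaseFun (d n : ℕ) (t : ℝ) : MemLp (phaseFun d n t) ∞ volume := by
  refine memLp_top_of_bound (Continuous.aestronglyMeasurable ?_) 1
    (Filter.Eventually.of_forall fun ξ => (norm_phaseFun d n t ξ).le)
  unfold phaseFun
  fun_prop

/-- Multiplication by `e^{-it|2πξ|²}` on the `n`-particle space. -/
def phaseOp (d k n : ℕ) (t : ℝ) : Sector d k n →L[ℂ] Sector d k n :=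
  (ContinuousLinearMap.lsmul ℂ ℂ).holderL volume ∞ 2 2 (memLp_phaseFun d n t).toLp

theorem phaseOp_ae (d k n : ℕ) (t : ℝ) (f : Sector d k n) :
    phaseOp d k n t f =ᵐ[volume] fun ξ => phaseFun d n t ξ • f ξ := by
  refine (ContinuousLinearMap.coeFn_holder _ _ _).trans ?_
  filter_upwards [(memLp_phaseFun d n t).coeFn_toLp] with ξ hξ
  simp [hξ]

theorem norm_phaseOp (d k n : ℕ) (t : ℝ) (f : Sector d k n) :
    ‖phaseOp d k n t f‖ = ‖f‖ := by
  simp only [Lp.norm_def]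
  congr 1
  refine eLpNorm_congr_norm_ae ?_
  filter_upwards [phaseOp_ae d k n t f] with ξ hξ
  rw [hξ, norm_smul, norm_phaseFun, one_mul]

/-- The unitary group `e^{-itT_n} = e^{itΔ}` of the free `n`-particle Hamiltonian
`T_n = - ∑_j Δ_j` (units `ħ = 1`, mass `1/2`), defined by the Fourier transform. -/
def sectorEvol (d k n : ℕ) (t : ℝ) : Sector d k n →L[ℂ] Sector d k n :=
  (Lp.fourierTransformₗᵢ (EuclideanSpace ℝ (Fin n × Fin d))
      (EuclideanSpace ℂ (Fin n → Label k))).symm.toContinuousLinearEquiv.toContinuousLinearMap ∘L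
    phaseOp d k n t ∘L
  (Lp.fourierTransformₗᵢ (EuclideanSpace ℝ (Fin n × Fin d))
      (EuclideanSpace ℂ (Fin n → Label k))).toContinuousLinearEquiv.toContinuousLinearMap

theorem norm_sectorEvol (d k n : ℕ) (t : ℝ) (f : Sector d k n) :
    ‖sectorEvol d k n t f‖ = ‖f‖ := by
  simp [sectorEvol, norm_phaseOp]

theorem permOp_phaseOp (d k n : ℕ) (t : ℝ) (σ : Equiv.Perm (Fin n)) (f : Sector d k n) :
    permOp d k n σ (phaseOp d k n t f) = phaseOp d k n t (permOp d k n σ f) := by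
  apply Lp.ext
  filter_upwards [permOp_ae d k n σ (phaseOp d k n t f), phaseOp_ae d k n t (permOp d k n σ f),
    permOp_ae d k n σ f, (permPos d n σ).measurePreserving.quasiMeasurePreserving.ae
      (phaseOp_ae d k n t f)] with x h1 h2 h3 h4
  rw [h1, h2, h3, h4, map_smul]
  simp [phaseFun]

theorem permOp_fourier (d k n : ℕ) (σ : Equiv.Perm (Fin n)) (f : Sector d k n) :
    permOp d k n σ (𝓕 f) = 𝓕 (permOp d k n σ f) := by
  have key : ∀ g : 𝓢(EuclideanSpace ℝ (Fin n × Fin d), EuclideanSpace ℂ (Fin n → Label k)),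
      ∃ h : 𝓢(EuclideanSpace ℝ (Fin n × Fin d), EuclideanSpace ℂ (Fin n → Label k)),
        permOp d k n σ (g.toLp 2) = h.toLp 2 ∧ ∀ x, h x = permLabel k n σ (g (permPos d n σ x)) := by
    intro g
    refine ⟨SchwartzMap.compCLMOfContinuousLinearEquiv ℂ (permPos d n σ).toContinuousLinearEquiv
      (SchwartzMap.postcompCLM
        (permLabel k n σ).toContinuousLinearEquiv.toContinuousLinearMap g), ?_, fun x => rfl⟩
    apply Lp.ext
    filter_upwards [permOp_ae d k n σ (g.toLp 2), SchwartzMap.coeFn_toLp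
      (SchwartzMap.compCLMOfContinuousLinearEquiv ℂ (permPos d n σ).toContinuousLinearEquiv
      (SchwartzMap.postcompCLM
        (permLabel k n σ).toContinuousLinearEquiv.toContinuousLinearMap g)) 2 volume,
      (permPos d n σ).measurePreserving.quasiMeasurePreserving.ae
        (SchwartzMap.coeFn_toLp g 2 volume)] with x h1 h2 h3
    rw [h1, h2, h3]
    rfl
  refine DenseRange.induction_on (p := fun f : Sector d k n =>
    permOp d k n σ (𝓕 f) = 𝓕 (permOp d k n σ f))
    (SchwartzMap.denseRange_toLpCLM (E := EuclideanSpace ℝ (Fin n × Fin d)) (μ := volume)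
      (p := 2) ENNReal.ofNat_ne_top) f ?_ ?_
  · exact isClosed_eq
      ((permOp d k n σ).continuous.comp (Lp.fourierTransformₗᵢ _ _).continuous)
      ((Lp.fourierTransformₗᵢ _ _).continuous.comp (permOp d k n σ).continuous)
  · intro g
    simp only [SchwartzMap.toLpCLM_apply]
    obtain ⟨h, h1, h2⟩ := key g
    obtain ⟨h', h1', h2'⟩ := key (𝓕 g)
    rw [SchwartzMap.toLp_fourier_eq, h1, h1', SchwartzMap.toLp_fourier_eq]
    congr 1
    ext1 x
    rw [h2', SchwartzMap.fourier_coe, SchwartzMap.fourier_coe]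
    have : (h : EuclideanSpace ℝ (Fin n × Fin d) → _) =
        (fun y => permLabel k n σ (g y)) ∘ permPos d n σ := funext h2
    rw [this, Real.fourier_comp_linearIsometry, Real.fourier_eq, Real.fourier_eq]
    have hi := (Real.fourierIntegral_convergent_iff (μ := volume) (permPos d n σ x)).2
      (g.integrable (μ := volume))
    refine ((permLabel k n σ).toContinuousLinearEquiv.toContinuousLinearMap.integral_comp_comm
      hi).symm.trans (integral_congr_ae (Filter.Eventually.of_forall fun y => ?_))
    simp [Circle.smul_def]

theorem sectorEvol_mem (d k n : ℕ) (t : ℝ) {f : Sector d k n} (hf : f ∈ fermi d k n) :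
    sectorEvol d k n t f ∈ fermi d k n := by
  rw [mem_fermi] at hf ⊢
  intro σ
  apply (Lp.fourierTransformₗᵢ (EuclideanSpace ℝ (Fin n × Fin d))
      (EuclideanSpace ℂ (Fin n → Label k))).injective
  have h1 := permOp_fourier d k n σ (sectorEvol d k n t f)
  change 𝓕 (permOp d k n σ (sectorEvol d k n t f)) =
    𝓕 (((Equiv.Perm.sign σ : ℤ) : ℂ) • sectorEvol d k n t f)
  rw [← h1]
  have h2 : 𝓕 (sectorEvol d k n t f) = phaseOp d k n t (𝓕 f) := by
    exact (Lp.fourierTransformₗᵢ (EuclideanSpace ℝ (Fin n × Fin d))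
      (EuclideanSpace ℂ (Fin n → Label k))).apply_symm_apply _
  rw [FourierTransform.fourier_smul, h2, permOp_phaseOp, permOp_fourier, hf σ,
    FourierTransform.fourier_smul, map_smul]

/-- The free evolution `e^{-itT_n}` on the fermionic `n`-particle space. -/
def fermiEvol (d k n : ℕ) (t : ℝ) : fermi d k n →ₗ[ℂ] fermi d k n :=
  (sectorEvol d k n t).toLinearMap.restrict fun _ hf => sectorEvol_mem d k n t hf

theorem norm_fermiEvol (d k n : ℕ) (t : ℝ) (f : fermi d k n) : ‖fermiEvol d k n t f‖ = ‖f‖ :=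
  norm_sectorEvol d k n t f

theorem memℓp_fermiEvol (d k : ℕ) (t : ℝ) (ψ : Fock d k) :
    Memℓp (fun n => fermiEvol d k n t (ψ.component n)) 2 := by
  refine memℓp_gen ?_
  simp only [norm_fermiEvol]
  exact (lp.memℓp (show lp (fun n : ℕ => fermi d k n) 2 from ψ)).summable (by norm_num)

/-- The free evolution on Fock space as a linear map. -/
def evolLinear (d k : ℕ) (t : ℝ) : Fock d k →ₗ[ℂ] Fock d k where
  toFun ψ := (⟨fun n => fermiEvol d k n t (ψ.component n), memℓp_fermiEvol d k t ψ⟩ :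
    lp (fun n : ℕ => fermi d k n) 2)
  map_add' ψ φ :=
    lp.ext (funext fun n => map_add (fermiEvol d k n t) (ψ.component n) (φ.component n))
  map_smul' c ψ := lp.ext (funext fun n => map_smul (fermiEvol d k n t) c (ψ.component n))

theorem norm_evolLinear (d k : ℕ) (t : ℝ) (ψ : Fock d k) : ‖evolLinear d k t ψ‖ = ‖ψ‖ := by
  refine (lp.norm_eq_tsum_rpow (by norm_num)
    (show lp (fun n : ℕ => fermi d k n) 2 from evolLinear d k t ψ)).trans
    (Eq.trans ?_ (lp.norm_eq_tsum_rpow (by norm_num)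
      (show lp (fun n : ℕ => fermi d k n) 2 from ψ)).symm)
  have h : ∀ n, ‖(show lp (fun n : ℕ => fermi d k n) 2 from evolLinear d k t ψ) n‖ =
      ‖(show lp (fun n : ℕ => fermi d k n) 2 from ψ) n‖ :=
    fun n => norm_fermiEvol d k n t (ψ.component n)
  simp only [h]

/-- The free evolution on Fock space, `(e^{-itH} ψ)_n = e^{-itT_n} ψ_n`. -/
def evol (d k : ℕ) (t : ℝ) : Op d k :=
  (evolLinear d k t).mkContinuous 1 fun ψ => by rw [one_mul, norm_evolLinear]

theorem evol_component (d k : ℕ) (t : ℝ) (ψ : Fock d k) (n : ℕ) :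
    ((evol d k t ψ).component n : Sector d k n) = sectorEvol d k n t (ψ.component n) := rfl

/-- The free Heisenberg dynamics `α⁰_t(A) = e^{itH} A e^{-itH}`. -/
def freeDynamics (d k : ℕ) (t : ℝ) (A : Op d k) : Op d k := evol d k (-t) * A * evol d k t

/-! ### Annihilation operators and Wick-ordered interactions -/

/-- A sequence `(f_n)_n` of `n`-particle wave functions. -/
abbrev WaveSeq (d k : ℕ) : Type := (n : ℕ) → (Fin n → Pt d k) → ℂ

/-- The wave functions `f_n(X_1, …, X_n)` of a Fock space vector (each one up to a null set). -/
def wave {d k : ℕ} (ψ : Fock d k) : WaveSeq d k :=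
  fun n X => (ψ.component n : Sector d k n) (coords fun j => (X j).1) fun j => (X j).2

/-- The annihilation operator at a point,
`(a(X) ψ)_n(X_1, …, X_n) = √(n+1) f_{n+1}(X, X_1, …, X_n)`. -/
def annih {d k : ℕ} (X : Pt d k) (Ψ : WaveSeq d k) : WaveSeq d k :=
  fun n Z => (Real.sqrt (n + 1) : ℂ) * Ψ (n + 1) (Fin.cons X Z)

/-- The product `a(Y_1) a(Y_2) ⋯ a(Y_N)`, applied to a sequence of wave functions. -/
def annihProd {d k N : ℕ} (Y : Fin N → Pt d k) (Ψ : WaveSeq d k) : WaveSeq d k :=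
  (List.ofFn Y).foldr annih Ψ

/-- The scalar product
`∑_n ∑_{s_1,r_1,…,s_n,r_n} ∫ dx_1 ⋯ dx_n conj(f_n(X_1, …, X_n)) g_n(X_1, …, X_n)`. -/
def waveInner {d k : ℕ} (Φ Ψ : WaveSeq d k) : ℂ :=
  ∑' n : ℕ, ∑ s : Fin n → Label k, ∫ x : Fin n → EuclideanSpace ℝ (Fin d),
    starRingEnd ℂ (Φ n fun j => (x j, s j)) * Ψ n fun j => (x j, s j)

/-- `L²` functions of `(x_1, …, x_N, y_1, …, y_N) ∈ ℝ^{2dN}`. -/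
abbrev KernelFun (d N : ℕ) : Type :=
  Lp ℂ 2 (volume : Measure (EuclideanSpace ℝ ((Fin N ⊕ Fin N) × Fin d)))

/-- A family of kernels `w = (w_N)_{N ≥ 1}`,
`w_N((x, s, r), (y, s', r'))` with `x, y ∈ (ℝ^d)^N` and `(s, r), (s', r')` lists of `N` labels. -/
abbrev Kernels (d k : ℕ) : Type :=
  (N : ℕ+) → (Fin N → Label k) → (Fin N → Label k) → KernelFun d N

/-- The sesquilinear form
`⟨φ, ∫dX ∫dY a*(X_1) ⋯ a*(X_N) w(X, Y) a(Y_1) ⋯ a(Y_N) ψ⟩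
  = ∫dX ∫dY w(X, Y) ⟨a(X_N) ⋯ a(X_1) φ, a(Y_1) ⋯ a(Y_N) ψ⟩`. -/
def wickForm {d k N : ℕ} (w : (Fin N → Label k) → (Fin N → Label k) → KernelFun d N)
    (φ ψ : Fock d k) : ℂ :=
  ∑ s : Fin N → Label k, ∑ s' : Fin N → Label k,
    ∫ x : Fin N → EuclideanSpace ℝ (Fin d), ∫ y : Fin N → EuclideanSpace ℝ (Fin d),
      w s s' (coords (Sum.elim x y)) *
        waveInner (annihProd (fun j => (x j.rev, s j.rev)) (wave φ))
          (annihProd (fun j => (y j, s' j)) (wave ψ))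

/-- Vectors of Fock space with finitely many non-zero components. -/
def IsFiniteParticle {d k : ℕ} (ψ : Fock d k) : Prop := {n | ψ.component n ≠ 0}.Finite

/-- `T = ∫dX ∫dY a*(X_1) ⋯ a*(X_N) w(X, Y) a(Y_1) ⋯ a(Y_N)` as a bounded operator: the equality
holds between matrix elements on the dense domain of finite-particle vectors. -/
def IsWickMonomial {d k N : ℕ} (w : (Fin N → Label k) → (Fin N → Label k) → KernelFun d N)
    (T : Op d k) : Prop :=
  ∀ φ ψ : Fock d k, IsFiniteParticle φ → IsFiniteParticle ψ → ⟪φ, T ψ⟫ = wickForm w φ ψ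

/-- `W = ∑_{N ≥ 1} W_N` in operator norm, where
`W_N = ∫dX ∫dY a*(X_1) ⋯ a*(X_N) w_N(X, Y) a(Y_1) ⋯ a(Y_N)` is bounded. -/
def IsSecondQuantization {d k : ℕ} (w : Kernels d k) (W : Op d k) : Prop :=
  ∃ T : ℕ+ → Op d k, (∀ N, IsWickMonomial (w N) (T N)) ∧ HasSum T W

/-! ### Weighted Sobolev norms -/

section Sobolev

variable {ι : Type} [Fintype ι] [DecidableEq ι]

/-- The operator `-∂²/∂x_j² + (x_j - y_j)² + 1` on Schwartz functions. -/
def harmOp (y : EuclideanSpace ℝ ι) (j : ι) :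
    𝓢(EuclideanSpace ℝ ι, ℂ) →L[ℂ] 𝓢(EuclideanSpace ℝ ι, ℂ) :=
  -(lineDerivOpCLM ℂ 𝓢(EuclideanSpace ℝ ι, ℂ) (EuclideanSpace.single j (1 : ℝ)) ∘L
      lineDerivOpCLM ℂ 𝓢(EuclideanSpace ℝ ι, ℂ) (EuclideanSpace.single j (1 : ℝ)))
    + SchwartzMap.smulLeftCLM ℂ (fun x : EuclideanSpace ℝ ι => (((x j - y j) ^ 2 : ℝ) : ℂ))
    + ContinuousLinearMap.id ℂ _

theorem hasTemperateGrowth_sq (y : EuclideanSpace ℝ ι) (j : ι) :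
    (fun x : EuclideanSpace ℝ ι => (((x j - y j) ^ 2 : ℝ) : ℂ)).HasTemperateGrowth := by
  have h1 : (fun x : EuclideanSpace ℝ ι => x j).HasTemperateGrowth :=
    (EuclideanSpace.proj (𝕜 := ℝ) j : EuclideanSpace ℝ ι →L[ℝ] ℝ).hasTemperateGrowth
  fun_prop

theorem harmOp_apply (y : EuclideanSpace ℝ ι) (j : ι) (φ : 𝓢(EuclideanSpace ℝ ι, ℂ))
    (x : EuclideanSpace ℝ ι) :
    harmOp y j φ x =
      -lineDeriv ℝ (fun z => lineDeriv ℝ φ z (EuclideanSpace.single j 1)) x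
          (EuclideanSpace.single j 1)
        + (((x j - y j) ^ 2 : ℝ) : ℂ) * φ x + φ x := by
  have h2 := SchwartzMap.smulLeftCLM_apply_apply (F := ℂ) (hasTemperateGrowth_sq y j) φ x
  have h3 : ∀ ψ : 𝓢(EuclideanSpace ℝ ι, ℂ), (∂_{EuclideanSpace.single j (1 : ℝ)} ψ) x =
      lineDeriv ℝ ψ x (EuclideanSpace.single j 1) := fun ψ => SchwartzMap.lineDerivOp_apply _ ψ x
  have h4 : (fun z => lineDeriv ℝ φ z (EuclideanSpace.single j 1)) =
      ⇑(∂_{EuclideanSpace.single j (1 : ℝ)} φ : 𝓢(EuclideanSpace ℝ ι, ℂ)) :=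
    funext fun z => (SchwartzMap.lineDerivOp_apply _ φ z).symm
  rw [h4, ← h3, ← smul_eq_mul, ← h2]
  rfl

/-- The operator `∏_j (-∂²/∂x_j² + (x_j - y_j)² + 1)³` on Schwartz functions. (The factors
commute, so the order of the product is immaterial.) -/
def harmProd (y : EuclideanSpace ℝ ι) :
    𝓢(EuclideanSpace ℝ ι, ℂ) →L[ℂ] 𝓢(EuclideanSpace ℝ ι, ℂ) :=
  ((Finset.univ : Finset ι).toList.map fun j => harmOp y j ^ 3).prod

/-- With `M` the number of variables and `B = ∏_j (-∂²/∂x_j² + (x_j - y_j)² + 1)³`, the norm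
`2^{-3M/2} ⟨f, B f⟩^{1/2}` of `f ∈ L²(ℝ^M)`, with values in `[0, ∞]`. The positive quadratic form
`⟨f, B f⟩` is understood weakly, by duality with Schwartz functions:
`⟨f, B f⟩^{1/2} = sup { |⟨f, B φ⟩| : φ Schwartz, ⟨φ, B φ⟩ ≤ 1 }`.
For Schwartz `f` this is the literal expression (by the Cauchy-Schwarz inequality for the form
of `B`), and in general it is the closure of that form; it is finite exactly on the weighted Sobolev
space which is the completion of the Schwartz functions. -/
def sobolevNorm (y : EuclideanSpace ℝ ι)
    (f : Lp ℂ 2 (volume : Measure (EuclideanSpace ℝ ι))) : ℝ≥0∞ :=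
  (2 : ℝ≥0∞) ^ (-(3 * (Fintype.card ι : ℝ) / 2)) *
    ⨆ (φ : 𝓢(EuclideanSpace ℝ ι, ℂ))
      (_ : (∫ x, starRingEnd ℂ (φ x) * harmProd y φ x).re ≤ 1),
      ‖∫ x, starRingEnd ℂ (f x) * harmProd y φ x‖ₑ

end Sobolev

/-- The norm `‖f‖'_M`, with weights centred at the origin. -/
def normP {d N : ℕ} (f : KernelFun d N) : ℝ≥0∞ := sobolevNorm 0 f

/-- The translation invariant functional `‖f‖''_M`, the infimum over all centres. -/
def normPP {d N : ℕ} (f : KernelFun d N) : ℝ≥0∞ :=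
  ⨅ y : EuclideanSpace ℝ ((Fin N ⊕ Fin N) × Fin d), sobolevNorm y f

/-- `‖w‖' = ∑_{N ≥ 1} N 2^{(d+2)N} ∑_{s, r, s', r'} ‖w_N((·, s, r), (·, s', r'))‖'_{2dN}`. -/
def kernelNormP {d k : ℕ} (w : Kernels d k) : ℝ≥0∞ :=
  ∑' N : ℕ+, ((N : ℕ) : ℝ≥0∞) * 2 ^ ((d + 2) * (N : ℕ)) *
    ∑ s : Fin N → Label k, ∑ s' : Fin N → Label k, normP (w N s s')

/-- `‖w‖''`, defined like `‖w‖'` with `‖·‖''_{2dN}` instead of `‖·‖'_{2dN}`. -/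
def kernelNormPP {d k : ℕ} (w : Kernels d k) : ℝ≥0∞ :=
  ∑' N : ℕ+, ((N : ℕ) : ℝ≥0∞) * 2 ^ ((d + 2) * (N : ℕ)) *
    ∑ s : Fin N → Label k, ∑ s' : Fin N → Label k, normPP (w N s s')

/-! ### The Dyson series -/

/-- The interaction picture `W(t) = α⁰_{-t}(W)`. -/
def interactionPicture {d k : ℕ} (W : Op d k) (t : ℝ) : Op d k := freeDynamics d k (-t) W

/-- The multiple commutator `[W(t_m), …, [W(t_1), a] … ]`. -/
def multiComm {d k : ℕ} (W a : Op d k) : (m : ℕ) → (Fin m → ℝ) → Op d k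
  | 0, _ => a
  | m + 1, τ => ⁅interactionPicture W (τ (Fin.last m)), multiComm W a m fun j => τ j.castSucc⁆

/-- The domain of integration: `t > t_m > ⋯ > t_1 > 0` for positive `t`, and
`0 > t_1 > ⋯ > t_m > t` for negative `t` (a single point for `m = 0`). -/
def timeSimplex (m : ℕ) (t : ℝ) : Set (Fin m → ℝ) :=
  {τ | (StrictMono τ ∧ ∀ j, 0 < τ j ∧ τ j < t) ∨ (StrictAnti τ ∧ ∀ j, t < τ j ∧ τ j < 0)}

/-- `D_m(t) a`, the integral of `[W(t_m), …, [W(t_1), a] … ]` over ordered times. -/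
def dyson {d k : ℕ} (W : Op d k) (m : ℕ) (t : ℝ) (a : Op d k) : Op d k :=
  ∫ τ in timeSimplex m t, multiComm W a m τ

end FreeFermions

end

/-! The operators are expanded in products of creation and annihilation operators of Hermite
functions. Time-ordered commutators of such products are then controlled by a branching argument
that uses only the anticommutation relations and the decay in time of one-particle scalar products.

Branching. Let V(t) = Σ_i w_i ψ(x_1,t)⋯ψ(x_{2N},t), with fields of norm at most 1 whose
anticommutators are scalars c. Since the products are even, [V(r), ·] acts on a product of older
fields as a derivation. Its action on one field q is a sum of terms in which one field of V(r) is
contracted with q to a scalar and the others take the place of q, so repeated commutators grow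
trees. Give each field q the mass u_q(t) = 1 + ∫_t^∞ rate_q(r) dr. Here rate_q(r) is Φ⁻¹ times the
total strength of the contractions of q with V(r), where every uncontracted new field x counts with
the weight 2b(x). The product rule -(∏ u_q)' = Σ_q rate_q ∏_{p≠q} u_p has the same structure as the
derivation. Induction on m, peeling off the earliest time, therefore bounds the ordered time
integral of the norm of an m-fold commutator by Φ^m ∏ u_q (`FieldSystem.adMass_mono_le`). No
factorial appears, because the sum over the fields that can be hit is absorbed in the derivative of
a product. The scheme closes if a new field satisfies u_x ≤ 2b(x). This follows from ∫|c(x,y;t,s)|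
dt ≤ κ b(x) b(y), as soon as κ times the sum of |w_i| · (number of fields) · ∏ 2b is at most 2Φ
(`FieldSystem.branch_le`).

Decay. The dispersive estimate bounds ⟨f, e^{itΔ}g⟩ by (4π|t|)^{-d/2} ‖f‖₁ ‖g‖₁, and a Hermite
function on ℝ^d has ‖h_n‖₁ ≤ (2π)^{d/2} b(n) with b(n) = ∏ (n_j+1)^{1/2}. Together with the trivial
bound 1, the scalar products are at most min(1, (π b b'/|t|)^{d/2}). For d ≥ 3 this is integrable,
with integral at most κ b b' for κ = πd/(d-2) (`lintegral_inner_hermLp_le`).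

Coefficients. The Hermite functions of M variables are eigenfunctions of B with eigenvalues 8^M
b(n)^6. By duality and Σ b(n)⁻⁴ ≤ 2^M, the sum Σ |⟨h_n,f⟩| b(n) is at most 2^{M/2} times the Sobolev
norm of f (`tsum_coeff_le`). For M = 2dN this factor is 2^{dN}; the doubled weights of 2N fields
contribute 2^{2N}, and half the number of fields is N. The product N 2^{(d+2)N} is the factor in the
norm of a family of kernels. Hence Φ = κ‖w‖ is admissible and the integral is at most (κ‖w‖)^m ‖a‖,
which is stronger than the claim since m ≤ 8^m.

Operators and centres. The Hermite monomials have norm at most 1, so the expansions converge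
absolutely in operator norm. Their matrix elements are the required ones because, for
finite-particle vectors, a matrix element is an L²-continuous functional of the kernel; these
elements determine the operator. All bounds are uniform in the centres of the Hermite functions, so
for the translation-invariant functional every kernel gets its own nearly optimal centre. Negative
times are the same argument for the reversed dynamics. -/

noncomputable section

namespace FreeFermions

/-! ### Iterated commutators of Wick-ordered fields -/

/-- The set of times `t < τ_0 < τ_1 < ⋯ < τ_{m-1}`. -/
def orderedTimes (m : ℕ) (t : ℝ) : Set (Fin m → ℝ) := {τ | StrictMono τ ∧ ∀ j, t < τ j}

theorem measurableSet_strictMono (m : ℕ) : MeasurableSet {τ : Fin m → ℝ | StrictMono τ} := by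
  have : {τ : Fin m → ℝ | StrictMono τ} = ⋂ (i) (j) (_ : i < j), {τ | τ i < τ j} := by
    ext τ
    simp [StrictMono]
  rw [this]
  refine MeasurableSet.iInter fun i => MeasurableSet.iInter fun j => MeasurableSet.iInter fun _ =>
    measurableSet_lt (measurable_pi_apply i) (measurable_pi_apply j)

theorem measurableSet_orderedTimes (m : ℕ) (t : ℝ) : MeasurableSet (orderedTimes m t) := by
  refine (measurableSet_strictMono m).inter ?_
  have : {τ : Fin m → ℝ | ∀ j, t < τ j} = ⋂ j, {τ | t < τ j} := by ext; simp
  change MeasurableSet {τ : Fin m → ℝ | ∀ j, t < τ j}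
  rw [this]
  exact MeasurableSet.iInter fun j => measurableSet_lt measurable_const (measurable_pi_apply j)

theorem cons_mem_orderedTimes {m : ℕ} {t r : ℝ} {τ : Fin m → ℝ} :
    (Fin.cons r τ : Fin (m + 1) → ℝ) ∈ orderedTimes (m + 1) t ↔
      t < r ∧ τ ∈ orderedTimes m r := by
  constructor
  · rintro ⟨h1, h2⟩
    refine ⟨by simpa using h2 0, fun i j hij => ?_, fun j => ?_⟩
    · simpa using h1 (Fin.succ_lt_succ_iff.2 hij)
    · simpa using h1 (Fin.succ_pos j)
  · rintro ⟨h1, h2, h3⟩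
    refine ⟨fun i j hij => ?_, fun j => ?_⟩
    · cases i using Fin.cases with
      | zero =>
        cases j using Fin.cases with
        | zero => exact absurd hij (lt_irrefl _)
        | succ j => simpa using h3 j
      | succ i =>
        cases j using Fin.cases with
        | zero => exact absurd hij (Fin.not_lt_zero _)
        | succ j => simpa using h2 (Fin.succ_lt_succ_iff.1 hij)
    · cases j using Fin.cases with
      | zero => simpa using h1
      | succ j => simpa using h1.trans (h3 j)

theorem lintegral_finCons {m : ℕ} {f : (Fin (m + 1) → ℝ) → ℝ≥0∞} (hf : Measurable f) :
    ∫⁻ τ, f τ = ∫⁻ r, ∫⁻ τ : Fin m → ℝ, f (Fin.cons r τ) := by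
  have h := (volume_preserving_piFinSuccAbove (fun _ : Fin (m + 1) => ℝ) 0).symm
  rw [← h.lintegral_comp hf]
  refine (lintegral_prod _ (hf.comp h.measurable).aemeasurable).trans ?_
  simp [MeasurableEquiv.piFinSuccAbove, Fin.insertNthEquiv]

/-- Tonelli with the earliest time singled out. That time sits in the innermost commutator, so this
slicing allows an induction in which the operator acted upon changes. -/
theorem setLIntegral_orderedTimes_succ {m : ℕ} (t : ℝ) {f : (Fin (m + 1) → ℝ) → ℝ≥0∞}
    (hf : Measurable f) :
    ∫⁻ τ in orderedTimes (m + 1) t, f τ =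
      ∫⁻ r in Set.Ioi t, ∫⁻ τ in orderedTimes m r, f (Fin.cons r τ) := by
  rw [← lintegral_indicator (measurableSet_orderedTimes _ _),
    lintegral_finCons (hf.indicator (measurableSet_orderedTimes _ _)),
    ← lintegral_indicator measurableSet_Ioi]
  refine lintegral_congr fun r => ?_
  by_cases hr : t < r
  · rw [Set.indicator_of_mem (show r ∈ Set.Ioi t from hr),
      ← lintegral_indicator (measurableSet_orderedTimes _ _)]
    refine lintegral_congr fun τ => ?_
    classical
    simp only [Set.indicator_apply, cons_mem_orderedTimes, hr, true_and]
  · rw [Set.indicator_of_notMem (show r ∉ Set.Ioi t from hr)]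
    simp [cons_mem_orderedTimes, hr]

/-- Monotonicity is also the source of the measurability of all tail integrals below. -/
theorem antitone_setLIntegral_Ioi (f : ℝ → ℝ≥0∞) : Antitone fun t => ∫⁻ r in Set.Ioi t, f r :=
  fun _ _ h => lintegral_mono_set (Set.Ioi_subset_Ioi h)

/-- The product is an integral over the quadrant (t,∞)², which is cut along its diagonal. This is
integration by parts for tail integrals, valid even when they are infinite. -/
theorem lintegral_Ioi_mul_lintegral_Ioi {f g : ℝ → ℝ≥0∞} (hf : Measurable f) (hg : Measurable g)
    (t : ℝ) :
    (∫⁻ r in Set.Ioi t, f r) * ∫⁻ r in Set.Ioi t, g r =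
      (∫⁻ r in Set.Ioi t, f r * ∫⁻ s in Set.Ioi r, g s) +
        ∫⁻ r in Set.Ioi t, (∫⁻ s in Set.Ioi r, f s) * g r := by
  have hsplit : ∀ r ∈ Set.Ioi t, ∫⁻ s in Set.Ioi t, g s =
      (∫⁻ s in Set.Ioi t, (Set.Iic r).indicator g s) + ∫⁻ s in Set.Ioi r, g s := by
    intro r hr
    rw [lintegral_indicator measurableSet_Iic, Measure.restrict_restrict measurableSet_Iic,
      ← lintegral_union measurableSet_Ioi]
    · congr 2
      rw [Set.inter_comm, Set.Ioi_inter_Iic, Set.Ioc_union_Ioi_eq_Ioi (le_of_lt hr)]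
    · exact Set.disjoint_left.2 fun x hx hx' => not_lt.2 hx.1 (show r < x from hx')
  have hmI : Measurable fun p : ℝ × ℝ => f p.1 * (Set.Iic p.1).indicator g p.2 := by
    refine (hf.comp measurable_fst).mul ?_
    have : (fun p : ℝ × ℝ => (Set.Iic p.1).indicator g p.2) =
        {p : ℝ × ℝ | p.2 ≤ p.1}.indicator fun p => g p.2 := by
      ext p
      simp [Set.indicator_apply]
    rw [this]
    exact (hg.comp measurable_snd).indicator (measurableSet_le measurable_snd measurable_fst)
  rw [← lintegral_mul_const _ hf]
  have h1 : ∫⁻ r in Set.Ioi t, f r * ∫⁻ s in Set.Ioi t, g s =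
      ∫⁻ r in Set.Ioi t, ((∫⁻ s in Set.Ioi t, f r * (Set.Iic r).indicator g s) +
        f r * ∫⁻ s in Set.Ioi r, g s) := by
    refine setLIntegral_congr_fun measurableSet_Ioi fun r hr => ?_
    rw [hsplit r hr, mul_add, lintegral_const_mul _ (hg.indicator measurableSet_Iic)]
  rw [h1, lintegral_add_right _
    (show Measurable fun r => f r * ∫⁻ s in Set.Ioi r, g s from
      hf.mul (antitone_setLIntegral_Ioi g).measurable), add_comm]
  congr 1
  -- On the half s ≤ r of the quadrant the variable r becomes the inner one. Its range s ≤ r differs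
  -- from s < r by a null set.
  rw [lintegral_lintegral_swap hmI.aemeasurable]
  refine setLIntegral_congr_fun measurableSet_Ioi fun s hs => ?_
  have : ∀ r, f r * (Set.Iic r).indicator g s = (Set.Ici s).indicator f r * g s := by
    intro r
    by_cases h : s ≤ r <;> simp [h]
  simp only [this]
  rw [lintegral_mul_const _ (hf.indicator measurableSet_Ici),
    lintegral_indicator measurableSet_Ici, Measure.restrict_restrict measurableSet_Ici,
    Set.inter_eq_left.2 (show Set.Ici s ⊆ Set.Ioi t from Set.Ici_subset_Ioi.2 hs),
    restrict_Ioi_eq_restrict_Ici]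

/-- Leibniz rule in integrated form: for u = 1 + ∫_t^∞ f and v = 1 + ∫_t^∞ g one has -(uv)' = f v +
u g. The summands 1 stand for branches that never grow. -/
theorem one_add_lintegral_mul_one_add_lintegral {f g : ℝ → ℝ≥0∞} (hf : Measurable f)
    (hg : Measurable g) (t : ℝ) :
    (1 + ∫⁻ r in Set.Ioi t, f r) * (1 + ∫⁻ r in Set.Ioi t, g r) =
      1 + ∫⁻ r in Set.Ioi t,
        (f r * (1 + ∫⁻ s in Set.Ioi r, g s) + (1 + ∫⁻ s in Set.Ioi r, f s) * g r) := by
  have e : ∀ r, f r * (1 + ∫⁻ s in Set.Ioi r, g s) + (1 + ∫⁻ s in Set.Ioi r, f s) * g r =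
      (f r + g r) + (f r * (∫⁻ s in Set.Ioi r, g s) + (∫⁻ s in Set.Ioi r, f s) * g r) :=
    fun r => by ring
  simp only [e]
  rw [lintegral_add_left (show Measurable fun r => f r + g r from hf.add hg),
    lintegral_add_left hf,
    lintegral_add_left (show Measurable fun r => f r * ∫⁻ s in Set.Ioi r, g s from
      hf.mul (antitone_setLIntegral_Ioi g).measurable),
    ← lintegral_Ioi_mul_lintegral_Ioi hf hg]
  ring

/-! ### Iterated commutators in a normed algebra and their time-integrated norms -/

section Ad

variable {𝔄 : Type*} [NormedRing 𝔄] [NormedAlgebra ℂ 𝔄]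

/-- The commutator `A ↦ [X, A]`. -/
def adL (X : 𝔄) : 𝔄 →L[ℂ] 𝔄 := ContinuousLinearMap.mul ℂ 𝔄 X - (ContinuousLinearMap.mul ℂ 𝔄).flip X

theorem adL_apply (X A : 𝔄) : adL X A = ⁅X, A⁆ := rfl

theorem continuous_adL : Continuous (adL : 𝔄 → 𝔄 →L[ℂ] 𝔄) :=
  (ContinuousLinearMap.mul ℂ 𝔄).continuous.sub (ContinuousLinearMap.mul ℂ 𝔄).flip.continuous

/-- The iterated commutator `A ↦ [V(τ_{m-1}), …, [V(τ_0), A] … ]`. -/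
def iterAd (V : ℝ → 𝔄) : (m : ℕ) → (Fin m → ℝ) → 𝔄 →L[ℂ] 𝔄
  | 0, _ => ContinuousLinearMap.id ℂ 𝔄
  | m + 1, τ => adL (V (τ (Fin.last m))) ∘L iterAd V m fun j => τ j.castSucc

theorem iterAd_succ (V : ℝ → 𝔄) (m : ℕ) (τ : Fin (m + 1) → ℝ) (A : 𝔄) :
    iterAd V (m + 1) τ A = ⁅V (τ (Fin.last m)), iterAd V m (fun j => τ j.castSucc) A⁆ := rfl

/-- The definition peels off the latest time, but the recursion for `adMass` needs the earliest one,
which acts on A first. -/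
theorem iterAd_succ' (V : ℝ → 𝔄) (m : ℕ) (τ : Fin (m + 1) → ℝ) (A : 𝔄) :
    iterAd V (m + 1) τ A = iterAd V m (fun j => τ j.succ) ⁅V (τ 0), A⁆ := by
  induction m with
  | zero => rfl
  | succ m ih =>
    rw [iterAd_succ, ih, iterAd_succ]
    rfl

theorem continuous_iterAd {V : ℝ → 𝔄} (hV : Continuous V) (m : ℕ) : Continuous (iterAd V m) := by
  induction m with
  | zero => exact continuous_const
  | succ m ih =>
    exact (continuous_adL.comp (hV.comp (continuous_apply _))).clm_comp
      (ih.comp (continuous_pi fun j => continuous_apply _))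

/-- The integral of the norm of an iterated commutator over ordered times after `t`. -/
def adMass (V : ℝ → 𝔄) (m : ℕ) (t : ℝ) (A : 𝔄) : ℝ≥0∞ :=
  ∫⁻ τ in orderedTimes m t, ‖iterAd V m τ A‖ₑ

variable {V : ℝ → 𝔄}

theorem measurable_enorm_iterAd (hV : Continuous V) (m : ℕ) (A : 𝔄) :
    Measurable fun τ => ‖iterAd V m τ A‖ₑ :=
  (((continuous_iterAd hV m).clm_apply continuous_const).enorm).measurable

theorem adMass_zero (m : ℕ) (t : ℝ) : adMass V m t 0 = 0 := by simp [adMass]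

theorem adMass_add_le (hV : Continuous V) (m : ℕ) (t : ℝ) (A B : 𝔄) :
    adMass V m t (A + B) ≤ adMass V m t A + adMass V m t B := by
  rw [adMass, adMass, adMass, ← lintegral_add_left (measurable_enorm_iterAd hV m A)]
  refine lintegral_mono fun τ => ?_
  rw [map_add]
  exact enorm_add_le _ _

theorem adMass_smul (hV : Continuous V) (m : ℕ) (t : ℝ) (z : ℂ) (A : 𝔄) :
    adMass V m t (z • A) = ‖z‖ₑ * adMass V m t A := by
  rw [adMass, adMass, ← lintegral_const_mul _ (measurable_enorm_iterAd hV m A)]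
  simp [enorm_smul]

/-- Countable subadditivity, by continuity of the iterated commutator and Tonelli. It lets V and A
be expanded into monomials. -/
theorem adMass_hasSum_le {I : Type*} [Countable I] (hV : Continuous V) (m : ℕ) (t : ℝ)
    {f : I → 𝔄} {A : 𝔄} (h : HasSum f A) : adMass V m t A ≤ ∑' i, adMass V m t (f i) := by
  simp only [adMass]
  rw [← lintegral_tsum fun i => (measurable_enorm_iterAd hV m (f i)).aemeasurable]
  refine lintegral_mono fun τ => ?_
  rw [← ((iterAd V m τ).hasSum h).tsum_eq]
  exact enorm_tsum_le_tsum_enorm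

/-- The recursion that drives the tree expansion: the first commutator happens at some time r > t,
and the remaining ones after r. -/
theorem adMass_succ (hV : Continuous V) (m : ℕ) (t : ℝ) (A : 𝔄) :
    adMass V (m + 1) t A = ∫⁻ r in Set.Ioi t, adMass V m r ⁅V r, A⁆ := by
  simp only [adMass]
  rw [setLIntegral_orderedTimes_succ t (measurable_enorm_iterAd hV _ A)]
  simp only [iterAd_succ', Fin.cons_zero, Fin.cons_succ]

end Ad

/-- A family of fields `ψ(x, t)` of norm at most `1`, whose anticommutators are scalars
`c(x, y; t, s)`, integrable in time with `∫_s^∞ |c(x, y; t, s)| dt ≤ κ b(x) b(y)`. -/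
structure FieldSystem (𝔄 : Type*) [NormedRing 𝔄] [NormedAlgebra ℂ 𝔄] (Λ : Type*) where
  /-- the fields -/
  ψ : Λ → ℝ → 𝔄
  /-- the anticommutators -/
  c : Λ → Λ → ℝ → ℝ → ℂ
  /-- the weights -/
  b : Λ → ℝ≥0∞
  /-- the decay constant -/
  κ : ℝ≥0∞
  car : ∀ x y t s, ψ x t * ψ y s + ψ y s * ψ x t = c x y t s • 1
  norm_one_le : ‖(1 : 𝔄)‖ ≤ 1
  norm_le : ∀ x t, ‖ψ x t‖ ≤ 1
  continuous_ψ : ∀ x, Continuous (ψ x)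
  measurable_c : ∀ x y s, Measurable fun t => c x y t s
  one_le_b : ∀ x, 1 ≤ b x
  lintegral_c_le : ∀ x y s, ∫⁻ t in Set.Ioi s, ‖c x y t s‖ₑ ≤ κ * b x * b y

/-! ### Contractions of a field with a product of fields -/

namespace FieldSystem

variable {𝔄 : Type*} [NormedRing 𝔄] [NormedAlgebra ℂ 𝔄] {Λ : Type*} (F : FieldSystem 𝔄 Λ)

/-- The product of the fields in a list of indices and times. -/
def mono (S : List (Λ × ℝ)) : 𝔄 := (S.map fun q => F.ψ q.1 q.2).prod

/-- A product of fields at a common time. -/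
def monoAt (P : List Λ) (t : ℝ) : 𝔄 := F.mono (P.map fun x => (x, t))

theorem mono_nil : F.mono [] = 1 := rfl

theorem mono_cons (q : Λ × ℝ) (S : List (Λ × ℝ)) : F.mono (q :: S) = F.ψ q.1 q.2 * F.mono S := by
  simp [mono]

theorem mono_append (R S : List (Λ × ℝ)) : F.mono (R ++ S) = F.mono R * F.mono S := by
  simp [mono]

theorem monoAt_cons (x : Λ) (P : List Λ) (t : ℝ) :
    F.monoAt (x :: P) t = F.ψ x t * F.monoAt P t := by
  simp [monoAt, mono]

theorem continuous_monoAt (P : List Λ) : Continuous (F.monoAt P) := by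
  induction P with
  | nil => exact continuous_const
  | cons x P ih =>
    simp only [funext (F.monoAt_cons x P)]
    exact (F.continuous_ψ x).mul ih

theorem norm_monoAt_le (P : List Λ) (t : ℝ) : ‖F.monoAt P t‖ ≤ 1 := by
  induction P with
  | nil => exact F.norm_one_le
  | cons x P ih =>
    rw [monoAt_cons]
    exact (norm_mul_le _ _).trans (mul_le_one₀ (F.norm_le x t) (norm_nonneg _) ih)

/-- The product of the doubled weights. -/
def weight (P : List Λ) : ℝ≥0∞ := (P.map fun x => 2 * F.b x).prod

theorem weight_cons (x : Λ) (P : List Λ) : F.weight (x :: P) = 2 * F.b x * F.weight P := by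
  simp [weight]

/-- The graded commutator `P q - (-1)^{|P|} q P` of a product of fields and a field. -/
def gradedComm (q : Λ × ℝ) (t : ℝ) (P : List Λ) : 𝔄 :=
  F.monoAt P t * F.ψ q.1 q.2 - ((-1 : ℂ) ^ P.length) • (F.ψ q.1 q.2 * F.monoAt P t)

theorem gradedComm_nil (q : Λ × ℝ) (t : ℝ) : F.gradedComm q t [] = 0 := by
  simp [gradedComm, monoAt, mono]

/-- Moving q past the head x costs a sign and the scalar anticommutator. Either x stays uncontracted
on the left, or it disappears and leaves the tail. -/
theorem gradedComm_cons (q : Λ × ℝ) (t : ℝ) (x : Λ) (P : List Λ) :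
    F.gradedComm q t (x :: P) = F.ψ x t * F.gradedComm q t P +
      ((-1 : ℂ) ^ P.length * F.c x q.1 t q.2) • F.monoAt P t := by
  have h : F.c x q.1 t q.2 • F.monoAt P t =
      F.ψ x t * F.ψ q.1 q.2 * F.monoAt P t + F.ψ q.1 q.2 * F.ψ x t * F.monoAt P t := by
    rw [← add_mul, F.car, smul_mul_assoc, one_mul]
  rw [mul_smul, h, gradedComm, gradedComm, monoAt_cons, List.length_cons, pow_succ]
  simp only [mul_sub, mul_smul_comm, smul_add, mul_neg, mul_one, neg_smul, mul_assoc]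
  abel

/-- The total strength of the contractions of `q` with the members of a list. -/
def contraction (q : Λ × ℝ) (t : ℝ) : List Λ → ℝ≥0∞
  | [] => 0
  | x :: P => ‖F.c x q.1 t q.2‖ₑ * F.weight P + 2 * F.b x * contraction q t P

theorem measurable_contraction (q : Λ × ℝ) (P : List Λ) :
    Measurable fun t => F.contraction q t P := by
  induction P with
  | nil => exact measurable_const
  | cons x P ih =>
    exact ((F.measurable_c x q.1 q.2).enorm.mul_const _).add (ih.const_mul _)

/-- The contracted member x contributes κ b(x) b(q) in place of its weight 2b(x). Each of the terms,
one per member of P, is therefore half of κ b(q) times the full weight; the 2 on the left clears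
this half. -/
theorem lintegral_contraction_le (q : Λ × ℝ) (P : List Λ) :
    2 * ∫⁻ t in Set.Ioi q.2, F.contraction q t P ≤ F.κ * F.b q.1 * (P.length * F.weight P) := by
  induction P with
  | nil => simp [contraction]
  | cons x P ih =>
    simp only [contraction]
    rw [lintegral_add_left ((F.measurable_c x q.1 q.2).enorm.mul_const _),
      lintegral_mul_const _ (F.measurable_c x q.1 q.2).enorm,
      lintegral_const_mul _ (F.measurable_contraction q P), weight_cons, List.length_cons]
    calc _ = 2 * ((∫⁻ t in Set.Ioi q.2, ‖F.c x q.1 t q.2‖ₑ) * F.weight P) +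
          2 * F.b x * (2 * ∫⁻ t in Set.Ioi q.2, F.contraction q t P) := by ring
      _ ≤ 2 * ((F.κ * F.b x * F.b q.1) * F.weight P) +
          2 * F.b x * (F.κ * F.b q.1 * (P.length * F.weight P)) := by
        gcongr
        exact F.lintegral_c_le x q.1 q.2
      _ = _ := by push_cast; ring

/-! ### Branch masses and the tree expansion -/

section Growth

variable {I : Type*} (w : I → ℂ) (ℓ : I → List Λ) (Φ : ℝ≥0∞)

/-- The rate at which new branches grow out of the field `q`. -/
def rate (q : Λ × ℝ) (t : ℝ) : ℝ≥0∞ := Φ⁻¹ * ∑' i, ‖w i‖ₑ * F.contraction q t (ℓ i)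

/-- The total mass of the branches growing out of the field `q` after time `t`. -/
def branch (q : Λ × ℝ) (t : ℝ) : ℝ≥0∞ := 1 + ∫⁻ r in Set.Ioi t, F.rate w ℓ Φ q r

/-- The product of the masses of all branches. -/
def branches (S : List (Λ × ℝ)) (t : ℝ) : ℝ≥0∞ := (S.map fun q => F.branch w ℓ Φ q t).prod

/-- Minus the derivative of `branches`. -/
def branchesRate : List (Λ × ℝ) → ℝ → ℝ≥0∞
  | [], _ => 0
  | q :: S, t => F.rate w ℓ Φ q t * F.branches w ℓ Φ S t + F.branch w ℓ Φ q t * branchesRate S t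

theorem branches_cons (q : Λ × ℝ) (S : List (Λ × ℝ)) (t : ℝ) :
    F.branches w ℓ Φ (q :: S) t = F.branch w ℓ Φ q t * F.branches w ℓ Φ S t := by
  simp [branches]

theorem branches_append (R S : List (Λ × ℝ)) (t : ℝ) :
    F.branches w ℓ Φ (R ++ S) t = F.branches w ℓ Φ R t * F.branches w ℓ Φ S t := by
  simp [branches]

theorem measurable_branch (q : Λ × ℝ) : Measurable (F.branch w ℓ Φ q) :=
  (antitone_setLIntegral_Ioi _).measurable.const_add 1

theorem measurable_branches (S : List (Λ × ℝ)) : Measurable (F.branches w ℓ Φ S) := by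
  induction S with
  | nil => exact measurable_const
  | cons q S ih =>
    rw [funext (F.branches_cons w ℓ Φ q S)]
    exact (F.measurable_branch w ℓ Φ q).mul ih

variable [Countable I]

theorem measurable_rate (q : Λ × ℝ) : Measurable (F.rate w ℓ Φ q) :=
  (Measurable.tsum fun i => (F.measurable_contraction q (ℓ i)).const_mul _).const_mul _

theorem measurable_branchesRate (S : List (Λ × ℝ)) : Measurable (F.branchesRate w ℓ Φ S) := by
  induction S with
  | nil => exact measurable_const
  | cons q S ih =>
    exact ((F.measurable_rate w ℓ Φ q).mul (F.measurable_branches w ℓ Φ S)).add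
      ((F.measurable_branch w ℓ Φ q).mul ih)

/-- Fundamental theorem of calculus for the product of the masses: the Leibniz rule is applied
factor by factor, in the order in which `branchesRate` is defined. -/
theorem branches_eq (S : List (Λ × ℝ)) (t : ℝ) :
    F.branches w ℓ Φ S t = 1 + ∫⁻ r in Set.Ioi t, F.branchesRate w ℓ Φ S r := by
  induction S generalizing t with
  | nil => simp [branches, branchesRate]
  | cons q S ih =>
    rw [branches_cons, ih, branch, one_add_lintegral_mul_one_add_lintegral
      (F.measurable_rate w ℓ Φ q) (F.measurable_branchesRate w ℓ Φ S)]
    simp only [← ih]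
    rfl

variable {w ℓ Φ}

/-- The self-consistency of the scheme. The rate was defined with weights 2b for the new fields; by
the choice of Φ its integral is at most b(q), so the mass is at most 1 + b(q) ≤ 2b(q), using b ≥ 1.
-/
theorem branch_le (h0 : Φ ≠ 0) (h1 : Φ ≠ ∞)
    (hΦ : F.κ * ∑' i, ‖w i‖ₑ * ((ℓ i).length * F.weight (ℓ i)) ≤ 2 * Φ) (q : Λ × ℝ) {t : ℝ}
    (ht : q.2 ≤ t) : F.branch w ℓ Φ q t ≤ 2 * F.b q.1 := by
  have key : ∫⁻ r in Set.Ioi t, F.rate w ℓ Φ q r ≤ F.b q.1 := by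
    refine (antitone_setLIntegral_Ioi _ ht).trans ?_
    simp only [rate]
    rw [lintegral_const_mul _ (Measurable.tsum fun i =>
        (F.measurable_contraction q (ℓ i)).const_mul _),
      lintegral_tsum fun i => ((F.measurable_contraction q (ℓ i)).const_mul _).aemeasurable]
    simp only [fun i => lintegral_const_mul ‖w i‖ₑ (F.measurable_contraction q (ℓ i))
      (μ := volume.restrict (Set.Ioi q.2))]
    rw [ENNReal.inv_mul_le_iff h0 h1]
    refine (ENNReal.mul_le_mul_iff_right two_ne_zero ENNReal.ofNat_ne_top).1 ?_
    calc 2 * ∑' i, ‖w i‖ₑ * ∫⁻ t in Set.Ioi q.2, F.contraction q t (ℓ i)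
        = ∑' i, ‖w i‖ₑ * (2 * ∫⁻ t in Set.Ioi q.2, F.contraction q t (ℓ i)) := by
          rw [← ENNReal.tsum_mul_left]
          exact tsum_congr fun i => by ring
      _ ≤ ∑' i, ‖w i‖ₑ * (F.κ * F.b q.1 * ((ℓ i).length * F.weight (ℓ i))) := by
          exact ENNReal.tsum_le_tsum fun i => mul_le_mul_right (F.lintegral_contraction_le q _) _
      _ = F.b q.1 * (F.κ * ∑' i, ‖w i‖ₑ * ((ℓ i).length * F.weight (ℓ i))) := by
          rw [← ENNReal.tsum_mul_left, ← ENNReal.tsum_mul_left]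
          exact tsum_congr fun i => by ring
      _ ≤ F.b q.1 * (2 * Φ) := by gcongr
      _ = 2 * (Φ * F.b q.1) := by ring
  calc F.branch w ℓ Φ q t ≤ F.b q.1 + F.b q.1 := add_le_add (F.one_le_b _) key
    _ = 2 * F.b q.1 := (two_mul _).symm

/-- Applies to fields just created by a commutator at time t, and to the initial operator at time 0.
-/
theorem branches_monoAt_le (h0 : Φ ≠ 0) (h1 : Φ ≠ ∞)
    (hΦ : F.κ * ∑' i, ‖w i‖ₑ * ((ℓ i).length * F.weight (ℓ i)) ≤ 2 * Φ) (P : List Λ) (t : ℝ) :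
    F.branches w ℓ Φ (P.map fun x => (x, t)) t ≤ F.weight P := by
  induction P with
  | nil => simp [branches, weight]
  | cons x P ih =>
    rw [List.map_cons, branches_cons, weight_cons]
    exact mul_le_mul' (F.branch_le h0 h1 hΦ (x, t) le_rfl) ih

variable {V : ℝ → 𝔄}

/-- Every contraction leaves a product of fields no younger than t, to which the bound for m
commutators applies. The left factor R is arbitrary because the expansion shifts the uncontracted
heads of P, one by one, to the left. -/
theorem adMass_gradedComm_le (hV : Continuous V) (h0 : Φ ≠ 0) (h1 : Φ ≠ ∞)
    (hΦ : F.κ * ∑' i, ‖w i‖ₑ * ((ℓ i).length * F.weight (ℓ i)) ≤ 2 * Φ) (m : ℕ) (t : ℝ)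
    (ih : ∀ S : List (Λ × ℝ), (∀ q ∈ S, q.2 ≤ t) →
      adMass V m t (F.mono S) ≤ Φ ^ m * F.branches w ℓ Φ S t)
    (q : Λ × ℝ) (P : List Λ) (S : List (Λ × ℝ)) (hS : ∀ q ∈ S, q.2 ≤ t)
    (R : List (Λ × ℝ)) (hR : ∀ q ∈ R, q.2 ≤ t) :
    adMass V m t (F.mono R * F.gradedComm q t P * F.mono S) ≤
      Φ ^ m * (F.branches w ℓ Φ R t * F.contraction q t P * F.branches w ℓ Φ S t) := by
  induction P generalizing R with
  | nil => simp [gradedComm_nil, adMass_zero]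
  | cons x P hP =>
    have e : F.mono R * F.gradedComm q t (x :: P) * F.mono S =
        F.mono (R ++ [(x, t)]) * F.gradedComm q t P * F.mono S +
          ((-1 : ℂ) ^ P.length * F.c x q.1 t q.2) •
            F.mono (R ++ (P.map fun x => (x, t)) ++ S) := by
      rw [gradedComm_cons, mono_append, mono_append, mono_append, mono_cons, mono_nil, mul_one,
        mul_add, add_mul, mul_smul_comm, smul_mul_assoc]
      simp only [mul_assoc, monoAt]
    rw [e]
    refine (adMass_add_le hV m t _ _).trans ?_
    rw [adMass_smul hV]
    have hRx : ∀ p ∈ R ++ [(x, t)], p.2 ≤ t := by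
      intro p hp
      rcases List.mem_append.1 hp with hp | hp
      · exact hR p hp
      · rw [List.mem_singleton.1 hp]
    have hall : ∀ p ∈ R ++ (P.map fun x => (x, t)) ++ S, p.2 ≤ t := by
      intro p hp
      rcases List.mem_append.1 hp with hp | hp
      · rcases List.mem_append.1 hp with hp | hp
        · exact hR p hp
        · obtain ⟨y, -, rfl⟩ := List.mem_map.1 hp
          exact le_rfl
      · exact hS p hp
    have hn : ‖(-1 : ℂ) ^ P.length * F.c x q.1 t q.2‖ₑ = ‖F.c x q.1 t q.2‖ₑ := by
      simp [enorm_mul, enorm_pow]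
    rw [hn]
    calc _ ≤ Φ ^ m * (F.branches w ℓ Φ (R ++ [(x, t)]) t * F.contraction q t P *
            F.branches w ℓ Φ S t) + ‖F.c x q.1 t q.2‖ₑ *
            (Φ ^ m * F.branches w ℓ Φ (R ++ (P.map fun x => (x, t)) ++ S) t) := by
          gcongr
          · exact hP _ hRx
          · exact ih _ hall
      _ ≤ Φ ^ m * (F.branches w ℓ Φ R t * (2 * F.b x) * F.contraction q t P *
            F.branches w ℓ Φ S t) + ‖F.c x q.1 t q.2‖ₑ *
            (Φ ^ m * (F.branches w ℓ Φ R t * F.weight P * F.branches w ℓ Φ S t)) := by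
          rw [branches_append, branches_append, branches_append]
          gcongr
          · simpa [branches] using F.branch_le h0 h1 hΦ (x, t) le_rfl
          · exact F.branches_monoAt_le h0 h1 hΦ P t
      _ = _ := by rw [contraction]; ring

/-- For products of even length the graded commutator is the commutator. The sum of all contractions
is Φ times the rate, which accounts for the additional power of Φ. -/
theorem adMass_commutator_field_le (hV : Continuous V) (h0 : Φ ≠ 0) (h1 : Φ ≠ ∞)
    (hΦ : F.κ * ∑' i, ‖w i‖ₑ * ((ℓ i).length * F.weight (ℓ i)) ≤ 2 * Φ)
    (hℓ : ∀ i, Even (ℓ i).length) (m : ℕ) (t : ℝ)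
    (hsum : HasSum (fun i => w i • F.monoAt (ℓ i) t) (V t))
    (ih : ∀ S : List (Λ × ℝ), (∀ q ∈ S, q.2 ≤ t) →
      adMass V m t (F.mono S) ≤ Φ ^ m * F.branches w ℓ Φ S t)
    (q : Λ × ℝ) (S : List (Λ × ℝ)) (hS : ∀ q ∈ S, q.2 ≤ t)
    (R : List (Λ × ℝ)) (hR : ∀ q ∈ R, q.2 ≤ t) :
    adMass V m t (F.mono R * ⁅V t, F.ψ q.1 q.2⁆ * F.mono S) ≤
      Φ ^ (m + 1) * (F.branches w ℓ Φ R t * F.rate w ℓ Φ q t * F.branches w ℓ Φ S t) := by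
  have hs : HasSum (fun i => w i • (F.mono R * F.gradedComm q t (ℓ i) * F.mono S))
      (F.mono R * ⁅V t, F.ψ q.1 q.2⁆ * F.mono S) := by
    have := (((hsum.mul_right (F.ψ q.1 q.2)).sub (hsum.mul_left (F.ψ q.1 q.2))).mul_left
      (F.mono R)).mul_right (F.mono S)
    rw [Ring.lie_def]
    refine (funext fun i => ?_ : (fun i => _) = fun i => _) ▸ this
    simp only [gradedComm, (hℓ i).neg_one_pow, one_smul, mul_smul_comm, smul_mul_assoc, mul_sub,
      sub_mul, smul_sub]
  refine (adMass_hasSum_le hV m t hs).trans ?_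
  calc _ ≤ ∑' i, ‖w i‖ₑ * (Φ ^ m * (F.branches w ℓ Φ R t * F.contraction q t (ℓ i) *
          F.branches w ℓ Φ S t)) := by
        refine ENNReal.tsum_le_tsum fun i => ?_
        rw [adMass_smul hV]
        gcongr
        exact F.adMass_gradedComm_le hV h0 h1 hΦ m t ih q (ℓ i) S hS R hR
    _ = Φ ^ m * F.branches w ℓ Φ R t * F.branches w ℓ Φ S t *
          ∑' i, ‖w i‖ₑ * F.contraction q t (ℓ i) := by
        rw [← ENNReal.tsum_mul_left]
        exact tsum_congr fun i => by ring
    _ = Φ ^ m * F.branches w ℓ Φ R t * F.branches w ℓ Φ S t *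
          ((Φ * Φ⁻¹) * ∑' i, ‖w i‖ₑ * F.contraction q t (ℓ i)) := by
        rw [ENNReal.mul_inv_cancel h0 h1, one_mul]
    _ = _ := by rw [rate, pow_succ]; ring

/-- The commutator is a derivation, and its product rule matches the recursive definition of
`branchesRate` term by term. -/
theorem adMass_commutator_mono_le (hV : Continuous V) (h0 : Φ ≠ 0) (h1 : Φ ≠ ∞)
    (hΦ : F.κ * ∑' i, ‖w i‖ₑ * ((ℓ i).length * F.weight (ℓ i)) ≤ 2 * Φ)
    (hℓ : ∀ i, Even (ℓ i).length) (m : ℕ) (t : ℝ)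
    (hsum : HasSum (fun i => w i • F.monoAt (ℓ i) t) (V t))
    (ih : ∀ S : List (Λ × ℝ), (∀ q ∈ S, q.2 ≤ t) →
      adMass V m t (F.mono S) ≤ Φ ^ m * F.branches w ℓ Φ S t)
    (S : List (Λ × ℝ)) (hS : ∀ q ∈ S, q.2 ≤ t) (R : List (Λ × ℝ)) (hR : ∀ q ∈ R, q.2 ≤ t) :
    adMass V m t (F.mono R * ⁅V t, F.mono S⁆) ≤
      Φ ^ (m + 1) * (F.branches w ℓ Φ R t * F.branchesRate w ℓ Φ S t) := by
  induction S generalizing R with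
  | nil => simp [mono_nil, Ring.lie_def, adMass_zero]
  | cons q S hind =>
    have hS' : ∀ p ∈ S, p.2 ≤ t := fun p hp => hS p (List.mem_cons_of_mem _ hp)
    have hRq : ∀ p ∈ R ++ [q], p.2 ≤ t := by
      intro p hp
      rcases List.mem_append.1 hp with hp | hp
      · exact hR p hp
      · rw [List.mem_singleton.1 hp]
        exact hS q List.mem_cons_self
    have e : F.mono R * ⁅V t, F.mono (q :: S)⁆ =
        F.mono R * ⁅V t, F.ψ q.1 q.2⁆ * F.mono S + F.mono (R ++ [q]) * ⁅V t, F.mono S⁆ := by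
      rw [mono_append, mono_cons, mono_cons, mono_nil]
      simp only [Ring.lie_def]
      noncomm_ring
    rw [e]
    refine (adMass_add_le hV m t _ _).trans ?_
    refine (add_le_add (F.adMass_commutator_field_le hV h0 h1 hΦ hℓ m t hsum ih q S hS' R hR)
      (hind hS' _ hRq)).trans (le_of_eq ?_)
    rw [branches_append, branchesRate]
    have h1 : F.branches w ℓ Φ [q] t = F.branch w ℓ Φ q t := by simp [branches]
    rw [h1]
    ring

/-- The tree expansion of iterated commutators: the ordered time integrals of the iterated
commutators of a product of fields are bounded by the product of the masses of the branches. -/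
theorem adMass_mono_le (hV : Continuous V) (h0 : Φ ≠ 0) (h1 : Φ ≠ ∞)
    (hΦ : F.κ * ∑' i, ‖w i‖ₑ * ((ℓ i).length * F.weight (ℓ i)) ≤ 2 * Φ)
    (hℓ : ∀ i, Even (ℓ i).length) (hsum : ∀ t, HasSum (fun i => w i • F.monoAt (ℓ i) t) (V t))
    (m : ℕ) (t : ℝ) (S : List (Λ × ℝ)) (hS : ∀ q ∈ S, q.2 ≤ t) :
    adMass V m t (F.mono S) ≤ Φ ^ m * F.branches w ℓ Φ S t := by
  induction m generalizing t S with
  | zero =>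
    -- For m = 0 there is a single empty tuple of times, of measure 1. It remains to see that a
    -- product of fields has norm at most 1, while the product of the masses is at least 1.
    have hvol : (volume : Measure (Fin 0 → ℝ)) Set.univ = 1 := by
      rw [Measure.volume_pi_eq_dirac (fun i => i.elim0)]
      simp
    have hn : ‖F.mono S‖ₑ ≤ 1 := by
      have : ‖F.mono S‖ ≤ 1 := by
        clear hS
        induction S with
        | nil => exact F.norm_one_le
        | cons x P ih =>
          rw [mono_cons]
          exact (norm_mul_le _ _).trans (mul_le_one₀ (F.norm_le _ _) (norm_nonneg _) ih)
      rw [← ofReal_norm]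
      exact ENNReal.ofReal_le_one.2 this
    calc adMass V 0 t (F.mono S) ≤ ∫⁻ _ : Fin 0 → ℝ, 1 :=
          (lintegral_mono fun _ => hn).trans (setLIntegral_le_lintegral _ _)
      _ = 1 := by rw [lintegral_one, hvol]
      _ ≤ _ := by rw [branches_eq, pow_zero, one_mul]; exact le_self_add
  | succ m ih =>
    rw [adMass_succ hV]
    calc _ ≤ ∫⁻ r in Set.Ioi t, Φ ^ (m + 1) * F.branchesRate w ℓ Φ S r := by
          -- All fields of S are older than r, so the bound for one commutator at time r applies,
          -- with an empty left factor.
          refine setLIntegral_mono ((F.measurable_branchesRate w ℓ Φ S).const_mul _) fun r hr => ?_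
          have := F.adMass_commutator_mono_le hV h0 h1 hΦ hℓ m r (hsum r) (ih r) S
            (fun q hq => (hS q hq).trans (le_of_lt hr)) [] (by simp)
          simpa [mono_nil, branches] using this
      _ = Φ ^ (m + 1) * ∫⁻ r in Set.Ioi t, F.branchesRate w ℓ Φ S r :=
          lintegral_const_mul _ (F.measurable_branchesRate w ℓ Φ S)
      _ ≤ _ := by
          rw [branches_eq]
          gcongr
          -- The product of the masses is 1 plus the integral of its rate; the 1 is given away.
          exact le_add_self

theorem adMass_sum_le (hV : Continuous V) (h0 : Φ ≠ 0) (h1 : Φ ≠ ∞)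
    (hΦ : F.κ * ∑' i, ‖w i‖ₑ * ((ℓ i).length * F.weight (ℓ i)) ≤ 2 * Φ)
    (hℓ : ∀ i, Even (ℓ i).length) (hsum : ∀ t, HasSum (fun i => w i • F.monoAt (ℓ i) t) (V t))
    {J : Type*} [Countable J] (a : J → ℂ) (p : J → List Λ) {A : 𝔄}
    (hA : HasSum (fun j => a j • F.monoAt (p j) 0) A) (m : ℕ) :
    adMass V m 0 A ≤ Φ ^ m * ∑' j, ‖a j‖ₑ * F.weight (p j) := by
  refine (adMass_hasSum_le hV m 0 hA).trans ?_
  rw [← ENNReal.tsum_mul_left]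
  refine ENNReal.tsum_le_tsum fun j => ?_
  rw [adMass_smul hV]
  calc _ ≤ ‖a j‖ₑ * (Φ ^ m * F.branches w ℓ Φ ((p j).map fun x => (x, 0)) 0) := by
        gcongr
        refine F.adMass_mono_le hV h0 h1 hΦ hℓ hsum m 0 _ fun q hq => ?_
        obtain ⟨y, -, rfl⟩ := List.mem_map.1 hq
        exact le_rfl
    _ ≤ ‖a j‖ₑ * (Φ ^ m * F.weight (p j)) := by
        gcongr
        exact F.branches_monoAt_le h0 h1 hΦ _ _
    _ = _ := by ring

end Growth

end FieldSystem

end FreeFermions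

end

noncomputable section

namespace FreeFermions

/-! ### Square integrable functions on products -/

section Slices

variable {X Y F : Type*} [MeasurableSpace X] [MeasurableSpace Y] {μ : Measure X} {ν : Measure Y}
  [NormedAddCommGroup F]

theorem MemLp.ae_memLp_slice [SFinite μ] [SFinite ν] {Ψ : Y × X → F} (hΨ : MemLp Ψ 2 (ν.prod μ)) :
    ∀ᵐ y ∂ν, MemLp (fun x => Ψ (y, x)) 2 μ := by
  have h1 := (memLp_two_iff_integrable_sq_norm hΨ.1).1 hΨ
  filter_upwards [hΨ.1.prodMk_left, h1.prod_right_ae] with y h2 h3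
  exact (memLp_two_iff_integrable_sq_norm h2).2 h3

theorem MemLp.integrable_smul_two [NormedSpace ℂ F] {h : X → ℂ} {f : X → F} (hh : MemLp h 2 μ) (hf : MemLp f 2 μ) :
    Integrable (fun x => h x • f x) μ :=
  memLp_one_iff_integrable.1 (hf.smul (r := 1) hh)

/-- Cauchy-Schwarz in `ℝ≥0∞`, so that f need only be measurable; this suits slices that are square
integrable only almost everywhere. -/
theorem enorm_integral_smul_sq_le [NormedSpace ℂ F] {h : X → ℂ} {f : X → F} (hh : MemLp h 2 μ)
    (hf : AEStronglyMeasurable f μ) :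
    ‖∫ x, h x • f x ∂μ‖ₑ ^ (2 : ℝ) ≤
      (∫⁻ x, ‖h x‖ₑ ^ (2 : ℝ) ∂μ) * ∫⁻ x, ‖f x‖ₑ ^ (2 : ℝ) ∂μ := by
  have h1 : ‖∫ x, h x • f x ∂μ‖ₑ ≤ ∫⁻ x, (fun x => ‖h x‖ₑ) x * (fun x => ‖f x‖ₑ) x ∂μ := by
    refine (enorm_integral_le_lintegral_enorm _).trans (le_of_eq ?_)
    simp only [enorm_smul]
  have h2 := h1.trans (ENNReal.lintegral_mul_le_Lp_mul_Lq μ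
    (Real.HolderConjugate.two_two) hh.1.enorm hf.enorm)
  refine (ENNReal.rpow_le_rpow h2 (by norm_num : (0 : ℝ) ≤ 2)).trans (le_of_eq ?_)
  rw [ENNReal.mul_rpow_of_nonneg _ _ (by norm_num), ← ENNReal.rpow_mul, ← ENNReal.rpow_mul]
  norm_num

/-- Cauchy-Schwarz on almost every slice, followed by Tonelli. -/
theorem MemLp.integral_smul_slice [SFinite μ] [NormedSpace ℂ F] {h : X → ℂ} {Ψ : Y × X → F} (hh : MemLp h 2 μ)
    (hΨ : MemLp Ψ 2 (ν.prod μ)) : MemLp (fun y => ∫ x, h x • Ψ (y, x) ∂μ) 2 ν := by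
  refine ⟨((hh.1.comp_snd).smul hΨ.1).integral_prod_right', ?_⟩
  rw [eLpNorm_lt_top_iff_lintegral_rpow_enorm_lt_top two_ne_zero ENNReal.ofNat_ne_top]
  have hh2 := (eLpNorm_lt_top_iff_lintegral_rpow_enorm_lt_top two_ne_zero
    ENNReal.ofNat_ne_top).1 hh.2
  have hΨ2 := (eLpNorm_lt_top_iff_lintegral_rpow_enorm_lt_top two_ne_zero
    ENNReal.ofNat_ne_top).1 hΨ.2
  simp only [ENNReal.toReal_ofNat] at hh2 hΨ2 ⊢
  rw [lintegral_prod _ (hΨ.1.enorm.pow_const _)] at hΨ2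
  calc _ ≤ ∫⁻ y, (∫⁻ x, ‖h x‖ₑ ^ (2 : ℝ) ∂μ) * ∫⁻ x, ‖Ψ (y, x)‖ₑ ^ (2 : ℝ) ∂μ ∂ν := by
        refine lintegral_mono_ae ?_
        filter_upwards [hΨ.1.prodMk_left] with y hy
        exact enorm_integral_smul_sq_le hh hy
    _ = (∫⁻ x, ‖h x‖ₑ ^ (2 : ℝ) ∂μ) * ∫⁻ y, ∫⁻ x, ‖Ψ (y, x)‖ₑ ^ (2 : ℝ) ∂μ ∂ν :=
        lintegral_const_mul' _ _ hh2.ne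
    _ < ∞ := ENNReal.mul_lt_top hh2 hΨ2

theorem MemLp.smul_prod [NormedSpace ℂ F] {h : X → ℂ} {f : Y → F} (hh : MemLp h 2 μ) (hf : MemLp f 2 ν) :
    MemLp (fun p : Y × X => h p.2 • f p.1) 2 (ν.prod μ) := by
  have hm : AEStronglyMeasurable (fun p : Y × X => h p.2 • f p.1) (ν.prod μ) :=
    hh.1.comp_snd.smul hf.1.comp_fst
  rw [memLp_two_iff_integrable_sq_norm hm]
  have := ((memLp_two_iff_integrable_sq_norm hf.1).1 hf).mul_prod
    ((memLp_two_iff_integrable_sq_norm hh.1).1 hh)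
  refine this.congr (Filter.Eventually.of_forall fun p => ?_)
  simp only [norm_smul]
  ring

end Slices

/-! ### Adding a particle -/

/-- The configuration of `n + 1` particles whose first one is at `p.2` and whose other ones are
at `p.1`, as an isometry. -/
def consIso (d n : ℕ) :
    WithLp 2 (EuclideanSpace ℝ (Fin n × Fin d) × EuclideanSpace ℝ (Fin d)) ≃ₗᵢ[ℝ]
      EuclideanSpace ℝ (Fin (n + 1) × Fin d) where
  toFun p := WithLp.toLp 2 fun q =>
    Fin.cases (motive := fun _ => ℝ) (p.snd q.2) (fun j => p.fst (j, q.2)) q.1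
  invFun x := WithLp.toLp 2
    (WithLp.toLp 2 fun q => x (q.1.succ, q.2), WithLp.toLp 2 fun i => x (0, i))
  map_add' p p' := by
    ext ⟨j, i⟩
    cases j using Fin.cases <;> rfl
  map_smul' c p := by
    ext ⟨j, i⟩
    cases j using Fin.cases <;> rfl
  left_inv p := rfl
  right_inv x := by
    ext ⟨j, i⟩
    cases j using Fin.cases <;> rfl
  norm_map' p := by
    refine (sq_eq_sq₀ (norm_nonneg _) (norm_nonneg _)).1 ?_
    rw [EuclideanSpace.norm_sq_eq, WithLp.prod_norm_sq_eq_of_L2, EuclideanSpace.norm_sq_eq,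
      EuclideanSpace.norm_sq_eq, Fintype.sum_prod_type, Fintype.sum_prod_type, Fin.sum_univ_succ,
      add_comm]
    rfl

/-- Splitting a configuration of `n + 1` particles into its tail and its head. -/
def splitPos (d n : ℕ) : EuclideanSpace ℝ (Fin (n + 1) × Fin d) ≃ᵐ
    EuclideanSpace ℝ (Fin n × Fin d) × EuclideanSpace ℝ (Fin d) :=
  (consIso d n).symm.toMeasurableEquiv.trans (MeasurableEquiv.toLp 2 _).symm

theorem measurePreserving_splitPos (d n : ℕ) : MeasurePreserving (splitPos d n) volume volume :=
  (WithLp.volume_preserving_ofLp _ _).comp (consIso d n).symm.measurePreserving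

theorem splitPos_snd_apply {d n : ℕ} (x : EuclideanSpace ℝ (Fin (n + 1) × Fin d)) (i : Fin d) :
    (splitPos d n x).2 i = x (0, i) := rfl

theorem splitPos_fst_apply {d n : ℕ} (x : EuclideanSpace ℝ (Fin (n + 1) × Fin d))
    (q : Fin n × Fin d) : (splitPos d n x).1 q = x (q.1.succ, q.2) := rfl

theorem splitPos_symm_apply_zero {d n : ℕ}
    (p : EuclideanSpace ℝ (Fin n × Fin d) × EuclideanSpace ℝ (Fin d)) (i : Fin d) :
    (splitPos d n).symm p (0, i) = p.2 i := rfl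

theorem splitPos_symm_apply_succ {d n : ℕ}
    (p : EuclideanSpace ℝ (Fin n × Fin d) × EuclideanSpace ℝ (Fin d)) (j : Fin n) (i : Fin d) :
    (splitPos d n).symm p (j.succ, i) = p.1 (j, i) := rfl

theorem inner_splitPos {d n : ℕ} (x y : EuclideanSpace ℝ (Fin (n + 1) × Fin d)) :
    inner ℝ x y = inner ℝ (splitPos d n x).1 (splitPos d n y).1 +
      inner ℝ (splitPos d n x).2 (splitPos d n y).2 := by
  rw [← (consIso d n).symm.inner_map_map x y, WithLp.prod_inner_apply]
  rfl

theorem norm_sq_splitPos {d n : ℕ} (x : EuclideanSpace ℝ (Fin (n + 1) × Fin d)) :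
    ‖x‖ ^ 2 = ‖(splitPos d n x).1‖ ^ 2 + ‖(splitPos d n x).2‖ ^ 2 := by
  rw [← real_inner_self_eq_norm_sq, inner_splitPos, real_inner_self_eq_norm_sq,
    real_inner_self_eq_norm_sq]

theorem ae_splitPos {d n : ℕ}
    {p : EuclideanSpace ℝ (Fin n × Fin d) × EuclideanSpace ℝ (Fin d) → Prop}
    (h : ∀ᵐ q, p q) : ∀ᵐ x, p (splitPos d n x) :=
  (measurePreserving_splitPos d n).quasiMeasurePreserving.ae h

theorem ae_splitPos_fst {d n : ℕ} {p : EuclideanSpace ℝ (Fin n × Fin d) → Prop}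
    (h : ∀ᵐ x, p x) : ∀ᵐ x, p (splitPos d n x).1 :=
  ae_splitPos (p := fun q => p q.1) (Measure.quasiMeasurePreserving_fst.ae h)

theorem ae_splitPos_snd {d n : ℕ} {p : EuclideanSpace ℝ (Fin d) → Prop}
    (h : ∀ᵐ x, p x) : ∀ᵐ x, p (splitPos d n x).2 :=
  ae_splitPos (p := fun q => p q.2) (Measure.quasiMeasurePreserving_snd.ae h)

theorem ae_splitPos_symm {d n : ℕ} {p : EuclideanSpace ℝ (Fin (n + 1) × Fin d) → Prop}
    (h : ∀ᵐ x, p x) : ∀ᵐ z, ∀ᵐ x, p ((splitPos d n).symm (z, x)) :=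
  Measure.ae_ae_of_ae_prod ((measurePreserving_splitPos d n).symm.quasiMeasurePreserving.ae h)

/-- Adding a particle with the label `l` in front of a vector of labels. -/
def labelCons (k n : ℕ) (l : Label k) :
    EuclideanSpace ℂ (Fin n → Label k) →ₗᵢ[ℂ] EuclideanSpace ℂ (Fin (n + 1) → Label k) where
  toFun v := WithLp.toLp 2 fun s => if s 0 = l then v (Fin.tail s) else 0
  map_add' v v' := by
    ext s
    by_cases h : s 0 = l <;> simp [h]
  map_smul' c v := by
    ext s
    by_cases h : s 0 = l <;> simp [h]
  norm_map' v := by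
    refine (sq_eq_sq₀ (norm_nonneg _) (norm_nonneg _)).1 ?_
    rw [EuclideanSpace.norm_sq_eq, EuclideanSpace.norm_sq_eq,
      ← (Fin.consEquiv fun _ : Fin (n + 1) => Label k).sum_comp, Fintype.sum_prod_type,
      Finset.sum_comm]
    refine Finset.sum_congr rfl fun s _ => ?_
    rw [Finset.sum_eq_single l]
    · simp [Fin.consEquiv]
    · intro l' _ hl'
      simp [Fin.consEquiv, hl']
    · simp

theorem labelCons_apply (k n : ℕ) (l : Label k) (v : EuclideanSpace ℂ (Fin n → Label k))
    (s : Fin (n + 1) → Label k) :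
    labelCons k n l v s = if s 0 = l then v (Fin.tail s) else 0 := rfl

/-- Fixing the first label of a vector of labels. -/
def labelHead (k n : ℕ) (l : Label k) :
    EuclideanSpace ℂ (Fin (n + 1) → Label k) →L[ℂ] EuclideanSpace ℂ (Fin n → Label k) :=
  (PiLp.continuousLinearEquiv 2 ℂ _).symm.toContinuousLinearMap ∘L
    ContinuousLinearMap.pi fun s => EuclideanSpace.proj (𝕜 := ℂ) (Fin.cons l s)

theorem labelHead_apply (k n : ℕ) (l : Label k) (v : EuclideanSpace ℂ (Fin (n + 1) → Label k))
    (s : Fin n → Label k) : labelHead k n l v s = v (Fin.cons l s) := rfl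

theorem labelHead_labelCons (k n : ℕ) (l l' : Label k) (v : EuclideanSpace ℂ (Fin n → Label k)) :
    labelHead k n l (labelCons k n l' v) = if l = l' then v else 0 := by
  ext s
  rw [labelHead_apply, labelCons_apply]
  by_cases h : l = l' <;> simp [h]

theorem inner_labelCons (k n : ℕ) (l : Label k) (v : EuclideanSpace ℂ (Fin n → Label k))
    (u : EuclideanSpace ℂ (Fin (n + 1) → Label k)) :
    ⟪labelCons k n l v, u⟫ = ⟪v, labelHead k n l u⟫ := by
  rw [PiLp.inner_apply, PiLp.inner_apply,
    ← (Fin.consEquiv fun _ : Fin (n + 1) => Label k).sum_comp, Fintype.sum_prod_type,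
    Finset.sum_comm]
  refine Finset.sum_congr rfl fun s _ => ?_
  rw [Finset.sum_eq_single l]
  · simp [Fin.consEquiv, labelCons_apply, labelHead_apply]
  · intro l' _ hl'
    simp [Fin.consEquiv, labelCons_apply, hl']
  · simp

/-- The one-particle space `L²(ℝ^d)` of a particle with a given label. -/
abbrev OneParticle (d : ℕ) : Type :=
  Lp ℂ 2 (volume : Measure (EuclideanSpace ℝ (Fin d)))

variable {d k n : ℕ}

theorem memLp_addParticle (h : OneParticle d) (l : Label k) (ψ : Sector d k n) :
    MemLp (fun x => h (splitPos d n x).2 • labelCons k n l (ψ (splitPos d n x).1)) 2 volume := by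
  have h1 : MemLp (fun x => labelCons k n l (ψ x)) 2 volume :=
    (labelCons k n l).toContinuousLinearMap.comp_memLp' (Lp.memLp ψ)
  exact (MemLp.smul_prod (Lp.memLp h) h1).comp_measurePreserving (measurePreserving_splitPos d n)

/-- The vector `h ⊗ ψ`, for a wave function `h` of one particle with the label `l`. -/
def addParticle (l : Label k) (h : OneParticle d) (ψ : Sector d k n) : Sector d k (n + 1) :=
  (memLp_addParticle h l ψ).toLp

theorem addParticle_ae (l : Label k) (h : OneParticle d) (ψ : Sector d k n) :
    addParticle l h ψ =ᵐ[volume]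
      fun x => h (splitPos d n x).2 • labelCons k n l (ψ (splitPos d n x).1) :=
  MemLp.coeFn_toLp _

theorem addParticle_ae_of_ae (l : Label k) {h : OneParticle d} {ψ : Sector d k n}
    {h' : EuclideanSpace ℝ (Fin d) → ℂ}
    {ψ' : EuclideanSpace ℝ (Fin n × Fin d) → EuclideanSpace ℂ (Fin n → Label k)}
    (e : h =ᵐ[volume] h') (e' : ψ =ᵐ[volume] ψ') :
    addParticle l h ψ =ᵐ[volume]
      fun x => h' (splitPos d n x).2 • labelCons k n l (ψ' (splitPos d n x).1) := by
  filter_upwards [addParticle_ae l h ψ, ae_splitPos_fst e', ae_splitPos_snd (n := n) e]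
    with x h1 h2 h3
  rw [h1, h2, h3]

theorem inner_addParticle (l l' : Label k) (h h' : OneParticle d) (ψ ψ' : Sector d k n) :
    ⟪addParticle l h ψ, addParticle l' h' ψ'⟫ = if l = l' then ⟪h, h'⟫ * ⟪ψ, ψ'⟫ else 0 := by
  have e : ⟪addParticle l h ψ, addParticle l' h' ψ'⟫ = ∫ x,
      (fun q : EuclideanSpace ℝ (Fin n × Fin d) × EuclideanSpace ℝ (Fin d) =>
        (if l = l' then ⟪ψ q.1, ψ' q.1⟫ else 0) * ⟪h q.2, h' q.2⟫) (splitPos d n x) := by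
    rw [L2.inner_def]
    refine integral_congr_ae ?_
    filter_upwards [addParticle_ae l h ψ, addParticle_ae l' h' ψ'] with x h1 h2
    rw [h1, h2, inner_smul_left, inner_smul_right, inner_labelCons, labelHead_labelCons]
    by_cases hl : l = l'
    · simp only [hl, if_true, RCLike.inner_apply]
      ring
    · simp [hl]
  rw [e]
  refine ((measurePreserving_splitPos d n).integral_comp (splitPos d n).measurableEmbedding
    (fun q => (if l = l' then (⟪ψ q.1, ψ' q.1⟫ : ℂ) else 0) * (⟪h q.2, h' q.2⟫ : ℂ))).trans ?_
  refine (integral_prod_mul (fun z => if l = l' then (⟪ψ z, ψ' z⟫ : ℂ) else 0)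
    fun x => (⟪h x, h' x⟫ : ℂ)).trans ?_
  by_cases hl : l = l'
  · simp only [hl, if_true]
    rw [L2.inner_def, L2.inner_def, mul_comm]
  · simp [hl]

theorem norm_addParticle (l : Label k) (h : OneParticle d) (ψ : Sector d k n) :
    ‖addParticle l h ψ‖ = ‖h‖ * ‖ψ‖ := by
  refine (sq_eq_sq₀ (norm_nonneg _) (by positivity)).1 ?_
  have h1 := inner_addParticle l l h h ψ ψ
  rw [if_pos rfl] at h1
  simp only [inner_self_eq_norm_sq_to_K] at h1
  rw [mul_pow]
  exact_mod_cast h1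

/-- The operator `(h, ψ) ↦ h ⊗ ψ`. -/
def addParticleL (d n : ℕ) (l : Label k) :
    OneParticle d →L[ℂ] Sector d k n →L[ℂ] Sector d k (n + 1) :=
  LinearMap.mkContinuous₂ (LinearMap.mk₂ ℂ (addParticle l)
    (fun h h' ψ => by
      apply Lp.ext
      filter_upwards [addParticle_ae_of_ae l (Lp.coeFn_add h h') (ae_eq_refl ψ),
        Lp.coeFn_add (addParticle l h ψ) (addParticle l h' ψ), addParticle_ae l h ψ,
        addParticle_ae l h' ψ] with x h1 h2 h3 h4
      rw [h1, h2, Pi.add_apply, Pi.add_apply, h3, h4, add_smul])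
    (fun c h ψ => by
      apply Lp.ext
      filter_upwards [addParticle_ae_of_ae l (Lp.coeFn_smul c h) (ae_eq_refl ψ),
        Lp.coeFn_smul c (addParticle l h ψ), addParticle_ae l h ψ] with x h1 h2 h3
      rw [h1, h2, Pi.smul_apply, Pi.smul_apply, h3, smul_assoc])
    (fun h ψ ψ' => by
      apply Lp.ext
      filter_upwards [addParticle_ae_of_ae l (ae_eq_refl h) (Lp.coeFn_add ψ ψ'),
        Lp.coeFn_add (addParticle l h ψ) (addParticle l h ψ'), addParticle_ae l h ψ,
        addParticle_ae l h ψ'] with x h1 h2 h3 h4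
      rw [h1, h2, Pi.add_apply, Pi.add_apply, h3, h4, map_add, smul_add])
    (fun c h ψ => by
      apply Lp.ext
      filter_upwards [addParticle_ae_of_ae l (ae_eq_refl h) (Lp.coeFn_smul c ψ),
        Lp.coeFn_smul c (addParticle l h ψ), addParticle_ae l h ψ] with x h1 h2 h3
      rw [h1, h2, Pi.smul_apply, Pi.smul_apply, h3, map_smul, smul_comm]))
    1 fun h ψ => by
      rw [one_mul]
      exact (norm_addParticle l h ψ).le

theorem addParticleL_apply (l : Label k) (h : OneParticle d) (ψ : Sector d k n) :
    addParticleL d n l h ψ = addParticle l h ψ := rfl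

/-- The adjoint of `ψ ↦ h ⊗ ψ`. -/
def removeParticle (l : Label k) (h : OneParticle d) : Sector d k (n + 1) →L[ℂ] Sector d k n :=
  ContinuousLinearMap.adjoint (addParticleL d n l h)

theorem inner_removeParticle (l : Label k) (h : OneParticle d) (ψ : Sector d k n)
    (Ψ : Sector d k (n + 1)) : ⟪ψ, removeParticle l h Ψ⟫ = ⟪addParticle l h ψ, Ψ⟫ := by
  rw [removeParticle, ContinuousLinearMap.adjoint_inner_right, addParticleL_apply]

theorem memLp_splitPos_symm (Ψ : Sector d k (n + 1)) :
    MemLp (fun q => Ψ ((splitPos d n).symm q)) 2 (volume.prod volume) :=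
  (Lp.memLp Ψ).comp_measurePreserving (measurePreserving_splitPos d n).symm

/-- The abstract adjoint is a partial scalar product, by Fubini after testing with all ψ. This is
the link to annihilation operators at a point. -/
theorem removeParticle_ae (l : Label k) (h : OneParticle d) (Ψ : Sector d k (n + 1)) :
    removeParticle l h Ψ =ᵐ[volume] fun z => ∫ x, starRingEnd ℂ (h x) •
      labelHead k n l (Ψ ((splitPos d n).symm (z, x))) := by
  have hh : MemLp (fun x => starRingEnd ℂ (h x)) 2 volume := (Lp.memLp h).star
  have hΨ : MemLp (fun q => labelHead k n l (Ψ ((splitPos d n).symm q))) 2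
      (volume.prod volume) := (labelHead k n l).comp_memLp' (memLp_splitPos_symm Ψ)
  have hG := MemLp.integral_smul_slice hh hΨ
  refine Filter.EventuallyEq.trans ?_ hG.coeFn_toLp
  rw [← Lp.ext_iff]
  refine ext_inner_left ℂ fun ψ => ?_
  rw [inner_removeParticle, L2.inner_def, L2.inner_def,
    ← (measurePreserving_splitPos d n).symm.integral_comp (splitPos d n).symm.measurableEmbedding]
  refine (integral_prod _ ((measurePreserving_splitPos d n).symm.integrable_comp_of_integrable
    (L2.integrable_inner (𝕜 := ℂ) (addParticle l h ψ) Ψ))).trans ?_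
  refine integral_congr_ae ?_
  filter_upwards [hG.coeFn_toLp, ae_splitPos_symm (addParticle_ae l h ψ),
    MemLp.ae_memLp_slice hΨ] with z h1 h2 h3
  rw [h1, ← integral_inner (MemLp.integrable_smul_two hh h3)]
  refine integral_congr_ae ?_
  filter_upwards [h2] with x h4
  rw [Function.comp_apply, h4, MeasurableEquiv.apply_symm_apply, inner_smul_left, inner_smul_right, inner_labelCons]

theorem removeParticle_addParticle (l l' : Label k) (h h' : OneParticle d) (ψ : Sector d k n) :
    removeParticle l h (addParticle l' h' ψ) = (if l = l' then ⟪h, h'⟫ else 0) • ψ := by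
  refine ext_inner_left ℂ fun χ => ?_
  rw [inner_removeParticle, inner_addParticle, inner_smul_right]
  split_ifs <;> simp

end FreeFermions

end

noncomputable section

namespace FreeFermions

variable {d k n : ℕ}

/-! ### Permutations of particles -/

theorem permOp_mul (σ τ : Equiv.Perm (Fin n)) (f : Sector d k n) :
    permOp d k n σ (permOp d k n τ f) = permOp d k n (σ * τ) f := by
  apply Lp.ext
  filter_upwards [permOp_ae d k n σ (permOp d k n τ f), permOp_ae d k n (σ * τ) f,
    (permPos d n σ).measurePreserving.quasiMeasurePreserving.ae (permOp_ae d k n τ f)]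
    with x h1 h2 h3
  rw [h1, h2, h3]
  rfl

theorem permOp_one (f : Sector d k n) : permOp d k n 1 f = f := by
  apply Lp.ext
  filter_upwards [permOp_ae d k n 1 f] with x h1
  rw [h1]
  rfl

theorem inner_permOp_permOp (σ : Equiv.Perm (Fin n)) (f g : Sector d k n) :
    ⟪permOp d k n σ f, permOp d k n σ g⟫ = ⟪f, g⟫ := by
  rw [L2.inner_def, L2.inner_def]
  refine Eq.trans ?_ ((permPos d n σ).measurePreserving.integral_comp
    (permPos d n σ).toHomeomorph.measurableEmbedding fun x => (⟪f x, g x⟫ : ℂ))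
  refine integral_congr_ae ?_
  filter_upwards [permOp_ae d k n σ f, permOp_ae d k n σ g] with x h1 h2
  rw [h1, h2, LinearIsometryEquiv.inner_map_map]

theorem inner_permOp_left (σ : Equiv.Perm (Fin n)) (f g : Sector d k n) :
    ⟪permOp d k n σ f, g⟫ = ⟪f, permOp d k n σ⁻¹ g⟫ := by
  rw [← inner_permOp_permOp σ f, permOp_mul, mul_inv_cancel, permOp_one]

theorem sign_smul_sign_smul {M : Type*} [AddCommGroup M] [Module ℂ M] (σ : Equiv.Perm (Fin n))
    (x : M) : ((Equiv.Perm.sign σ : ℤ) : ℂ) • ((Equiv.Perm.sign σ : ℤ) : ℂ) • x = x := by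
  rw [smul_smul, ← Int.cast_mul, Int.units_coe_mul_self, Int.cast_one, one_smul]

/-- The extension of a permutation to one more particle in front. -/
def liftPerm (σ : Equiv.Perm (Fin n)) : Equiv.Perm (Fin (n + 1)) :=
  Equiv.Perm.decomposeFin.symm (0, σ)

theorem liftPerm_zero (σ : Equiv.Perm (Fin n)) : liftPerm σ 0 = 0 :=
  Equiv.Perm.decomposeFin_symm_apply_zero 0 σ

theorem liftPerm_succ (σ : Equiv.Perm (Fin n)) (j : Fin n) : liftPerm σ j.succ = (σ j).succ := by
  rw [liftPerm, Equiv.Perm.decomposeFin_symm_apply_succ, Equiv.swap_self, Equiv.refl_apply]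

theorem sign_liftPerm (σ : Equiv.Perm (Fin n)) :
    Equiv.Perm.sign (liftPerm σ) = Equiv.Perm.sign σ := by
  rw [liftPerm, Equiv.Perm.decomposeFin.symm_sign, if_pos rfl, one_mul]

theorem liftPerm_inv (σ : Equiv.Perm (Fin n)) : liftPerm σ⁻¹ = (liftPerm σ)⁻¹ := by
  rw [eq_inv_iff_mul_eq_one]
  ext j
  cases j using Fin.cases <;> simp [liftPerm_zero, liftPerm_succ]

theorem decomposeFin_symm_eq (p : Fin (n + 1)) (σ : Equiv.Perm (Fin n)) :
    Equiv.Perm.decomposeFin.symm (p, σ) = Equiv.swap 0 p * liftPerm σ := by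
  ext j
  cases j using Fin.cases with
  | zero => simp [liftPerm_zero]
  | succ j => rw [Equiv.Perm.decomposeFin_symm_apply_succ, Equiv.Perm.mul_apply, liftPerm_succ]

theorem splitPos_permPos_liftPerm (σ : Equiv.Perm (Fin n))
    (x : EuclideanSpace ℝ (Fin (n + 1) × Fin d)) :
    splitPos d n (permPos d (n + 1) (liftPerm σ) x) =
      (permPos d n σ (splitPos d n x).1, (splitPos d n x).2) := by
  refine Prod.ext ?_ ?_
  · ext ⟨j, i⟩
    simp only [splitPos_fst_apply, permPos_apply, liftPerm_succ]
  · ext i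
    simp only [splitPos_snd_apply, permPos_apply, liftPerm_zero]

theorem permLabel_liftPerm_labelCons (σ : Equiv.Perm (Fin n)) (l : Label k)
    (v : EuclideanSpace ℂ (Fin n → Label k)) :
    permLabel k (n + 1) (liftPerm σ) (labelCons k n l v) = labelCons k n l (permLabel k n σ v) := by
  ext s
  have ht : Fin.tail (s ∘ liftPerm σ) = Fin.tail s ∘ σ := by
    ext1 j
    simp only [Fin.tail, Function.comp_apply, liftPerm_succ]
  rw [permLabel_apply, labelCons_apply, labelCons_apply, permLabel_apply, Function.comp_apply,
    liftPerm_zero, ht]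

theorem permOp_liftPerm_addParticle (σ : Equiv.Perm (Fin n)) (l : Label k) (h : OneParticle d)
    (ψ : Sector d k n) :
    permOp d k (n + 1) (liftPerm σ) (addParticle l h ψ) = addParticle l h (permOp d k n σ ψ) := by
  apply Lp.ext
  filter_upwards [permOp_ae d k (n + 1) (liftPerm σ) (addParticle l h ψ),
    (permPos d (n + 1) (liftPerm σ)).measurePreserving.quasiMeasurePreserving.ae
      (addParticle_ae l h ψ),
    addParticle_ae_of_ae l (ae_eq_refl h) (permOp_ae d k n σ ψ)] with x h1 h2 h3
  rw [h1, h2, h3, splitPos_permPos_liftPerm, map_smul, permLabel_liftPerm_labelCons]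

theorem permOp_removeParticle (σ : Equiv.Perm (Fin n)) (l : Label k) (h : OneParticle d)
    (Ψ : Sector d k (n + 1)) :
    permOp d k n σ (removeParticle l h Ψ) =
      removeParticle l h (permOp d k (n + 1) (liftPerm σ) Ψ) := by
  refine ext_inner_left ℂ fun χ => ?_
  have h1 := inner_permOp_left σ⁻¹ χ (removeParticle l h Ψ)
  have h2 := inner_permOp_left (liftPerm σ)⁻¹ (addParticle l h χ) Ψ
  rw [inv_inv] at h1 h2
  rw [← h1, inner_removeParticle, inner_removeParticle, ← permOp_liftPerm_addParticle, ← h2,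
    liftPerm_inv]

theorem swap_zero_one_succ_succ (j : Fin n) :
    Equiv.swap (0 : Fin (n + 2)) 1 j.succ.succ = j.succ.succ := by
  refine Equiv.swap_apply_of_ne_of_ne (Fin.succ_ne_zero _) ?_
  rw [← Fin.succ_zero_eq_one]
  exact fun h => Fin.succ_ne_zero j (Fin.succ_injective _ h)

theorem permLabel_swap_labelCons (l : Label k) (v : EuclideanSpace ℂ (Fin (n + 1) → Label k))
    (s : Fin (n + 1) → Label k) (l' : Label k) :
    permLabel k (n + 2) (Equiv.swap 0 1) (labelCons k (n + 1) l v) (Fin.cons l' s) =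
      if s 0 = l then v (Fin.cons l' (Fin.tail s)) else 0 := by
  rw [permLabel_apply, labelCons_apply]
  have h1 : ((Fin.cons l' s : Fin (n + 2) → Label k) ∘ (Equiv.swap 0 1)) 0 = s 0 := by
    simp only [Function.comp_apply, Equiv.swap_apply_left]
    rfl
  have h2 : Fin.tail ((Fin.cons l' s : Fin (n + 2) → Label k) ∘ (Equiv.swap 0 1)) =
      Fin.cons l' (Fin.tail s) := by
    ext1 j
    cases j using Fin.cases with
    | zero =>
      simp only [Fin.tail, Function.comp_apply]
      rw [Fin.succ_zero_eq_one, Equiv.swap_apply_right]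
      rfl
    | succ j =>
      simp only [Fin.tail, Function.comp_apply]
      rw [swap_zero_one_succ_succ]
      rfl
  rw [h1, h2]

theorem labelHead_permLabel_swap_labelCons (l l' : Label k)
    (v : EuclideanSpace ℂ (Fin (n + 1) → Label k)) :
    labelHead k (n + 1) l (permLabel k (n + 2) (Equiv.swap 0 1) (labelCons k (n + 1) l' v)) =
      labelCons k n l' (labelHead k n l v) := by
  ext s
  rw [labelHead_apply, permLabel_swap_labelCons, labelCons_apply, labelHead_apply]

theorem permLabel_swap_labelCons_labelCons (l l' : Label k)
    (v : EuclideanSpace ℂ (Fin n → Label k)) :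
    permLabel k (n + 2) (Equiv.swap 0 1) (labelCons k (n + 1) l (labelCons k n l' v)) =
      labelCons k (n + 1) l' (labelCons k n l v) := by
  ext s
  obtain ⟨a, s, rfl⟩ : ∃ a s', s = Fin.cons a s' := ⟨s 0, Fin.tail s, (Fin.cons_self_tail s).symm⟩
  rw [permLabel_swap_labelCons]
  simp only [labelCons_apply, Fin.cons_zero, Fin.tail_cons]
  by_cases h1 : s 0 = l <;> by_cases h2 : a = l' <;> simp [h1, h2]

theorem splitPos_permPos_swap_snd (x : EuclideanSpace ℝ (Fin (n + 2) × Fin d)) :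
    (splitPos d (n + 1) (permPos d (n + 2) (Equiv.swap 0 1) x)).2 =
      (splitPos d n (splitPos d (n + 1) x).1).2 := by
  ext i
  simp only [splitPos_snd_apply, splitPos_fst_apply, permPos_apply, Equiv.swap_apply_left]
  rfl

theorem splitPos_permPos_swap_fst (x : EuclideanSpace ℝ (Fin (n + 2) × Fin d)) :
    (splitPos d (n + 1) (permPos d (n + 2) (Equiv.swap 0 1) x)).1 =
      (splitPos d n).symm ((splitPos d n (splitPos d (n + 1) x).1).1,
        (splitPos d (n + 1) x).2) := by
  ext ⟨j, i⟩
  cases j using Fin.cases with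
  | zero =>
    rw [splitPos_symm_apply_zero, splitPos_fst_apply, splitPos_snd_apply, permPos_apply]
    simp only [Fin.succ_zero_eq_one, Equiv.swap_apply_right]
  | succ j =>
    rw [splitPos_symm_apply_succ, splitPos_fst_apply, splitPos_fst_apply, splitPos_fst_apply,
      permPos_apply]
    simp only [swap_zero_one_succ_succ]

theorem permOp_swap_addParticle_ae (l : Label k) (g : OneParticle d) (Ψ : Sector d k (n + 1)) :
    permOp d k (n + 2) (Equiv.swap 0 1) (addParticle l g Ψ) =ᵐ[volume] fun x =>
      g (splitPos d n (splitPos d (n + 1) x).1).2 • permLabel k (n + 2) (Equiv.swap 0 1)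
        (labelCons k (n + 1) l (Ψ ((splitPos d n).symm
          ((splitPos d n (splitPos d (n + 1) x).1).1, (splitPos d (n + 1) x).2)))) := by
  filter_upwards [permOp_ae d k (n + 2) (Equiv.swap 0 1) (addParticle l g Ψ),
    (permPos d (n + 2) (Equiv.swap 0 1)).measurePreserving.quasiMeasurePreserving.ae
      (addParticle_ae l g Ψ)] with x h1 h2
  rw [h1, h2, splitPos_permPos_swap_snd, splitPos_permPos_swap_fst, map_smul]

/-- After the exchange the added particle is the second one, so the removal acts only on Ψ. These
are the exchange terms of the anticommutation relation. -/
theorem removeParticle_permOp_swap_addParticle (l l' : Label k) (f g : OneParticle d)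
    (Ψ : Sector d k (n + 1)) :
    removeParticle l f (permOp d k (n + 2) (Equiv.swap 0 1) (addParticle l' g Ψ)) =
      addParticle l' g (removeParticle l f Ψ) := by
  apply Lp.ext
  filter_upwards [removeParticle_ae l f (permOp d k (n + 2) (Equiv.swap 0 1) (addParticle l' g Ψ)),
    addParticle_ae_of_ae l' (ae_eq_refl g) (removeParticle_ae l f Ψ),
    ae_splitPos_symm (permOp_swap_addParticle_ae l' g Ψ)] with z h1 h2 h3
  rw [h1, h2, ← LinearIsometry.integral_comp_comm, ← integral_smul]
  refine integral_congr_ae ?_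
  filter_upwards [h3] with x h4
  rw [h4, MeasurableEquiv.apply_symm_apply]
  simp only [map_smul, labelHead_permLabel_swap_labelCons]
  rw [smul_comm]

theorem permOp_swap_addParticle_addParticle (l l' : Label k) (f g : OneParticle d)
    (ψ : Sector d k n) :
    permOp d k (n + 2) (Equiv.swap 0 1) (addParticle l f (addParticle l' g ψ)) =
      addParticle l' g (addParticle l f ψ) := by
  apply Lp.ext
  have h0 : ∀ᵐ x : EuclideanSpace ℝ (Fin (n + 2) × Fin d),
      addParticle l' g ψ ((splitPos d n).symm
          ((splitPos d n (splitPos d (n + 1) x).1).1, (splitPos d (n + 1) x).2)) =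
        g (splitPos d (n + 1) x).2 • labelCons k n l'
          (ψ (splitPos d n (splitPos d (n + 1) x).1).1) := by
    filter_upwards [(permPos d (n + 2) (Equiv.swap 0 1)).measurePreserving.quasiMeasurePreserving.ae
      (ae_splitPos_fst (addParticle_ae l' g ψ))] with x hx
    rw [splitPos_permPos_swap_fst, MeasurableEquiv.apply_symm_apply] at hx
    exact hx
  filter_upwards [permOp_swap_addParticle_ae l f (addParticle l' g ψ), h0,
    addParticle_ae_of_ae l' (ae_eq_refl g) (addParticle_ae l f ψ)] with x h1 h2 h3
  rw [h1, h2, h3]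
  simp only [map_smul, permLabel_swap_labelCons_labelCons]
  rw [smul_comm]

/-- Dual to the exchange of two added particles. On antisymmetric functions the swap is -1, which
makes annihilation operators anticommute. -/
theorem removeParticle_removeParticle (l l' : Label k) (f g : OneParticle d)
    (Ψ : Sector d k (n + 2)) :
    removeParticle l f (removeParticle l' g Ψ) =
      removeParticle l' g (removeParticle l f (permOp d k (n + 2) (Equiv.swap 0 1) Ψ)) := by
  refine ext_inner_left ℂ fun χ => ?_
  have h1 := inner_permOp_left (Equiv.swap (0 : Fin (n + 2)) 1)
    (addParticle l f (addParticle l' g χ)) Ψ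
  rw [Equiv.swap_inv] at h1
  rw [inner_removeParticle, inner_removeParticle, inner_removeParticle, inner_removeParticle, ← h1,
    permOp_swap_addParticle_addParticle]

/-! ### The antisymmetrizer -/

/-- The projection onto the antisymmetric wave functions. -/
def antisym (d k n : ℕ) : Sector d k n →L[ℂ] Sector d k n :=
  ((n.factorial : ℂ))⁻¹ • ∑ σ : Equiv.Perm (Fin n),
    ((Equiv.Perm.sign σ : ℤ) : ℂ) • permOp d k n σ

theorem antisym_apply (ψ : Sector d k n) : antisym d k n ψ = ((n.factorial : ℂ))⁻¹ •
    ∑ σ : Equiv.Perm (Fin n), ((Equiv.Perm.sign σ : ℤ) : ℂ) • permOp d k n σ ψ := by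
  simp [antisym]

theorem antisym_mem (ψ : Sector d k n) : antisym d k n ψ ∈ fermi d k n := by
  rw [mem_fermi]
  intro τ
  rw [antisym_apply, map_smul, map_sum, smul_comm ((Equiv.Perm.sign τ : ℤ) : ℂ)]
  congr 1
  rw [Finset.smul_sum, ← Equiv.sum_comp (Equiv.mulLeft τ) (fun σ =>
    ((Equiv.Perm.sign τ : ℤ) : ℂ) • ((Equiv.Perm.sign σ : ℤ) : ℂ) • permOp d k n σ ψ)]
  refine Finset.sum_congr rfl fun σ _ => ?_
  rw [map_smul, permOp_mul, Equiv.coe_mulLeft, Equiv.Perm.sign_mul, Units.val_mul, Int.cast_mul,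
    mul_smul, sign_smul_sign_smul]

theorem inner_antisym (φ ψ : Sector d k n) (hφ : φ ∈ fermi d k n) :
    ⟪φ, antisym d k n ψ⟫ = ⟪φ, ψ⟫ := by
  have h : ∀ σ : Equiv.Perm (Fin n),
      ⟪φ, ((Equiv.Perm.sign σ : ℤ) : ℂ) • permOp d k n σ ψ⟫ = ⟪φ, ψ⟫ := by
    intro σ
    have h1 := inner_permOp_left σ⁻¹ φ ψ
    rw [inv_inv, (mem_fermi φ).1 hφ] at h1
    rw [inner_smul_right, ← h1, inner_smul_left, Equiv.Perm.sign_inv, map_intCast,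
      ← mul_assoc, ← Int.cast_mul, Int.units_coe_mul_self, Int.cast_one, one_mul]
  rw [antisym_apply, inner_smul_right, inner_sum, Finset.sum_congr rfl fun σ _ => h σ,
    Finset.sum_const, Finset.card_univ, Fintype.card_perm, Fintype.card_fin, nsmul_eq_mul,
    ← mul_assoc, inv_mul_cancel₀ (by exact_mod_cast n.factorial_ne_zero), one_mul]

/-- Every permutation of n + 1 particles is a transposition (0 p) times a permutation that fixes 0.
The latter is absorbed by the antisymmetry of ψ, so each p contributes n! equal terms, with sign -1
unless p = 0. -/
theorem antisym_addParticle (l : Label k) (g : OneParticle d) (ψ : Sector d k n)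
    (hψ : ψ ∈ fermi d k n) :
    ((n + 1 : ℕ) : ℂ) • antisym d k (n + 1) (addParticle l g ψ) = addParticle l g ψ -
      ∑ p : Fin n, permOp d k (n + 1) (Equiv.swap 0 p.succ) (addParticle l g ψ) := by
  have h1 : ∑ σ : Equiv.Perm (Fin (n + 1)),
      ((Equiv.Perm.sign σ : ℤ) : ℂ) • permOp d k (n + 1) σ (addParticle l g ψ) =
      (n.factorial : ℂ) • (addParticle l g ψ -
        ∑ p : Fin n, permOp d k (n + 1) (Equiv.swap 0 p.succ) (addParticle l g ψ)) := by
    rw [← Equiv.Perm.decomposeFin.symm.sum_comp, Fintype.sum_prod_type]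
    have h2 : ∀ (p : Fin (n + 1)) (σ : Equiv.Perm (Fin n)),
        ((Equiv.Perm.sign (Equiv.Perm.decomposeFin.symm (p, σ)) : ℤ) : ℂ) •
          permOp d k (n + 1) (Equiv.Perm.decomposeFin.symm (p, σ)) (addParticle l g ψ) =
        (if p = 0 then (1 : ℂ) else -1) •
          permOp d k (n + 1) (Equiv.swap 0 p) (addParticle l g ψ) := by
      intro p σ
      rw [Equiv.Perm.decomposeFin.symm_sign, decomposeFin_symm_eq, ← permOp_mul,
        permOp_liftPerm_addParticle, (mem_fermi ψ).1 hψ, ← addParticleL_apply, map_smul, map_smul,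
        Units.val_mul, Int.cast_mul, mul_smul, sign_smul_sign_smul]
      split_ifs <;> simp [addParticleL_apply]
    simp only [h2, Finset.sum_const, Finset.card_univ, Fintype.card_perm, Fintype.card_fin]
    rw [← Finset.smul_sum, Fin.sum_univ_succ, ← Nat.cast_smul_eq_nsmul ℂ]
    congr 1
    simp only [if_true, one_smul, Fin.succ_ne_zero, if_false, neg_smul, Finset.sum_neg_distrib,
      Equiv.swap_self]
    rw [sub_eq_add_neg]
    rw [show (Equiv.refl (Fin (n + 1))) = 1 from rfl, permOp_one]
  rw [antisym_apply, h1, smul_smul, smul_smul, Nat.factorial_succ, Nat.cast_mul, mul_inv,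
    ← mul_assoc, mul_inv_cancel₀ (Nat.cast_ne_zero.2 n.succ_ne_zero), one_mul,
    inv_mul_cancel₀ (by exact_mod_cast n.factorial_ne_zero), one_smul]

theorem liftPerm_swap (p : Fin (n + 1)) :
    liftPerm (Equiv.swap 0 p) * Equiv.swap 0 1 * liftPerm (Equiv.swap 0 p) =
      Equiv.swap 0 p.succ := by
  have h : liftPerm (Equiv.swap 0 p) = (liftPerm (Equiv.swap 0 p))⁻¹ := by
    rw [← liftPerm_inv, Equiv.swap_inv]
  nth_rewrite 2 [h]
  rw [← Equiv.swap_apply_apply, liftPerm_zero, ← Fin.succ_zero_eq_one, liftPerm_succ,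
    Equiv.swap_apply_left]

/-- The canonical anticommutation relation, in terms of antisymmetrizers. -/
theorem removeParticle_antisym_addParticle (l l' : Label k) (f g : OneParticle d)
    (ψ : Sector d k (n + 1)) (hψ : ψ ∈ fermi d k (n + 1))
    (hr : removeParticle l f ψ ∈ fermi d k n) :
    ((n + 2 : ℕ) : ℂ) • removeParticle l f (antisym d k (n + 2) (addParticle l' g ψ)) =
      (if l = l' then ⟪f, g⟫ else 0) • ψ -
        ((n + 1 : ℕ) : ℂ) • antisym d k (n + 1) (addParticle l' g (removeParticle l f ψ)) := by
  rw [antisym_addParticle l' g _ hr, ← map_smul, antisym_addParticle l' g ψ hψ, map_sub, map_sum,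
    removeParticle_addParticle, Fin.sum_univ_succ, Fin.succ_zero_eq_one,
    removeParticle_permOp_swap_addParticle]
  congr 1
  rw [sub_eq_add_neg, ← Finset.sum_neg_distrib]
  congr 1
  refine Finset.sum_congr rfl fun q _ => ?_
  have hs : Equiv.Perm.sign (Equiv.swap (0 : Fin (n + 1)) q.succ) = -1 :=
    Equiv.Perm.sign_swap (Fin.succ_ne_zero q).symm
  -- An exchange with a later particle is conjugate to the exchange of the first two. One
  -- conjugating factor acts on ψ and gives -1; the other commutes with the removal of the first
  -- particle.
  rw [← liftPerm_swap, ← permOp_mul, ← permOp_mul, permOp_liftPerm_addParticle,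
    (mem_fermi ψ).1 hψ, ← permOp_removeParticle, ← addParticleL_apply, map_smul, map_smul,
    addParticleL_apply, map_smul, removeParticle_permOp_swap_addParticle, map_smul, hs]
  simp

theorem removeParticle_mem (l : Label k) (f : OneParticle d) {ψ : Sector d k (n + 1)}
    (hψ : ψ ∈ fermi d k (n + 1)) : removeParticle l f ψ ∈ fermi d k n := by
  rw [mem_fermi] at hψ ⊢
  intro σ
  rw [permOp_removeParticle, hψ, map_smul, sign_liftPerm]

end FreeFermions

end

noncomputable section

namespace FreeFermions

variable {d k n : ℕ}

/-! ### Creation and annihilation operators between sectors -/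

/-- The annihilation operator from `n + 1` to `n` particles. -/
def annihSector (n : ℕ) (l : Label k) (h : OneParticle d) :
    fermi d k (n + 1) →L[ℂ] fermi d k n :=
  (Real.sqrt (n + 1) : ℂ) • ((removeParticle l h ∘L (fermi d k (n + 1)).subtypeL).codRestrict
    (fermi d k n) fun ψ => removeParticle_mem l h ψ.2)

theorem coe_annihSector (l : Label k) (h : OneParticle d) (ψ : fermi d k (n + 1)) :
    (annihSector n l h ψ : Sector d k n) = (Real.sqrt (n + 1) : ℂ) • removeParticle l h ψ := rfl

/-- The creation operator from `n` to `n + 1` particles. -/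
def createSector (n : ℕ) (l : Label k) (h : OneParticle d) :
    fermi d k n →L[ℂ] fermi d k (n + 1) :=
  ContinuousLinearMap.adjoint (annihSector n l h)

/-- The adjoint is taken within the antisymmetric subspace, which is why the antisymmetrizer
appears: against antisymmetric vectors it has no effect. -/
theorem coe_createSector (l : Label k) (h : OneParticle d) (ψ : fermi d k n) :
    (createSector n l h ψ : Sector d k (n + 1)) =
      (Real.sqrt (n + 1) : ℂ) • antisym d k (n + 1) (addParticle l h ψ) := by
  have : createSector n l h ψ = ⟨(Real.sqrt (n + 1) : ℂ) • antisym d k (n + 1) (addParticle l h ψ),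
      Submodule.smul_mem _ _ (antisym_mem _)⟩ := by
    refine ext_inner_left ℂ fun χ => ?_
    rw [createSector, ContinuousLinearMap.adjoint_inner_right, Submodule.coe_inner,
      Submodule.coe_inner, coe_annihSector, inner_smul_left, inner_smul_right,
      inner_antisym _ _ χ.2, Complex.conj_ofReal, ← inner_conj_symm, inner_removeParticle,
      inner_conj_symm]
  rw [this]

theorem sqrt_mul_sqrt_succ (n : ℕ) :
    (Real.sqrt (n + 1) : ℂ) * (Real.sqrt (n + 1) : ℂ) = ((n + 1 : ℕ) : ℂ) := by
  rw [← Complex.ofReal_mul, Real.mul_self_sqrt (by positivity)]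
  push_cast
  ring

theorem annihSector_zero_createSector_zero (l l' : Label k) (f g : OneParticle d)
    (ψ : fermi d k 0) :
    annihSector 0 l f (createSector 0 l' g ψ) = (if l = l' then ⟪f, g⟫ else 0) • ψ := by
  apply Subtype.ext
  have h := antisym_addParticle l' g (ψ : Sector d k 0) ψ.2
  rw [Fin.sum_univ_zero, sub_zero] at h
  rw [coe_annihSector, coe_createSector, map_smul, smul_smul, sqrt_mul_sqrt_succ, ← map_smul, h,
    removeParticle_addParticle]
  rfl

theorem annihSector_createSector (l l' : Label k) (f g : OneParticle d)
    (ψ : fermi d k (n + 1)) :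
    annihSector (n + 1) l f (createSector (n + 1) l' g ψ) +
      createSector n l' g (annihSector n l f ψ) = (if l = l' then ⟪f, g⟫ else 0) • ψ := by
  apply Subtype.ext
  have h := removeParticle_antisym_addParticle l l' f g (ψ : Sector d k (n + 1)) ψ.2
    (removeParticle_mem l f ψ.2)
  rw [Submodule.coe_add, coe_annihSector, coe_createSector, coe_createSector, coe_annihSector,
    map_smul, smul_smul, sqrt_mul_sqrt_succ, ← addParticleL_apply l' g (_ • _), map_smul, map_smul,
    smul_smul, sqrt_mul_sqrt_succ, addParticleL_apply, h, sub_add_cancel]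
  rfl

theorem annihSector_annihSector (l l' : Label k) (f g : OneParticle d)
    (ψ : fermi d k (n + 2)) :
    annihSector n l f (annihSector (n + 1) l' g ψ) =
      -annihSector n l' g (annihSector (n + 1) l f ψ) := by
  apply Subtype.ext
  have hs : Equiv.Perm.sign (Equiv.swap (0 : Fin (n + 2)) 1) = -1 :=
    Equiv.Perm.sign_swap (Fin.zero_ne_one)
  rw [Submodule.coe_neg, coe_annihSector, coe_annihSector, coe_annihSector, coe_annihSector,
    map_smul, map_smul, removeParticle_removeParticle, (mem_fermi _).1 ψ.2, hs]
  simp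

theorem fermi_inner_self (ψ : fermi d k n) : ⟪ψ, ψ⟫ = ((‖ψ‖ ^ 2 : ℝ) : ℂ) := by
  have h := inner_self_eq_norm_sq_to_K (𝕜 := ℂ) ψ
  rw [Complex.ofReal_pow]
  exact h

/-- By the anticommutation relation, ‖a*(h)ψ‖² = ‖h‖²‖ψ‖² - ‖a(h)ψ‖², with the last term absent for
n = 0. The bound is uniform in n in spite of the factor √(n+1). -/
theorem norm_createSector_le (l : Label k) (h : OneParticle d) (ψ : fermi d k n) :
    ‖createSector n l h ψ‖ ≤ ‖h‖ * ‖ψ‖ := by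
  have key : ‖createSector n l h ψ‖ ^ 2 ≤ (‖h‖ * ‖ψ‖) ^ 2 := by
    have e : ⟪createSector n l h ψ, createSector n l h ψ⟫ =
        ⟪ψ, annihSector n l h (createSector n l h ψ)⟫ := by
      rw [createSector, ContinuousLinearMap.adjoint_inner_left]
    have hh : ⟪ψ, (if l = l then (⟪h, h⟫ : ℂ) else 0) • ψ⟫ = (((‖h‖ * ‖ψ‖) ^ 2 : ℝ) : ℂ) := by
      have h1 : ⟪ψ, (⟪h, h⟫ : ℂ) • ψ⟫ = (⟪h, h⟫ : ℂ) * ⟪ψ, ψ⟫ :=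
        inner_smul_right (𝕜 := ℂ) (E := Sector d k n) ψ ψ _
      rw [if_pos rfl, h1, fermi_inner_self, inner_self_eq_norm_sq_to_K]
      simp only [Complex.coe_algebraMap]
      push_cast
      ring
    cases n with
    | zero =>
      rw [annihSector_zero_createSector_zero, hh, fermi_inner_self] at e
      exact (by exact_mod_cast e : ‖createSector 0 l h ψ‖ ^ 2 = (‖h‖ * ‖ψ‖) ^ 2).le
    | succ n =>
      rw [eq_sub_of_add_eq (annihSector_createSector l l h h ψ), inner_sub_right, hh] at e
      have e2 : ⟪ψ, createSector n l h (annihSector n l h ψ)⟫ =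
          ((‖annihSector n l h ψ‖ ^ 2 : ℝ) : ℂ) := by
        rw [← fermi_inner_self, createSector, ContinuousLinearMap.adjoint_inner_right]
      rw [e2, fermi_inner_self] at e
      have e3 : ‖createSector (n + 1) l h ψ‖ ^ 2 =
          (‖h‖ * ‖ψ‖) ^ 2 - ‖annihSector n l h ψ‖ ^ 2 := by exact_mod_cast e
      rw [e3]
      linarith [sq_nonneg ‖annihSector n l h ψ‖]
  exact (sq_le_sq₀ (norm_nonneg _) (by positivity)).1 key

theorem norm_annihSector_le (l : Label k) (h : OneParticle d) (ψ : fermi d k (n + 1)) :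
    ‖annihSector n l h ψ‖ ≤ ‖h‖ * ‖ψ‖ := by
  have h1 : ‖createSector n l h‖ ≤ ‖h‖ :=
    ContinuousLinearMap.opNorm_le_bound _ (norm_nonneg _) (norm_createSector_le l h)
  rw [createSector, LinearIsometryEquiv.norm_map] at h1
  exact ContinuousLinearMap.le_of_opNorm_le _ h1 ψ

/-! ### Vectors of Fock space -/

namespace Fock

theorem ext_component {φ ψ : Fock d k} (h : ∀ n, φ.component n = ψ.component n) : φ = ψ :=
  lp.ext (E := fun n : ℕ => fermi d k n) (p := 2) (funext h)

theorem component_add (φ ψ : Fock d k) (n : ℕ) :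
    (φ + ψ).component n = φ.component n + ψ.component n := rfl

theorem component_sub (φ ψ : Fock d k) (n : ℕ) :
    (φ - ψ).component n = φ.component n - ψ.component n := rfl

theorem sum_norm_sq_le (ψ : Fock d k) (s : Finset ℕ) :
    ∑ n ∈ s, ‖ψ.component n‖ ^ 2 ≤ ‖ψ‖ ^ 2 := by
  have h := lp.sum_rpow_le_norm_rpow (E := fun n : ℕ => fermi d k n) (p := 2) (by norm_num) ψ s
  simp only [ENNReal.toReal_ofNat, Real.rpow_two] at h
  exact h

theorem norm_le_of_sum {ψ : Fock d k} {C : ℝ} (hC : 0 ≤ C)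
    (h : ∀ s : Finset ℕ, ∑ n ∈ s, ‖ψ.component n‖ ^ 2 ≤ C ^ 2) : ‖ψ‖ ≤ C := by
  refine lp.norm_le_of_forall_sum_le (E := fun n : ℕ => fermi d k n) (p := 2) (by norm_num) hC
    (f := ψ) fun s => ?_
  simp only [ENNReal.toReal_ofNat, Real.rpow_two]
  exact h s

/-- The vector with given components. -/
def ofComponents (f : (n : ℕ) → fermi d k n) {C : ℝ}
    (h : ∀ s : Finset ℕ, ∑ n ∈ s, ‖f n‖ ^ 2 ≤ C) : Fock d k :=
  (⟨f, memℓp_gen' (C := C) fun s => by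
    simp only [ENNReal.toReal_ofNat, Real.rpow_two]
    exact h s⟩ : lp (fun n : ℕ => fermi d k n) 2)

/-- The vector with one non-zero component. -/
def single (n : ℕ) (f : fermi d k n) : Fock d k :=
  lp.single (E := fun n : ℕ => fermi d k n) 2 n f

theorem component_single_self (n : ℕ) (f : fermi d k n) : (single n f).component n = f :=
  lp.single_apply_self (E := fun n : ℕ => fermi d k n) 2 n f

theorem component_single_ne {m n : ℕ} (f : fermi d k n) (h : m ≠ n) :
    (single n f).component m = 0 :=
  lp.single_apply_ne (E := fun n : ℕ => fermi d k n) 2 n f h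

theorem inner_single (n : ℕ) (f : fermi d k n) (ψ : Fock d k) :
    ⟪single n f, ψ⟫ = ⟪f, ψ.component n⟫ := by
  rw [inner_eq, tsum_eq_single n, component_single_self]
  intro m hm
  rw [component_single_ne f hm, inner_zero_left]

theorem isFiniteParticle_single (n : ℕ) (f : fermi d k n) : IsFiniteParticle (single n f) := by
  refine (Set.finite_singleton n).subset fun m hm => ?_
  by_contra h
  exact hm (component_single_ne f h)

/-- An operator is determined by its matrix elements between finite-particle vectors. -/
theorem op_ext {S T : Op d k} (h : ∀ φ ψ : Fock d k, IsFiniteParticle φ → IsFiniteParticle ψ →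
    ⟪φ, S ψ⟫ = ⟪φ, T ψ⟫) : S = T := by
  have h1 : ∀ (n : ℕ) (f : fermi d k n), S (single n f) = T (single n f) := by
    intro n f
    refine ext_component fun m => ext_inner_left ℂ fun χ => ?_
    rw [← inner_single, ← inner_single]
    exact h _ _ (isFiniteParticle_single m χ) (isFiniteParticle_single n f)
  ext1 ψ
  have hs : HasSum (fun n => single n (ψ.component n)) ψ :=
    lp.hasSum_single (E := fun n : ℕ => fermi d k n) (p := 2) ENNReal.ofNat_ne_top ψ
  have hS := S.hasSum hs
  have hT := T.hasSum hs
  simp only [h1] at hS hT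
  exact hS.unique hT

end Fock

/-! ### Creation and annihilation operators on Fock space -/

theorem sum_norm_sq_annihSector_le (l : Label k) (h : OneParticle d) (ψ : Fock d k)
    (s : Finset ℕ) :
    ∑ n ∈ s, ‖annihSector n l h (ψ.component (n + 1))‖ ^ 2 ≤ (‖h‖ * ‖ψ‖) ^ 2 := by
  calc _ ≤ ∑ n ∈ s, ‖h‖ ^ 2 * ‖ψ.component (n + 1)‖ ^ 2 := by
        refine Finset.sum_le_sum fun n _ => ?_
        rw [← mul_pow]
        gcongr
        exact norm_annihSector_le l h _
    _ = ‖h‖ ^ 2 * ∑ n ∈ s.map ⟨Nat.succ, Nat.succ_injective⟩, ‖ψ.component n‖ ^ 2 := by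
        rw [Finset.mul_sum, Finset.sum_map]
        rfl
    _ ≤ ‖h‖ ^ 2 * ‖ψ‖ ^ 2 := by
        gcongr
        exact ψ.sum_norm_sq_le _
    _ = _ := (mul_pow _ _ _).symm

/-- The annihilation operator `a(h)` of a particle with the label `l`. -/
def ann (l : Label k) (h : OneParticle d) : Op d k :=
  LinearMap.mkContinuous
    { toFun := fun ψ => Fock.ofComponents (fun n => annihSector n l h (ψ.component (n + 1)))
        (sum_norm_sq_annihSector_le l h ψ)
      map_add' := fun φ ψ => Fock.ext_component fun n =>
        map_add (annihSector n l h) (φ.component (n + 1)) (ψ.component (n + 1))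
      map_smul' := fun c ψ => Fock.ext_component fun n =>
        map_smul (annihSector n l h) c (ψ.component (n + 1)) }
    ‖h‖ fun ψ => Fock.norm_le_of_sum (by positivity) (sum_norm_sq_annihSector_le l h ψ)

theorem component_ann (l : Label k) (h : OneParticle d) (ψ : Fock d k) (n : ℕ) :
    (ann l h ψ).component n = annihSector n l h (ψ.component (n + 1)) := rfl

theorem norm_ann_le (l : Label k) (h : OneParticle d) : ‖ann l h‖ ≤ ‖h‖ :=
  LinearMap.mkContinuous_norm_le _ (norm_nonneg _) _

/-- The creation operator `a*(h)` of a particle with the label `l`. -/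
def cre (l : Label k) (h : OneParticle d) : Op d k := ContinuousLinearMap.adjoint (ann l h)

theorem norm_cre_le (l : Label k) (h : OneParticle d) : ‖cre l h‖ ≤ ‖h‖ := by
  rw [cre, LinearIsometryEquiv.norm_map]
  exact norm_ann_le l h

theorem component_cre_succ (l : Label k) (h : OneParticle d) (ψ : Fock d k) (n : ℕ) :
    (cre l h ψ).component (n + 1) = createSector n l h (ψ.component n) := by
  refine ext_inner_left ℂ fun χ => ?_
  rw [← Fock.inner_single, cre, ContinuousLinearMap.adjoint_inner_right, createSector,
    ContinuousLinearMap.adjoint_inner_right, Fock.inner_eq, tsum_eq_single n, component_ann,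
    Fock.component_single_self]
  intro m hm
  rw [component_ann, Fock.component_single_ne _ (fun h => hm (Nat.succ_injective h)), map_zero,
    inner_zero_left]

theorem component_cre_zero (l : Label k) (h : OneParticle d) (ψ : Fock d k) :
    (cre l h ψ).component 0 = 0 := by
  refine ext_inner_left ℂ fun χ => ?_
  rw [← Fock.inner_single, cre, ContinuousLinearMap.adjoint_inner_right, Fock.inner_eq,
    inner_zero_right]
  refine (tsum_congr fun m => ?_).trans tsum_zero
  rw [component_ann, Fock.component_single_ne _ (Nat.succ_ne_zero m), map_zero, inner_zero_left]

theorem ann_cre (l l' : Label k) (f g : OneParticle d) :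
    ann l f * cre l' g + cre l' g * ann l f = (if l = l' then ⟪f, g⟫ else 0) • (1 : Op d k) := by
  ext1 ψ
  refine Fock.ext_component fun n => ?_
  change (ann l f (cre l' g ψ) + cre l' g (ann l f ψ)).component n =
    (if l = l' then ⟪f, g⟫ else 0) • ψ.component n
  rw [Fock.component_add, component_ann, component_cre_succ]
  cases n with
  | zero => rw [component_cre_zero, add_zero, annihSector_zero_createSector_zero]
  | succ n => rw [component_cre_succ, component_ann, annihSector_createSector]

theorem ann_ann (l l' : Label k) (f g : OneParticle d) :
    ann l f * ann l' g + ann l' g * ann l f = 0 := by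
  ext1 ψ
  refine Fock.ext_component fun n => ?_
  change (ann l f (ann l' g ψ) + ann l' g (ann l f ψ)).component n = 0
  rw [Fock.component_add, component_ann, component_ann, component_ann, component_ann,
    annihSector_annihSector, neg_add_cancel]

theorem cre_cre (l l' : Label k) (f g : OneParticle d) :
    cre l f * cre l' g + cre l' g * cre l f = 0 := by
  have h := congrArg star (ann_ann l l' f g)
  rw [star_add, star_mul, star_mul, star_zero] at h
  rw [add_comm]
  exact h

/-- With the norm bound this makes h ↦ a(h) Lipschitz, hence the time-evolved fields continuous in
operator norm. -/
theorem ann_sub (l : Label k) (f g : OneParticle d) : ann l (f - g) = ann l f - ann l g := by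
  have h1 : ∀ n (Ψ : Sector d k (n + 1)),
      removeParticle l (f - g) Ψ = removeParticle l f Ψ - removeParticle l g Ψ := by
    intro n Ψ
    simp only [removeParticle, map_sub]
    rfl
  ext1 ψ
  refine Fock.ext_component fun n => Subtype.ext ?_
  change (((ann l (f - g) ψ).component n : fermi d k n) : Sector d k n) =
    (((ann l f ψ - ann l g ψ).component n : fermi d k n) : Sector d k n)
  rw [Fock.component_sub, Submodule.coe_sub, component_ann, component_ann, component_ann,
    coe_annihSector, coe_annihSector, coe_annihSector, h1, smul_sub]

theorem continuous_ann (l : Label k) : Continuous (ann l : OneParticle d → Op d k) := by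
  refine LipschitzWith.continuous (K := 1) (LipschitzWith.of_dist_le_mul fun f g => ?_)
  rw [dist_eq_norm, dist_eq_norm, ← ann_sub, NNReal.coe_one, one_mul]
  exact norm_ann_le l _

theorem continuous_cre (l : Label k) : Continuous (cre l : OneParticle d → Op d k) :=
  ContinuousLinearMap.adjoint.continuous.comp (continuous_ann l)

end FreeFermions

end

noncomputable section

namespace FreeFermions

/-! ### The one-particle evolution -/

/-- The Fourier transform on L² is an extension by density. It agrees with the integral on
integrable functions because both define the same tempered distribution, by ∫ 𝓕φ f = ∫ φ 𝓕f. -/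
theorem fourier_eq_of_integrable {E F : Type*} [NormedAddCommGroup E] [MeasurableSpace E]
    [BorelSpace E] [NormedAddCommGroup F] [InnerProductSpace ℂ F] [CompleteSpace F]
    [InnerProductSpace ℝ E] [FiniteDimensional ℝ E] {f g : Lp (α := E) F 2} (hf : Integrable f)
    (hg : g =ᵐ[volume] 𝓕 (f : E → F)) : 𝓕 f = g := by
  have hinj : Function.Injective (Lp.toTemperedDistributionCLM F (volume : Measure E) 2) :=
    LinearMap.ker_eq_bot.1 (Lp.ker_toTemperedDistributionCLM_eq_bot)
  apply hinj
  ext φ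
  change Lp.toTemperedDistribution (𝓕 f) φ = Lp.toTemperedDistribution g φ
  rw [← Lp.fourier_toTemperedDistribution_eq f, TemperedDistribution.fourier_apply,
    Lp.toTemperedDistribution_apply, Lp.toTemperedDistribution_apply]
  have h := VectorFourier.integral_fourierIntegral_smul_eq_flip (μ := (volume : Measure E))
    (ν := (volume : Measure E)) (L := innerₗ E) (f := φ) (g := f) Real.continuous_fourierChar
    continuous_inner φ.integrable hf
  refine h.trans (integral_congr_ae ?_)
  filter_upwards [hg] with x hx
  rw [hx]
  simp [flip_innerₗ]
  rfl

variable {d k n : ℕ}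

/-- The function `e^{-it|2πξ|²}` of one momentum. -/
def onePhaseFun (d : ℕ) (t : ℝ) (ξ : EuclideanSpace ℝ (Fin d)) : ℂ :=
  Complex.exp (((-(t * (2 * Real.pi * ‖ξ‖) ^ 2) : ℝ) : ℂ) * Complex.I)

theorem norm_onePhaseFun (t : ℝ) (ξ : EuclideanSpace ℝ (Fin d)) : ‖onePhaseFun d t ξ‖ = 1 :=
  Complex.norm_exp_ofReal_mul_I _

theorem continuous_onePhaseFun (t : ℝ) : Continuous (onePhaseFun d t) := by
  unfold onePhaseFun
  fun_prop

theorem onePhaseFun_add (s t : ℝ) (ξ : EuclideanSpace ℝ (Fin d)) :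
    onePhaseFun d (s + t) ξ = onePhaseFun d s ξ * onePhaseFun d t ξ := by
  simp only [onePhaseFun]
  rw [← Complex.exp_add]
  congr 1
  push_cast
  ring

theorem onePhaseFun_zero (ξ : EuclideanSpace ℝ (Fin d)) : onePhaseFun d 0 ξ = 1 := by
  simp [onePhaseFun]

theorem conj_onePhaseFun (t : ℝ) (ξ : EuclideanSpace ℝ (Fin d)) :
    starRingEnd ℂ (onePhaseFun d t ξ) = onePhaseFun d (-t) ξ := by
  simp only [onePhaseFun]
  rw [← Complex.exp_conj, map_mul, Complex.conj_ofReal, Complex.conj_I]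
  congr 1
  push_cast
  ring

theorem phaseFun_splitPos (t : ℝ) (ξ : EuclideanSpace ℝ (Fin (n + 1) × Fin d)) :
    phaseFun d (n + 1) t ξ =
      onePhaseFun d t (splitPos d n ξ).2 * phaseFun d n t (splitPos d n ξ).1 := by
  simp only [phaseFun, onePhaseFun]
  rw [← Complex.exp_add]
  congr 1
  rw [mul_pow, norm_sq_splitPos]
  push_cast
  ring

theorem memLp_onePhaseFun (d : ℕ) (t : ℝ) : MemLp (onePhaseFun d t) ∞ volume :=
  memLp_top_of_bound (continuous_onePhaseFun t).aestronglyMeasurable 1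
    (Filter.Eventually.of_forall fun ξ => (norm_onePhaseFun t ξ).le)

/-- Multiplication by `e^{-it|2πξ|²}` on the one-particle space. -/
def onePhaseOp (d : ℕ) (t : ℝ) : OneParticle d →L[ℂ] OneParticle d :=
  (ContinuousLinearMap.lsmul ℂ ℂ).holderL volume ∞ 2 2 (memLp_onePhaseFun d t).toLp

theorem onePhaseOp_ae (t : ℝ) (f : OneParticle d) :
    onePhaseOp d t f =ᵐ[volume] fun ξ => onePhaseFun d t ξ * f ξ := by
  refine (ContinuousLinearMap.coeFn_holder _ _ _).trans ?_
  filter_upwards [(memLp_onePhaseFun d t).coeFn_toLp] with ξ hξ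
  simp [hξ]

theorem onePhaseOp_onePhaseOp (s t : ℝ) (f : OneParticle d) :
    onePhaseOp d s (onePhaseOp d t f) = onePhaseOp d (s + t) f := by
  apply Lp.ext
  filter_upwards [onePhaseOp_ae s (onePhaseOp d t f), onePhaseOp_ae t f,
    onePhaseOp_ae (s + t) f] with ξ h1 h2 h3
  rw [h1, h2, h3, onePhaseFun_add, mul_assoc]

theorem onePhaseOp_zero (f : OneParticle d) : onePhaseOp d 0 f = f := by
  apply Lp.ext
  filter_upwards [onePhaseOp_ae 0 f] with ξ h1
  rw [h1, onePhaseFun_zero, one_mul]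

theorem norm_onePhaseOp (t : ℝ) (f : OneParticle d) : ‖onePhaseOp d t f‖ = ‖f‖ := by
  simp only [Lp.norm_def]
  congr 1
  refine eLpNorm_congr_norm_ae ?_
  filter_upwards [onePhaseOp_ae t f] with ξ hξ
  rw [hξ, norm_mul, norm_onePhaseFun, one_mul]

theorem inner_onePhaseOp (s t : ℝ) (f g : OneParticle d) :
    ⟪onePhaseOp d s f, onePhaseOp d t g⟫ = ∫ ξ, onePhaseFun d (t - s) ξ * ⟪f ξ, g ξ⟫ := by
  rw [L2.inner_def]
  refine integral_congr_ae ?_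
  filter_upwards [onePhaseOp_ae s f, onePhaseOp_ae t g] with ξ h1 h2
  rw [h1, h2, sub_eq_neg_add, onePhaseFun_add, ← conj_onePhaseFun]
  simp only [RCLike.inner_apply, map_mul]
  ring

/-- For unitary operators ‖U_t f - U_s f‖² = 2‖f‖² - 2 Re⟨U_s f, U_t f⟩, and the scalar product is
continuous by dominated convergence. -/
theorem continuous_onePhaseOp (f : OneParticle d) : Continuous fun t => onePhaseOp d t f := by
  rw [continuous_iff_continuousAt]
  intro s
  have h1 : Continuous fun t => ⟪onePhaseOp d s f, onePhaseOp d t f⟫ := by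
    simp only [inner_onePhaseOp]
    have hi : Integrable fun ξ => (⟪f ξ, f ξ⟫ : ℂ) := L2.integrable_inner f f
    refine continuous_of_dominated (fun t =>
      (continuous_onePhaseFun _).aestronglyMeasurable.mul hi.aestronglyMeasurable)
      (bound := fun ξ => ‖(⟪f ξ, f ξ⟫ : ℂ)‖) (fun t => Filter.Eventually.of_forall fun ξ => ?_)
      hi.norm (Filter.Eventually.of_forall fun ξ => ?_)
    · rw [norm_mul, norm_onePhaseFun, one_mul]
    · unfold onePhaseFun
      fun_prop
  have h2 : ∀ t, ‖onePhaseOp d t f - onePhaseOp d s f‖ ^ 2 =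
      2 * ‖f‖ ^ 2 - 2 * (⟪onePhaseOp d s f, onePhaseOp d t f⟫ : ℂ).re := by
    intro t
    rw [@norm_sub_sq ℂ, norm_onePhaseOp, norm_onePhaseOp, inner_re_symm]
    simp only [RCLike.re_eq_complex_re]
    ring
  have h3 : Continuous fun t => ‖onePhaseOp d t f - onePhaseOp d s f‖ ^ 2 := by
    simp only [h2]
    fun_prop
  have h4 := (Real.continuous_sqrt.comp h3).tendsto s
  simp only [Function.comp_def, Real.sqrt_sq (norm_nonneg _), sub_self, norm_zero,
    zero_pow two_ne_zero, Real.sqrt_zero] at h4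
  exact tendsto_iff_norm_sub_tendsto_zero.2 h4

/-- The one-particle evolution `e^{itΔ}`. -/
def oneEvol (t : ℝ) (h : OneParticle d) : OneParticle d := 𝓕⁻ (onePhaseOp d t (𝓕 h))

theorem fourier_oneEvol (t : ℝ) (h : OneParticle d) : 𝓕 (oneEvol t h) = onePhaseOp d t (𝓕 h) :=
  FourierInvPair.fourier_fourierInv_eq _

theorem oneEvol_zero (h : OneParticle d) : oneEvol 0 h = h := by
  rw [oneEvol, onePhaseOp_zero]
  exact FourierPair.fourierInv_fourier_eq _

theorem oneEvol_oneEvol (s t : ℝ) (h : OneParticle d) :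
    oneEvol s (oneEvol t h) = oneEvol (s + t) h := by
  rw [oneEvol, fourier_oneEvol, onePhaseOp_onePhaseOp, oneEvol]

theorem norm_oneEvol (t : ℝ) (h : OneParticle d) : ‖oneEvol t h‖ = ‖h‖ := by
  rw [← Lp.norm_fourier_eq, fourier_oneEvol, norm_onePhaseOp, Lp.norm_fourier_eq]

theorem continuous_oneEvol (h : OneParticle d) : Continuous fun t => oneEvol t h :=
  (Lp.fourierTransformₗᵢ (EuclideanSpace ℝ (Fin d)) ℂ).symm.continuous.comp
    (continuous_onePhaseOp (𝓕 h))

theorem inner_oneEvol (s t : ℝ) (f g : OneParticle d) :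
    ⟪oneEvol s f, oneEvol t g⟫ = ⟪f, oneEvol (t - s) g⟫ := by
  rw [← Lp.inner_fourier_eq, fourier_oneEvol, fourier_oneEvol, ← Lp.inner_fourier_eq f,
    fourier_oneEvol, inner_onePhaseOp, ← onePhaseOp_zero (𝓕 f), inner_onePhaseOp, sub_zero,
    onePhaseOp_zero]

/-! ### Covariance of the creation and annihilation operators -/

theorem phaseOp_addParticle (t : ℝ) (l : Label k) (h : OneParticle d) (ψ : Sector d k n) :
    phaseOp d k (n + 1) t (addParticle l h ψ) =
      addParticle l (onePhaseOp d t h) (phaseOp d k n t ψ) := by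
  apply Lp.ext
  filter_upwards [phaseOp_ae d k (n + 1) t (addParticle l h ψ), addParticle_ae l h ψ,
    addParticle_ae_of_ae l (onePhaseOp_ae t h) (phaseOp_ae d k n t ψ)] with x h1 h2 h3
  rw [h1, h2, h3, phaseFun_splitPos, map_smul, smul_smul, smul_smul]
  congr 1
  ring

theorem fourier_addParticle_fun (l : Label k) {h : EuclideanSpace ℝ (Fin d) → ℂ}
    {ψ : EuclideanSpace ℝ (Fin n × Fin d) → EuclideanSpace ℂ (Fin n → Label k)}
    (hψ : Integrable ψ) (ξ : EuclideanSpace ℝ (Fin (n + 1) × Fin d)) :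
    𝓕 (fun x => h (splitPos d n x).2 • labelCons k n l (ψ (splitPos d n x).1)) ξ =
      𝓕 h (splitPos d n ξ).2 • labelCons k n l (𝓕 ψ (splitPos d n ξ).1) := by
  rw [Real.fourier_eq, Real.fourier_eq, Real.fourier_eq]
  have hi := (Real.fourierIntegral_convergent_iff (μ := volume) (splitPos d n ξ).1).2 hψ
  have e : labelCons k n l (∫ v, 𝐞 (-inner ℝ v (splitPos d n ξ).1) • ψ v) =
      ∫ v, labelCons k n l (𝐞 (-inner ℝ v (splitPos d n ξ).1) • ψ v) :=
    ((labelCons k n l).toContinuousLinearMap.integral_comp_comm hi).symm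
  rw [e]
  have e2 := integral_prod_smul (μ := (volume : Measure (EuclideanSpace ℝ (Fin d))))
    (ν := (volume : Measure (EuclideanSpace ℝ (Fin n × Fin d))))
    (fun x => (𝐞 (-inner ℝ x (splitPos d n ξ).2) : Circle) • h x)
    (fun v => labelCons k n l (𝐞 (-inner ℝ v (splitPos d n ξ).1) • ψ v))
  refine Eq.trans ?_ e2
  rw [← integral_prod_swap]
  have e3 := (measurePreserving_splitPos d n).integral_comp (splitPos d n).measurableEmbedding
    fun z => ((𝐞 (-inner ℝ z.swap.1 (splitPos d n ξ).2) : Circle) • h z.swap.1) •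
      labelCons k n l (𝐞 (-inner ℝ z.swap.2 (splitPos d n ξ).1) • ψ z.swap.2)
  refine Eq.trans ?_ e3
  refine integral_congr_ae (Filter.Eventually.of_forall fun x => ?_)
  simp only [Prod.fst_swap, Prod.snd_swap, Circle.smul_def, map_smul, smul_smul, smul_eq_mul]
  congr 1
  rw [inner_splitPos, neg_add, AddChar.map_add_eq_mul, Circle.coe_mul]
  ring

/-- Both sides are continuous in h and in ψ separately, so it suffices to take Schwartz functions,
for which the Fourier integral factorises. -/
theorem fourier_addParticle (l : Label k) (h : OneParticle d) (ψ : Sector d k n) :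
    𝓕 (addParticle l h ψ) = addParticle l (𝓕 h) (𝓕 ψ) := by
  have c1 : Continuous (fun h : OneParticle d => (𝓕 h : OneParticle d)) :=
    (Lp.fourierTransformₗᵢ _ _).continuous
  have c2 : Continuous (fun h : Sector d k n => (𝓕 h : Sector d k n)) :=
    (Lp.fourierTransformₗᵢ _ _).continuous
  have c3 : Continuous (fun h : Sector d k (n + 1) => (𝓕 h : Sector d k (n + 1))) :=
    (Lp.fourierTransformₗᵢ _ _).continuous
  have hd1 : DenseRange fun h : 𝓢(EuclideanSpace ℝ (Fin d), ℂ) => h.toLp 2 volume :=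
    SchwartzMap.denseRange_toLpCLM (E := EuclideanSpace ℝ (Fin d)) (μ := volume) (p := 2)
      ENNReal.ofNat_ne_top
  have hd2 : DenseRange fun ψ : 𝓢(EuclideanSpace ℝ (Fin n × Fin d),
      EuclideanSpace ℂ (Fin n → Label k)) => ψ.toLp 2 volume :=
    SchwartzMap.denseRange_toLpCLM (E := EuclideanSpace ℝ (Fin n × Fin d)) (μ := volume) (p := 2)
      ENNReal.ofNat_ne_top
  refine hd1.induction_on (p := fun h => 𝓕 (addParticle l h ψ) = addParticle l (𝓕 h) (𝓕 ψ)) h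
    (isClosed_eq (c3.comp ((addParticleL d n l).flip ψ).continuous)
      (((addParticleL d n l).flip (𝓕 ψ)).continuous.comp c1)) fun h => ?_
  refine hd2.induction_on (p := fun ψ => 𝓕 (addParticle l (h.toLp 2 volume) ψ) =
      addParticle l (𝓕 (h.toLp 2 volume)) (𝓕 ψ)) ψ
    (isClosed_eq (c3.comp (addParticleL d n l _).continuous)
      ((addParticleL d n l (𝓕 (h.toLp 2 volume))).continuous.comp c2)) fun ψ => ?_
  have e := addParticle_ae_of_ae l (h.coeFn_toLp 2 volume) (ψ.coeFn_toLp 2 volume)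
  refine fourier_eq_of_integrable ?_ ?_
  · refine Integrable.congr ?_ e.symm
    have hi : Integrable (fun q : EuclideanSpace ℝ (Fin n × Fin d) × EuclideanSpace ℝ (Fin d) =>
        h q.2 • labelCons k n l (ψ q.1)) (volume.prod volume) := by
      have h1 : Integrable fun x => labelCons k n l (ψ x) :=
        (labelCons k n l).toContinuousLinearMap.integrable_comp ψ.integrable
      have h2 : Integrable h (volume : Measure (EuclideanSpace ℝ (Fin d))) := h.integrable
      exact (h2.smul_prod h1).swap
    exact (measurePreserving_splitPos d n).integrable_comp_of_integrable hi
  · rw [SchwartzMap.toLp_fourier_eq, SchwartzMap.toLp_fourier_eq]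
    refine (addParticle_ae_of_ae l ((𝓕 h).coeFn_toLp 2 volume)
      ((𝓕 ψ).coeFn_toLp 2 volume)).trans (Filter.Eventually.of_forall fun ξ => ?_)
    rw [Real.fourier_congr_ae e, fourier_addParticle_fun l ψ.integrable]
    rfl

theorem sectorEvol_eq (t : ℝ) (Ψ : Sector d k n) :
    sectorEvol d k n t Ψ = 𝓕⁻ (phaseOp d k n t (𝓕 Ψ)) := rfl

theorem fourier_sectorEvol (t : ℝ) (Ψ : Sector d k n) :
    𝓕 (sectorEvol d k n t Ψ) = phaseOp d k n t (𝓕 Ψ) :=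
  FourierInvPair.fourier_fourierInv_eq _

/-- The kinetic energy is additive, so in Fourier space the phase factorises over the new particle
and the others. -/
theorem sectorEvol_addParticle (t : ℝ) (l : Label k) (h : OneParticle d) (ψ : Sector d k n) :
    sectorEvol d k (n + 1) t (addParticle l h ψ) =
      addParticle l (oneEvol t h) (sectorEvol d k n t ψ) := by
  apply (Lp.fourierTransformₗᵢ (EuclideanSpace ℝ (Fin (n + 1) × Fin d))
      (EuclideanSpace ℂ (Fin (n + 1) → Label k))).injective
  change 𝓕 (sectorEvol d k (n + 1) t (addParticle l h ψ)) =
    𝓕 (addParticle l (oneEvol t h) (sectorEvol d k n t ψ))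
  rw [fourier_sectorEvol, fourier_addParticle, fourier_addParticle, phaseOp_addParticle,
    fourier_oneEvol, fourier_sectorEvol]

theorem sectorEvol_neg (t : ℝ) (Ψ : Sector d k n) :
    sectorEvol d k n t (sectorEvol d k n (-t) Ψ) = Ψ := by
  have h : phaseOp d k n t (phaseOp d k n (-t) (𝓕 Ψ)) = 𝓕 Ψ := by
    apply Lp.ext
    filter_upwards [phaseOp_ae d k n t (phaseOp d k n (-t) (𝓕 Ψ)),
      phaseOp_ae d k n (-t) (𝓕 Ψ)] with ξ h1 h2
    rw [h1, h2, smul_smul]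
    simp only [phaseFun]
    rw [← Complex.exp_add]
    simp
  rw [sectorEvol_eq t, fourier_sectorEvol, h]
  exact FourierPair.fourierInv_fourier_eq _

theorem inner_sectorEvol (t : ℝ) (Φ Ψ : Sector d k n) :
    ⟪sectorEvol d k n t Φ, Ψ⟫ = ⟪Φ, sectorEvol d k n (-t) Ψ⟫ := by
  let U : Sector d k n →ₗᵢ[ℂ] Sector d k n :=
    { (sectorEvol d k n t).toLinearMap with norm_map' := norm_sectorEvol d k n t }
  have h := U.inner_map_map Φ (sectorEvol d k n (-t) Ψ)
  change ⟪sectorEvol d k n t Φ, sectorEvol d k n t (sectorEvol d k n (-t) Ψ)⟫ = _ at h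
  rwa [sectorEvol_neg] at h

theorem removeParticle_sectorEvol (t : ℝ) (l : Label k) (h : OneParticle d)
    (Ψ : Sector d k (n + 1)) :
    removeParticle l (oneEvol t h) (sectorEvol d k (n + 1) t Ψ) =
      sectorEvol d k n t (removeParticle l h Ψ) := by
  refine ext_inner_left ℂ fun ψ => ?_
  have h1 : ⟪ψ, sectorEvol d k n t (removeParticle l h Ψ)⟫ =
      ⟪sectorEvol d k n (-t) ψ, removeParticle l h Ψ⟫ := by
    rw [inner_sectorEvol, neg_neg]
  have h2 : ⟪addParticle l (oneEvol t h) ψ, sectorEvol d k (n + 1) t Ψ⟫ =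
      ⟪sectorEvol d k (n + 1) (-t) (addParticle l (oneEvol t h) ψ), Ψ⟫ := by
    rw [inner_sectorEvol, neg_neg]
  rw [inner_removeParticle, h1, inner_removeParticle, h2, sectorEvol_addParticle]
  rw [oneEvol_oneEvol, neg_add_cancel, oneEvol_zero]

theorem evol_mul_ann (t : ℝ) (l : Label k) (h : OneParticle d) :
    evol d k t * ann l h = ann l (oneEvol t h) * evol d k t := by
  ext1 ψ
  refine Fock.ext_component fun n => Subtype.ext ?_
  change sectorEvol d k n t ((ann l h ψ).component n) =
    ((ann l (oneEvol t h) (evol d k t ψ)).component n : Sector d k n)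
  rw [component_ann, component_ann, coe_annihSector, coe_annihSector, evol_component,
    removeParticle_sectorEvol, map_smul]

theorem evol_mul_evol_neg (t : ℝ) : evol d k t * evol d k (-t) = 1 := by
  ext1 ψ
  exact Fock.ext_component fun n => Subtype.ext (sectorEvol_neg t (ψ.component n : Sector d k n))

theorem star_evol (t : ℝ) : star (evol d k t) = evol d k (-t) := by
  rw [ContinuousLinearMap.star_eq_adjoint]
  symm
  refine (ContinuousLinearMap.eq_adjoint_iff _ _).2 fun φ ψ => ?_
  rw [Fock.inner_eq, Fock.inner_eq]
  refine tsum_congr fun n => ?_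
  rw [Submodule.coe_inner, Submodule.coe_inner, evol_component, evol_component, inner_sectorEvol,
    neg_neg]

/-- Conjugation with the free evolution. -/
theorem interactionPicture_eq (W : Op d k) (t : ℝ) :
    interactionPicture W t = evol d k t * W * evol d k (-t) := by
  rw [interactionPicture, freeDynamics, neg_neg]

theorem interactionPicture_mul (V W : Op d k) (t : ℝ) :
    interactionPicture (V * W) t = interactionPicture V t * interactionPicture W t := by
  have h := evol_mul_evol_neg (d := d) (k := k) (-t)
  rw [neg_neg] at h
  simp only [interactionPicture_eq]
  calc _ = evol d k t * V * 1 * W * evol d k (-t) := by rw [mul_one]; noncomm_ring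
    _ = _ := by rw [← h]; noncomm_ring

theorem interactionPicture_one (t : ℝ) : interactionPicture (1 : Op d k) t = 1 := by
  rw [interactionPicture_eq, mul_one, evol_mul_evol_neg]

/-- The free dynamics is quasi-free: it acts on the fields through the one-particle evolution. Hence
anticommutators at different times are still scalars. -/
theorem interactionPicture_ann (l : Label k) (h : OneParticle d) (t : ℝ) :
    interactionPicture (ann l h) t = ann l (oneEvol t h) := by
  rw [interactionPicture_eq, evol_mul_ann, mul_assoc, evol_mul_evol_neg, mul_one]

theorem interactionPicture_cre (l : Label k) (h : OneParticle d) (t : ℝ) :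
    interactionPicture (cre l h) t = cre l (oneEvol t h) := by
  have e := congrArg star (interactionPicture_ann l h t)
  rw [interactionPicture_eq, star_mul, star_mul, star_evol, star_evol, neg_neg, ← mul_assoc] at e
  rw [interactionPicture_eq]
  exact e

/-- The interaction picture as a bounded linear map on operators. -/
def interactionPictureL (d k : ℕ) (t : ℝ) : Op d k →L[ℂ] Op d k :=
  (ContinuousLinearMap.mul ℂ (Op d k)).flip (evol d k (-t)) ∘L
    ContinuousLinearMap.mul ℂ (Op d k) (evol d k t)

theorem interactionPictureL_apply (W : Op d k) (t : ℝ) :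
    interactionPictureL d k t W = interactionPicture W t :=
  (interactionPicture_eq W t).symm

end FreeFermions

end

noncomputable section

namespace FreeFermions

/-! ### Hermite functions of one variable -/

/-- The normalised Hermite polynomials. -/
def hermPoly : ℕ → Polynomial ℝ
  | 0 => Polynomial.C (Real.sqrt (Real.sqrt Real.pi))⁻¹
  | n + 1 => Polynomial.C (Real.sqrt (2 * (n + 1)))⁻¹ *
      (2 * Polynomial.X * hermPoly n - Polynomial.derivative (hermPoly n))

theorem sqrt_two_mul_pos (n : ℕ) : 0 < Real.sqrt (2 * (n + 1)) :=
  Real.sqrt_pos.2 (by positivity)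

theorem sqrt_two_mul_sq (n : ℕ) :
    Real.sqrt (2 * (n + 1)) * Real.sqrt (2 * (n + 1)) = 2 * (n + 1) :=
  Real.mul_self_sqrt (by positivity)

theorem sqrt_smul_hermPoly_succ (n : ℕ) :
    Polynomial.C (Real.sqrt (2 * (n + 1))) * hermPoly (n + 1) =
      2 * Polynomial.X * hermPoly n - Polynomial.derivative (hermPoly n) := by
  rw [hermPoly, ← mul_assoc, ← Polynomial.C_mul, mul_inv_cancel₀ (sqrt_two_mul_pos n).ne',
    Polynomial.C_1, one_mul]

theorem derivative_hermPoly_zero : Polynomial.derivative (hermPoly 0) = 0 :=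
  Polynomial.derivative_C

/-- Differentiate the recursion. The statement for the previous index turns the remaining 2X h' -
h'' into a multiple of h. -/
theorem derivative_hermPoly_succ (n : ℕ) :
    Polynomial.derivative (hermPoly (n + 1)) =
      Polynomial.C (Real.sqrt (2 * (n + 1))) * hermPoly n := by
  have hC : Polynomial.C (Real.sqrt (2 * (n + 1))) ≠ 0 := by
    rw [Ne, Polynomial.C_eq_zero]
    exact (sqrt_two_mul_pos n).ne'
  refine mul_left_cancel₀ hC ?_
  rw [← mul_assoc, ← Polynomial.C_mul, sqrt_two_mul_sq]
  have h := congrArg Polynomial.derivative (sqrt_smul_hermPoly_succ n)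
  rw [Polynomial.derivative_C_mul] at h
  rw [h]
  have h2 : Polynomial.derivative (2 * Polynomial.X * hermPoly n -
      Polynomial.derivative (hermPoly n)) = 2 * hermPoly n + (2 * Polynomial.X *
        Polynomial.derivative (hermPoly n) -
          Polynomial.derivative (Polynomial.derivative (hermPoly n))) := by
    simp only [Polynomial.derivative_sub, Polynomial.derivative_mul, Polynomial.derivative_X,
      Polynomial.derivative_ofNat]
    ring
  rw [h2]
  cases n with
  | zero =>
    rw [derivative_hermPoly_zero]
    simp only [Polynomial.derivative_zero, mul_zero, sub_zero, add_zero, Nat.cast_zero, zero_add,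
      mul_one, Polynomial.C_ofNat]
  | succ n =>
    have h3 : 2 * Polynomial.X * Polynomial.derivative (hermPoly (n + 1)) -
          Polynomial.derivative (Polynomial.derivative (hermPoly (n + 1))) =
        Polynomial.C (2 * ((n : ℝ) + 1)) * hermPoly (n + 1) := by
      have h4 := sqrt_smul_hermPoly_succ n
      have h5 : Polynomial.C (2 * ((n : ℝ) + 1)) = Polynomial.C (Real.sqrt (2 * (n + 1))) *
          Polynomial.C (Real.sqrt (2 * (n + 1))) := by
        rw [← Polynomial.C_mul, sqrt_two_mul_sq]
      rw [derivative_hermPoly_succ n, Polynomial.derivative_C_mul, h5]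
      linear_combination (-Polynomial.C (Real.sqrt (2 * ((n : ℝ) + 1)))) * h4
    rw [h3]
    simp only [Polynomial.C_mul, Polynomial.C_add, Nat.cast_add, Nat.cast_one, Polynomial.C_1]
    simp only [Polynomial.C_ofNat]
    ring

theorem hermPoly_ode (n : ℕ) :
    Polynomial.derivative (Polynomial.derivative (hermPoly n)) =
      2 * Polynomial.X * Polynomial.derivative (hermPoly n) -
        Polynomial.C (2 * (n : ℝ)) * hermPoly n := by
  cases n with
  | zero => simp [derivative_hermPoly_zero]
  | succ n =>
    have h := sqrt_smul_hermPoly_succ n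
    have h' : Polynomial.derivative (hermPoly n) = 2 * Polynomial.X * hermPoly n -
      Polynomial.C (Real.sqrt (2 * (n + 1))) * hermPoly (n + 1) := by rw [h]; ring
    have hc : Polynomial.C (2 * ((n + 1 : ℕ) : ℝ)) = Polynomial.C (Real.sqrt (2 * (n + 1))) *
        Polynomial.C (Real.sqrt (2 * (n + 1))) := by
      rw [← Polynomial.C_mul, sqrt_two_mul_sq, Nat.cast_add, Nat.cast_one]
    rw [derivative_hermPoly_succ, Polynomial.derivative_C_mul, h', hc]
    ring

/-- A subspace that contains the Hermite polynomials contains all polynomials. -/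
theorem mem_of_hermPoly_mem (S : Submodule ℝ (Polynomial ℝ)) (hS : ∀ n, hermPoly n ∈ S)
    (p : Polynomial ℝ) : p ∈ S := by
  have h1 : ∀ m n : ℕ, Polynomial.X ^ m * hermPoly n ∈ S := by
    intro m
    induction m with
    | zero => simpa using hS
    | succ m ih =>
      intro n
      have h2 : Polynomial.X ^ m * Polynomial.derivative (hermPoly n) ∈ S := by
        cases n with
        | zero => simp [derivative_hermPoly_zero]
        | succ n =>
          rw [derivative_hermPoly_succ, mul_left_comm, ← Polynomial.smul_eq_C_mul]
          exact S.smul_mem _ (ih n)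
      have h3 : Polynomial.X ^ m * (Polynomial.C (Real.sqrt (2 * (n + 1))) * hermPoly (n + 1)) ∈
          S := by
        rw [mul_left_comm, ← Polynomial.smul_eq_C_mul]
        exact S.smul_mem _ (ih (n + 1))
      have h4 := S.smul_mem (2⁻¹ : ℝ) (S.add_mem h2 h3)
      rw [sqrt_smul_hermPoly_succ, ← mul_add] at h4
      convert h4 using 1
      rw [add_sub_cancel, mul_assoc (2 : Polynomial ℝ), mul_left_comm _ (2 : Polynomial ℝ),
        ← Polynomial.C_ofNat, ← Polynomial.smul_eq_C_mul, smul_smul]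
      simp
      ring
  have h5 : ∀ m : ℕ, (Polynomial.X ^ m : Polynomial ℝ) ∈ S := by
    intro m
    have h6 := S.smul_mem (Real.sqrt (Real.sqrt Real.pi)) (h1 m 0)
    rw [hermPoly, mul_comm, ← Polynomial.smul_eq_C_mul, smul_smul, mul_inv_cancel₀, one_smul] at h6
    · exact h6
    · exact (Real.sqrt_pos.2 (Real.sqrt_pos.2 Real.pi_pos)).ne'
  induction p using Polynomial.induction_on' with
  | add p q hp hq => exact S.add_mem hp hq
  | monomial m c =>
    rw [← Polynomial.C_mul_X_pow_eq_monomial, ← Polynomial.smul_eq_C_mul]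
    exact S.smul_mem _ (h5 m)

/-- Polynomials are dominated by Gaussians. -/
theorem exists_abs_eval_le (p : Polynomial ℝ) {b : ℝ} (hb : 0 < b) :
    ∃ C : ℝ, 0 ≤ C ∧ ∀ t : ℝ, |p.eval t| ≤ C * Real.exp (b * t ^ 2) := by
  induction p using Polynomial.induction_on' with
  | add p q hp hq =>
    obtain ⟨C, hC, h⟩ := hp
    obtain ⟨C', hC', h'⟩ := hq
    refine ⟨C + C', by positivity, fun t => ?_⟩
    rw [Polynomial.eval_add, add_mul]
    exact (abs_add_le _ _).trans (add_le_add (h t) (h' t))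
  | monomial m c =>
    refine ⟨|c| * (1 + m.factorial / b ^ m), by positivity, fun t => ?_⟩
    rw [Polynomial.eval_monomial, abs_mul, abs_pow, mul_assoc]
    gcongr
    have h1 : |t| ^ m ≤ 1 + (t ^ 2) ^ m := by
      rw [← sq_abs, ← pow_mul]
      rcases le_total |t| 1 with h | h
      · exact (pow_le_one₀ (abs_nonneg _) h).trans (le_add_of_nonneg_right (by positivity))
      · exact (pow_le_pow_right₀ h (by omega)).trans (le_add_of_nonneg_left zero_le_one)
    have h2 : (b * t ^ 2) ^ m / m.factorial ≤ Real.exp (b * t ^ 2) :=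
      Real.pow_div_factorial_le_exp _ (by positivity) m
    have h3 : 1 ≤ Real.exp (b * t ^ 2) := Real.one_le_exp (by positivity)
    have h4 : (t ^ 2) ^ m = m.factorial / b ^ m * ((b * t ^ 2) ^ m / m.factorial) := by
      rw [mul_pow]
      have : (m.factorial : ℝ) ≠ 0 := by positivity
      field_simp
    rw [add_mul, one_mul]
    refine h1.trans (add_le_add h3 ?_)
    rw [h4]
    gcongr

theorem integrable_eval_mul_gaussian (p : Polynomial ℝ) {b : ℝ} (hb : 0 < b) :
    Integrable fun t : ℝ => p.eval t * Real.exp (-b * t ^ 2) := by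
  obtain ⟨C, hC, h⟩ := exists_abs_eval_le p (half_pos hb)
  refine Integrable.mono' ((integrable_exp_neg_mul_sq (half_pos hb)).const_mul C)
    (by fun_prop) (Filter.Eventually.of_forall fun t => ?_)
  rw [Real.norm_eq_abs, abs_mul, Real.abs_exp]
  calc _ ≤ C * Real.exp (b / 2 * t ^ 2) * Real.exp (-b * t ^ 2) := by
        gcongr
        exact h t
    _ = _ := by
        rw [mul_assoc, ← Real.exp_add]
        congr 2
        ring

/-- Integration by parts against the Gaussian `e^{-t²}`. -/
theorem integral_gaussian_derivative (q : Polynomial ℝ) :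
    ∫ t : ℝ, (Polynomial.derivative q - 2 * Polynomial.X * q).eval t * Real.exp (-1 * t ^ 2) =
      0 := by
  refine integral_eq_zero_of_hasDerivAt_of_integrable
    (f := fun t => q.eval t * Real.exp (-1 * t ^ 2)) (fun t => ?_)
    (integrable_eval_mul_gaussian _ one_pos) (integrable_eval_mul_gaussian _ one_pos)
  have h1 : HasDerivAt (fun t : ℝ => Real.exp (-1 * t ^ 2))
      (Real.exp (-1 * t ^ 2) * (-1 * (2 * t))) t := by
    refine HasDerivAt.exp (HasDerivAt.const_mul _ ?_)
    simpa using hasDerivAt_pow 2 t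
  refine ((q.hasDerivAt t).fun_mul h1).congr_deriv ?_
  rw [Polynomial.eval_sub, Polynomial.eval_mul, Polynomial.eval_mul, Polynomial.eval_X,
    Polynomial.eval_ofNat]
  ring

/-- With respect to the Gaussian weight, the raising operator 2X - d/dX is the adjoint of d/dX. -/
theorem integral_hermPoly_succ_mul (n : ℕ) (q : Polynomial ℝ) :
    Real.sqrt (2 * (n + 1)) * ∫ t : ℝ, (hermPoly (n + 1) * q).eval t * Real.exp (-1 * t ^ 2) =
      ∫ t : ℝ, (hermPoly n * Polynomial.derivative q).eval t * Real.exp (-1 * t ^ 2) := by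
  have h := integral_gaussian_derivative (hermPoly n * q)
  rw [← integral_const_mul, ← sub_eq_zero, ← integral_sub
    ((integrable_eval_mul_gaussian _ one_pos).const_mul _) (integrable_eval_mul_gaussian _ one_pos),
    ← neg_eq_zero, ← h, ← integral_neg]
  refine integral_congr_ae (Filter.Eventually.of_forall fun t => ?_)
  have e := congrArg (Polynomial.eval t) (sqrt_smul_hermPoly_succ n)
  simp only [Polynomial.eval_mul, Polynomial.eval_C, Polynomial.eval_sub, Polynomial.eval_X,
    Polynomial.eval_ofNat, Polynomial.derivative_mul, Polynomial.eval_add] at e ⊢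
  linear_combination (-(q.eval t) * Real.exp (-1 * t ^ 2)) * e

/-- Adjointness lowers both indices by one until one of them is 0; if the other one is not, the
derivative kills the constant polynomial. -/
theorem integral_hermPoly_mul (m n : ℕ) :
    ∫ t : ℝ, (hermPoly m * hermPoly n).eval t * Real.exp (-1 * t ^ 2) = if m = n then 1 else 0 := by
  induction m generalizing n with
  | zero =>
    cases n with
    | zero =>
      have hp : Real.sqrt (Real.sqrt Real.pi) * Real.sqrt (Real.sqrt Real.pi) =
        Real.sqrt Real.pi := Real.mul_self_sqrt (Real.sqrt_nonneg _)
      have h0 : Real.sqrt Real.pi ≠ 0 := (Real.sqrt_pos.2 Real.pi_pos).ne'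
      simp only [hermPoly, Polynomial.eval_mul, Polynomial.eval_C]
      rw [integral_const_mul, integral_gaussian, div_one, ← mul_inv, hp, inv_mul_cancel₀ h0]
      rfl
    | succ n =>
      have h := integral_hermPoly_succ_mul n (hermPoly 0)
      rw [derivative_hermPoly_zero, mul_zero] at h
      simp only [Polynomial.eval_zero, zero_mul, integral_zero] at h
      rw [mul_comm (hermPoly 0), (mul_eq_zero.1 h).resolve_left (sqrt_two_mul_pos n).ne',
        if_neg (Nat.succ_ne_zero n).symm]
  | succ m ih =>
    have h := integral_hermPoly_succ_mul m (hermPoly n)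
    cases n with
    | zero =>
      rw [derivative_hermPoly_zero, mul_zero] at h
      simp only [Polynomial.eval_zero, zero_mul, integral_zero] at h
      rw [(mul_eq_zero.1 h).resolve_left (sqrt_two_mul_pos m).ne', if_neg (Nat.succ_ne_zero m)]
    | succ n =>
      rw [derivative_hermPoly_succ] at h
      have e : ∀ t : ℝ, (hermPoly m * (Polynomial.C (Real.sqrt (2 * (n + 1))) * hermPoly n)).eval t
          * Real.exp (-1 * t ^ 2) = Real.sqrt (2 * (n + 1)) *
            ((hermPoly m * hermPoly n).eval t * Real.exp (-1 * t ^ 2)) := by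
        intro t
        simp only [Polynomial.eval_mul, Polynomial.eval_C]
        ring
      simp only [e] at h
      rw [integral_const_mul, ih] at h
      by_cases hmn : m = n
      · subst hmn
        rw [if_pos rfl] at h ⊢
        exact mul_left_cancel₀ (sqrt_two_mul_pos m).ne' h
      · rw [if_neg hmn, mul_zero] at h
        rw [if_neg (fun e => hmn (Nat.succ_injective e))]
        exact (mul_eq_zero.1 h).resolve_left (sqrt_two_mul_pos m).ne'

/-- The Hermite functions. -/
def hermFun (n : ℕ) (t : ℝ) : ℝ := (hermPoly n).eval t * Real.exp (-(t ^ 2 / 2))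

theorem hasDerivAt_eval_mul_exp (p : Polynomial ℝ) (t : ℝ) :
    HasDerivAt (fun t : ℝ => p.eval t * Real.exp (-(t ^ 2 / 2)))
      ((Polynomial.derivative p - Polynomial.X * p).eval t * Real.exp (-(t ^ 2 / 2))) t := by
  have h1 : HasDerivAt (fun t : ℝ => Real.exp (-(t ^ 2 / 2)))
      (Real.exp (-(t ^ 2 / 2)) * (-((2 * t) / 2))) t := by
    refine HasDerivAt.exp (HasDerivAt.neg (HasDerivAt.div_const ?_ _))
    simpa using hasDerivAt_pow 2 t
  refine ((p.hasDerivAt t).fun_mul h1).congr_deriv ?_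
  rw [Polynomial.eval_sub, Polynomial.eval_mul, Polynomial.eval_X]
  ring

theorem deriv_hermFun (n : ℕ) : deriv (hermFun n) = fun t =>
    (Polynomial.derivative (hermPoly n) - Polynomial.X * hermPoly n).eval t *
      Real.exp (-(t ^ 2 / 2)) :=
  funext fun t => (hasDerivAt_eval_mul_exp (hermPoly n) t).deriv

theorem differentiable_hermFun (n : ℕ) : Differentiable ℝ (hermFun n) :=
  fun t => (hasDerivAt_eval_mul_exp (hermPoly n) t).differentiableAt

theorem differentiable_deriv_hermFun (n : ℕ) : Differentiable ℝ (deriv (hermFun n)) := by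
  rw [deriv_hermFun]
  exact fun t => (hasDerivAt_eval_mul_exp _ t).differentiableAt

theorem hermFun_ode (n : ℕ) (t : ℝ) :
    -deriv (deriv (hermFun n)) t + t ^ 2 * hermFun n t + hermFun n t =
      (2 * n + 2) * hermFun n t := by
  have e := congrArg (Polynomial.eval t) (hermPoly_ode n)
  rw [deriv_hermFun, (hasDerivAt_eval_mul_exp _ t).deriv, hermFun]
  simp only [Polynomial.eval_mul, Polynomial.eval_C, Polynomial.eval_sub, Polynomial.eval_X,
    Polynomial.eval_ofNat, Polynomial.derivative_mul, Polynomial.derivative_sub,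
    Polynomial.derivative_X, Polynomial.eval_add, Polynomial.eval_one] at e ⊢
  linear_combination (-Real.exp (-(t ^ 2 / 2))) * e

theorem exp_half_sq_mul_self (t : ℝ) :
    Real.exp (-(t ^ 2 / 2)) * Real.exp (-(t ^ 2 / 2)) = Real.exp (-1 * t ^ 2) := by
  rw [← Real.exp_add]
  congr 1
  ring

theorem integrable_eval_mul_hermFun_sq (p : Polynomial ℝ) (m n : ℕ) :
    Integrable fun t => p.eval t * (hermFun m t * hermFun n t) := by
  refine (integrable_eval_mul_gaussian (p * (hermPoly m * hermPoly n)) one_pos).congr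
    (Filter.Eventually.of_forall fun t => ?_)
  simp only [Polynomial.eval_mul, hermFun]
  rw [← exp_half_sq_mul_self]
  ring

theorem integral_hermFun_mul (m n : ℕ) :
    ∫ t, hermFun m t * hermFun n t = if m = n then 1 else 0 := by
  rw [← integral_hermPoly_mul m n]
  refine integral_congr_ae (Filter.Eventually.of_forall fun t => ?_)
  simp only [Polynomial.eval_mul, hermFun]
  rw [← exp_half_sq_mul_self]
  ring

/-- Pairing the oscillator equation -h'' + t²h + h = (2n+2)h with h gives ∫ (1+t²)h² = 2n + 2 - ∫
h'². -/
theorem integral_sq_mul_hermFun_sq_le (n : ℕ) :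
    ∫ t, (1 + t ^ 2) * hermFun n t ^ 2 ≤ 2 * (n : ℝ) + 2 := by
  have hint : ∀ p : Polynomial ℝ, Integrable fun t : ℝ => p.eval t * Real.exp (-1 * t ^ 2) :=
    fun p => integrable_eval_mul_gaussian p one_pos
  set q := Polynomial.derivative (hermPoly n) - Polynomial.X * hermPoly n with hq
  -- The integrand is the derivative of h'h, a polynomial times a Gaussian.
  have h1 : ∫ t, (deriv (deriv (hermFun n)) t * hermFun n t + deriv (hermFun n) t ^ 2) = 0 := by
    have e : ∀ t, deriv (deriv (hermFun n)) t * hermFun n t + deriv (hermFun n) t ^ 2 =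
        ((Polynomial.derivative q - Polynomial.X * q) * hermPoly n + q ^ 2).eval t *
          Real.exp (-1 * t ^ 2) := by
      intro t
      rw [deriv_hermFun, ← hq, (hasDerivAt_eval_mul_exp _ t).deriv, hermFun,
        ← exp_half_sq_mul_self]
      simp only [Polynomial.eval_mul, Polynomial.eval_add, Polynomial.eval_pow]
      ring
    simp only [e]
    refine integral_eq_zero_of_hasDerivAt_of_integrable
      (f := fun t => (q * hermPoly n).eval t * Real.exp (-1 * t ^ 2)) (fun t => ?_)
      (hint _) (hint _)
    have h2 := (hasDerivAt_eval_mul_exp q t).fun_mul (hasDerivAt_eval_mul_exp (hermPoly n) t)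
    rw [← hq] at h2
    have e' : (fun t => (q * hermPoly n).eval t * Real.exp (-1 * t ^ 2)) = fun t =>
        q.eval t * Real.exp (-(t ^ 2 / 2)) * ((hermPoly n).eval t * Real.exp (-(t ^ 2 / 2))) := by
      funext t
      rw [← exp_half_sq_mul_self, Polynomial.eval_mul]
      ring
    rw [e']
    refine h2.congr_deriv ?_
    rw [← exp_half_sq_mul_self]
    simp only [Polynomial.eval_mul, Polynomial.eval_add, Polynomial.eval_pow]
    ring
  have h3 : ∫ t, (1 + t ^ 2) * hermFun n t ^ 2 = (2 * n + 2) - ∫ t, deriv (hermFun n) t ^ 2 := by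
    have hn := integral_hermFun_mul n n
    rw [if_pos rfl] at hn
    have i1 : Integrable fun t => (2 * (n : ℝ) + 2) * (hermFun n t * hermFun n t) := by
      have := integrable_eval_mul_hermFun_sq (Polynomial.C (2 * (n : ℝ) + 2)) n n
      simpa using this
    have i2 : Integrable fun t => deriv (hermFun n) t ^ 2 := by
      refine (hint (q ^ 2)).congr (Filter.Eventually.of_forall fun t => ?_)
      simp only [deriv_hermFun, ← hq, Polynomial.eval_pow]
      rw [← exp_half_sq_mul_self]
      ring
    have i3 : Integrable fun t =>
        deriv (deriv (hermFun n)) t * hermFun n t + deriv (hermFun n) t ^ 2 := by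
      refine (hint ((Polynomial.derivative q - Polynomial.X * q) * hermPoly n + q ^ 2)).congr
        (Filter.Eventually.of_forall fun t => ?_)
      simp only
      rw [deriv_hermFun, ← hq, (hasDerivAt_eval_mul_exp _ t).deriv, hermFun,
        ← exp_half_sq_mul_self]
      simp only [Polynomial.eval_mul, Polynomial.eval_add, Polynomial.eval_pow]
      ring
    have e2 : ∀ t, (1 + t ^ 2) * hermFun n t ^ 2 = (2 * n + 2) * (hermFun n t * hermFun n t) -
        deriv (hermFun n) t ^ 2 + (deriv (deriv (hermFun n)) t * hermFun n t +
          deriv (hermFun n) t ^ 2) := by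
      intro t
      linear_combination (hermFun n t) * hermFun_ode n t
    simp only [e2]
    have e3 := integral_add (i1.sub i2) i3
    simp only [Pi.sub_apply] at e3
    rw [e3, integral_sub i1 i2, h1, integral_const_mul, hn, mul_one,
      add_zero]
  rw [h3]
  have h4 : 0 ≤ ∫ t, deriv (hermFun n) t ^ 2 := integral_nonneg fun t => sq_nonneg _
  linarith

theorem integrable_hermFun (n : ℕ) : Integrable (hermFun n) := by
  refine (integrable_eval_mul_gaussian (hermPoly n) (half_pos one_pos)).congr
    (Filter.Eventually.of_forall fun t => ?_)
  simp only [hermFun]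
  congr 2
  ring

/-- Cauchy-Schwarz with the weight 1 + t², whose reciprocal has integral π. -/
theorem sq_integral_abs_hermFun_le (n : ℕ) :
    (∫ t, |hermFun n t|) ^ 2 ≤ 2 * Real.pi * (n + 1) := by
  have hw : Integrable fun t : ℝ => (1 + t ^ 2) * hermFun n t ^ 2 := by
    refine (integrable_eval_mul_hermFun_sq (1 + Polynomial.X ^ 2) n n).congr
      (Filter.Eventually.of_forall fun t => ?_)
    simp only [Polynomial.eval_add, Polynomial.eval_one, Polynomial.eval_pow, Polynomial.eval_X]
    ring
  -- Cauchy-Schwarz in the form 2s|h| ≤ s²/(1+t²) + (1+t²)h², integrated, with a free parameter s.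
  have key : ∀ s : ℝ, 0 < s →
      2 * s * ∫ t, |hermFun n t| ≤ s ^ 2 * Real.pi + (2 * n + 2) := by
    intro s hs
    have h1 : ∫ t, 2 * s * |hermFun n t| ≤
        ∫ t, (s ^ 2 * (1 + t ^ 2)⁻¹ + (1 + t ^ 2) * hermFun n t ^ 2) := by
      refine integral_mono ((integrable_hermFun n).abs.const_mul _)
        ((integrable_inv_one_add_sq.const_mul _).add hw) fun t => ?_
      have hp : 0 < 1 + t ^ 2 := by positivity
      have h2 := sq_nonneg (s - (1 + t ^ 2) * |hermFun n t|)
      have h3 : s ^ 2 * (1 + t ^ 2)⁻¹ + (1 + t ^ 2) * hermFun n t ^ 2 - 2 * s * |hermFun n t| =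
          (s - (1 + t ^ 2) * |hermFun n t|) ^ 2 * (1 + t ^ 2)⁻¹ := by
        rw [← sq_abs (hermFun n t)]
        field_simp
        ring
      have h4 : 0 ≤ (s - (1 + t ^ 2) * |hermFun n t|) ^ 2 * (1 + t ^ 2)⁻¹ := by positivity
      simp only
      linarith
    rw [integral_const_mul, integral_add (integrable_inv_one_add_sq.const_mul _) hw,
      integral_const_mul, integral_univ_inv_one_add_sq] at h1
    linarith [integral_sq_mul_hermFun_sq_le n]
  set I := ∫ t, |hermFun n t| with hI
  have hI0 : 0 ≤ I := integral_nonneg fun t => abs_nonneg _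
  rcases hI0.eq_or_lt with h | h
  · have := Real.pi_pos
    rw [← h, zero_pow two_ne_zero]
    positivity
  -- The value s = I/π maximises 2sI - s²π.
  · have h1 := key (I / Real.pi) (by have := Real.pi_pos; positivity)
    have hp := Real.pi_pos
    have h2 : 2 * (I / Real.pi) * I - (I / Real.pi) ^ 2 * Real.pi = I ^ 2 / Real.pi := by
      field_simp
      ring
    have h3 : I ^ 2 / Real.pi ≤ 2 * n + 2 := by linarith
    rw [div_le_iff₀ hp] at h3
    linarith

end FreeFermions

end

noncomputable section

namespace FreeFermions

/-! ### Hermite functions of several variables -/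

/-- The Gaussian `e^{-t²/2}` of one variable as a Schwartz function. -/
def gaussianOne : 𝓢(ℝ, ℝ) where
  toFun t := Real.exp (-(t ^ 2 / 2))
  smooth' := by fun_prop
  decay' k n := by
    obtain ⟨C, hC, h⟩ := exists_abs_eval_le
      (Polynomial.X ^ k * (Polynomial.hermite n).map (algebraMap ℤ ℝ)) (half_pos one_pos)
    refine ⟨C, fun t => ?_⟩
    -- Every derivative is a polynomial times the Gaussian, so the bound of a polynomial by e^{t²/2}
    -- controls each Schwartz seminorm.
    have e : iteratedDeriv n (fun t : ℝ => Real.exp (-(t ^ 2 / 2))) t =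
        (-1 : ℝ) ^ n * Polynomial.aeval t (Polynomial.hermite n) * Real.exp (-(t ^ 2 / 2)) := by
      rw [iteratedDeriv_eq_iterate, Polynomial.deriv_gaussian_eq_hermite_mul_gaussian]
    have h1 := h t
    rw [Polynomial.eval_mul, Polynomial.eval_pow, Polynomial.eval_X, Polynomial.eval_map_algebraMap,
      abs_mul, abs_pow] at h1
    rw [norm_iteratedFDeriv_eq_norm_iteratedDeriv, e, norm_mul, norm_mul, norm_pow, norm_neg,
      norm_one, one_pow, one_mul, ← mul_assoc, Real.norm_eq_abs, Real.norm_eq_abs,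
      Real.norm_eq_abs, Real.abs_exp]
    calc _ ≤ C * Real.exp (1 / 2 * t ^ 2) * Real.exp (-(t ^ 2 / 2)) := by gcongr
      _ = C := by
        rw [mul_assoc, ← Real.exp_add]
        have e0 : 1 / 2 * t ^ 2 + -(t ^ 2 / 2) = 0 := by ring
        rw [e0, Real.exp_zero, mul_one]

variable {ι : Type} [Fintype ι]

/-- The Gaussian `e^{-|x|²/2}` as a Schwartz function. -/
def gaussian (ι : Type) [Fintype ι] : 𝓢(EuclideanSpace ℝ ι, ℂ) :=
  -- The one-variable Gaussian is composed with √(1+|x|²), which unlike |x| is smooth at 0; the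
  -- factor e^{1/2} removes the 1.
  ((Real.exp (1 / 2) : ℝ) : ℂ) • SchwartzMap.postcompCLM Complex.ofRealCLM
    (SchwartzMap.compCLM ℝ (F := ℝ)
      (Function.hasTemperateGrowth_one_add_norm_sq_rpow (EuclideanSpace ℝ ι) (1 / 2))
      ⟨1, 1, fun x => by
        rw [pow_one, one_mul, ← Real.sqrt_eq_rpow]
        have h : ‖x‖ ≤ Real.sqrt (1 + ‖x‖ ^ 2) := Real.le_sqrt_of_sq_le (by linarith)
        exact h.trans ((le_abs_self _).trans (by rw [Real.norm_eq_abs]; linarith))⟩ gaussianOne)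

theorem gaussian_apply (x : EuclideanSpace ℝ ι) :
    gaussian ι x = ((Real.exp (-(‖x‖ ^ 2 / 2)) : ℝ) : ℂ) := by
  change ((Real.exp (1 / 2) : ℝ) : ℂ) *
    ((Real.exp (-(((1 + ‖x‖ ^ 2) ^ (1 / 2 : ℝ)) ^ 2 / 2)) : ℝ) : ℂ) = _
  rw [← Real.sqrt_eq_rpow, Real.sq_sqrt (by positivity), ← Complex.ofReal_mul, ← Real.exp_add]
  congr 2
  ring

theorem hasTemperateGrowth_prod_eval (p : ι → Polynomial ℝ) (y : EuclideanSpace ℝ ι) :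
    (fun x : EuclideanSpace ℝ ι =>
      ∏ j, (((p j).eval (x j - y j) : ℝ) : ℂ)).HasTemperateGrowth := by
  have h1 : ∀ j, (fun x : EuclideanSpace ℝ ι =>
      (((p j).eval (x j - y j) : ℝ) : ℂ)).HasTemperateGrowth := by
    intro j
    have h2 : (fun x : EuclideanSpace ℝ ι => x j - y j).HasTemperateGrowth :=
      (EuclideanSpace.proj (𝕜 := ℝ) j : EuclideanSpace ℝ ι →L[ℝ] ℝ).hasTemperateGrowth.sub
        (Function.HasTemperateGrowth.const _)
    have h3 : ∀ q : Polynomial ℝ,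
        (fun x : EuclideanSpace ℝ ι => q.eval (x j - y j)).HasTemperateGrowth := by
      intro q
      simp only [Polynomial.eval_eq_sum_range]
      refine Function.HasTemperateGrowth.sum fun i _ => ?_
      exact (Function.HasTemperateGrowth.const _).mul (h2.pow i)
    have := h3 (p j)
    fun_prop
  have h4 : ∀ s : Finset ι, (fun x : EuclideanSpace ℝ ι =>
      ∏ j ∈ s, (((p j).eval (x j - y j) : ℝ) : ℂ)).HasTemperateGrowth := by
    classical
    intro s
    induction s using Finset.induction_on with
    | empty =>
      simp only [Finset.prod_empty]
      exact Function.HasTemperateGrowth.const _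
    | insert j s hj ih =>
      simp only [Finset.prod_insert hj]
      exact (h1 j).mul ih
  exact h4 _

/-- The Hermite functions centred at `y`. -/
def herm (y : EuclideanSpace ℝ ι) (n : ι → ℕ) : 𝓢(EuclideanSpace ℝ ι, ℂ) :=
  SchwartzMap.smulLeftCLM ℂ (fun x : EuclideanSpace ℝ ι =>
    ∏ j, (((hermPoly (n j)).eval (x j - y j) : ℝ) : ℂ))
    (SchwartzMap.compSubConstCLM ℂ y (gaussian ι))

theorem exp_norm_sq (x : EuclideanSpace ℝ ι) (c : ℝ) :
    Real.exp (c * ‖x‖ ^ 2) = ∏ j, Real.exp (c * x j ^ 2) := by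
  rw [← Real.exp_sum, EuclideanSpace.norm_sq_eq, Finset.mul_sum]
  simp only [Real.norm_eq_abs, sq_abs]

theorem herm_apply (y : EuclideanSpace ℝ ι) (n : ι → ℕ) (x : EuclideanSpace ℝ ι) :
    herm y n x = ∏ j, ((hermFun (n j) (x j - y j) : ℝ) : ℂ) := by
  rw [herm, SchwartzMap.smulLeftCLM_apply_apply (hasTemperateGrowth_prod_eval _ y),
    SchwartzMap.compSubConstCLM_apply, gaussian_apply]
  have h := exp_norm_sq (x - y) (-(1 / 2))
  have e : -(‖x - y‖ ^ 2 / 2) = -(1 / 2) * ‖x - y‖ ^ 2 := by ring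
  rw [e, h, Complex.ofReal_prod, smul_eq_mul, ← Finset.prod_mul_distrib]
  refine Finset.prod_congr rfl fun j _ => ?_
  rw [← Complex.ofReal_mul, hermFun]
  congr 3
  rw [PiLp.sub_apply]
  ring

theorem conj_herm (y : EuclideanSpace ℝ ι) (n : ι → ℕ) (x : EuclideanSpace ℝ ι) :
    starRingEnd ℂ (herm y n x) = herm y n x := by
  rw [herm_apply, map_prod]
  simp only [Complex.conj_ofReal]

/-- Derivatives of products of functions of one variable. -/
theorem lineDeriv_prod [DecidableEq ι] (F : ι → ℝ → ℝ) (y x : EuclideanSpace ℝ ι) (j : ι)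
    (hF : Differentiable ℝ (F j)) :
    lineDeriv ℝ (fun x : EuclideanSpace ℝ ι => ∏ i, ((F i (x i - y i) : ℝ) : ℂ)) x
        (EuclideanSpace.single j 1) =
      ∏ i, ((Function.update F j (deriv (F j)) i (x i - y i) : ℝ) : ℂ) := by
  have e : ∀ t : ℝ, ∏ i, ((F i ((x + t • EuclideanSpace.single j (1 : ℝ)) i - y i) : ℝ) : ℂ) =
      (∏ i ∈ Finset.univ.erase j, ((F i (x i - y i) : ℝ) : ℂ)) * ((F j (x j - y j + t) : ℝ) : ℂ) := by
    intro t
    rw [← Finset.mul_prod_erase Finset.univ _ (Finset.mem_univ j), mul_comm]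
    congr 1
    · refine Finset.prod_congr rfl fun i hi => ?_
      simp [Finset.ne_of_mem_erase hi]
    · simp
      congr 2
      ring
  rw [lineDeriv]
  simp only [e]
  have h1 : HasDerivAt (fun t => ((F j (x j - y j + t) : ℝ) : ℂ))
      ((deriv (F j) (x j - y j) : ℝ) : ℂ) 0 := by
    have h2 : HasDerivAt (F j) (deriv (F j) (x j - y j)) (x j - y j + 0) := by
      rw [add_zero]
      exact (hF _).hasDerivAt
    exact (HasDerivAt.comp_const_add (x j - y j) 0 h2).ofReal_comp
  rw [(h1.const_mul _).deriv, ← Finset.mul_prod_erase Finset.univ _ (Finset.mem_univ j),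
    Function.update_self, mul_comm]
  congr 1
  refine Finset.prod_congr rfl fun i hi => ?_
  rw [Function.update_of_ne (Finset.ne_of_mem_erase hi)]

/-- Only the factor of the j-th variable is affected, and it solves the one-variable oscillator
equation. -/
theorem harmOp_herm [DecidableEq ι] (y : EuclideanSpace ℝ ι) (n : ι → ℕ) (j : ι) :
    harmOp y j (herm y n) = ((2 * n j + 2 : ℕ) : ℂ) • herm y n := by
  ext x
  have e0 : (herm y n : EuclideanSpace ℝ ι → ℂ) =
      fun x => ∏ i, (((fun i => hermFun (n i)) i (x i - y i) : ℝ) : ℂ) :=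
    funext fun x => herm_apply y n x
  have e1 : (fun z => lineDeriv ℝ (herm y n) z (EuclideanSpace.single j 1)) = fun z =>
      ∏ i, ((Function.update (fun i => hermFun (n i)) j (deriv (hermFun (n j))) i (z i - y i) : ℝ) :
        ℂ) := by
    funext z
    rw [e0, lineDeriv_prod (fun i => hermFun (n i)) y z j (differentiable_hermFun (n j))]
  have e3 := lineDeriv_prod (Function.update (fun i => hermFun (n i)) j (deriv (hermFun (n j)))) y x
    j (by
      rw [Function.update_self]
      exact differentiable_deriv_hermFun (n j))
  rw [harmOp_apply, e1, e3]
  rw [smul_apply, herm_apply, smul_eq_mul, Function.update_self,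
    Function.update_idem, ← Finset.mul_prod_erase Finset.univ _ (Finset.mem_univ j),
    Function.update_self, ← Finset.mul_prod_erase Finset.univ (fun i =>
      ((hermFun (n i) (x i - y i) : ℝ) : ℂ)) (Finset.mem_univ j)]
  have e2 : ∏ i ∈ Finset.univ.erase j, ((Function.update (fun i => hermFun (n i)) j
      (deriv (deriv (hermFun (n j)))) i (x i - y i) : ℝ) : ℂ) =
      ∏ i ∈ Finset.univ.erase j, ((hermFun (n i) (x i - y i) : ℝ) : ℂ) := by
    refine Finset.prod_congr rfl fun i hi => ?_
    rw [Function.update_of_ne (Finset.ne_of_mem_erase hi)]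
  rw [e2]
  have h := congrArg (fun r : ℝ => (r : ℂ)) (hermFun_ode (n j) (x j - y j))
  push_cast at h ⊢
  linear_combination
    (∏ i ∈ Finset.univ.erase j, ((hermFun (n i) (x i - y i) : ℝ) : ℂ)) * h

/-- The eigenvalue of `∏_j (-∂_j² + (x_j - y_j)² + 1)³`. -/
def hermEigen (n : ι → ℕ) : ℕ := ∏ j, (2 * n j + 2) ^ 3

theorem harmProd_herm [DecidableEq ι] (y : EuclideanSpace ℝ ι) (n : ι → ℕ) :
    harmProd y (herm y n) = (hermEigen n : ℂ) • herm y n := by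
  have hp : ∀ (j : ι) (c : ℂ) (m : ℕ), (harmOp y j ^ m) (c • herm y n) =
      (c * ((2 * n j + 2 : ℕ) : ℂ) ^ m) • herm y n := by
    intro j c m
    induction m with
    | zero => simp
    | succ m ih =>
      rw [pow_succ', mul_apply_eq_comp, ih, map_smul, harmOp_herm, smul_smul]
      congr 1
      ring
  have h : ∀ l : List ι, (l.map fun j => harmOp y j ^ 3).prod (herm y n) =
      (((l.map fun j => (2 * n j + 2) ^ 3).prod : ℕ) : ℂ) • herm y n := by
    intro l
    induction l with
    | nil => simp
    | cons j l ih =>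
      rw [List.map_cons, List.prod_cons, mul_apply_eq_comp, ih, hp, List.map_cons,
        List.prod_cons]
      congr 1
      push_cast
      ring
  rw [harmProd, h, hermEigen]
  congr 2
  exact Finset.prod_map_toList _ _

theorem integral_prod_euclidean (F : ι → ℝ → ℂ) (y : EuclideanSpace ℝ ι) :
    ∫ x : EuclideanSpace ℝ ι, ∏ j, F j (x j - y j) = ∏ j, ∫ t, F j t := by
  have h := (EuclideanSpace.volume_preserving_symm_measurableEquiv_toLp ι).integral_comp'
    (fun x : ι → ℝ => ∏ j, F j (x j - y j))
  refine h.trans ?_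
  rw [integral_fintype_prod_volume_eq_prod (fun j t => F j (t - y j))]
  exact Finset.prod_congr rfl fun j _ => integral_sub_right_eq_self _ _

theorem integral_herm_mul_herm (y : EuclideanSpace ℝ ι) (m n : ι → ℕ) :
    ∫ x, starRingEnd ℂ (herm y m x) * herm y n x = if m = n then 1 else 0 := by
  simp only [conj_herm]
  simp only [herm_apply, ← Finset.prod_mul_distrib, ← Complex.ofReal_mul]
  rw [integral_prod_euclidean fun j t => ((hermFun (m j) t * hermFun (n j) t : ℝ) : ℂ)]
  simp only [integral_complex_ofReal, integral_hermFun_mul]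
  by_cases h : m = n
  · simp [h]
  · obtain ⟨j, hj⟩ := Function.ne_iff.1 h
    rw [if_neg h]
    exact Finset.prod_eq_zero (Finset.mem_univ j) (by simp [hj])

theorem integral_norm_herm (y : EuclideanSpace ℝ ι) (n : ι → ℕ) :
    ∫ x, ‖herm y n x‖ = ∏ j, ∫ t, |hermFun (n j) t| := by
  have h1 : ∀ x, ‖herm y n x‖ = (∏ j, ((|hermFun (n j) (x j - y j)| : ℝ) : ℂ)).re := by
    intro x
    rw [herm_apply, ← Complex.ofReal_prod, ← Complex.ofReal_prod, Complex.ofReal_re,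
      Complex.norm_real, Real.norm_eq_abs, Finset.abs_prod]
  have h2 := integral_prod_euclidean (fun j t => ((|hermFun (n j) t| : ℝ) : ℂ)) y
  have h3 : ∀ x : EuclideanSpace ℝ ι, (∏ j, ((|hermFun (n j) (x j - y j)| : ℝ) : ℂ)) =
      ((‖herm y n x‖ : ℝ) : ℂ) := by
    intro x
    rw [h1, ← Complex.ofReal_prod, Complex.ofReal_re]
  simp only [h3, integral_complex_ofReal] at h2
  rw [← Complex.ofReal_prod] at h2
  exact_mod_cast h2

theorem sq_integral_norm_herm_le (y : EuclideanSpace ℝ ι) (n : ι → ℕ) :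
    (∫ x, ‖herm y n x‖) ^ 2 ≤ (2 * Real.pi) ^ Fintype.card ι * ∏ j, ((n j : ℝ) + 1) := by
  rw [integral_norm_herm, ← Finset.prod_pow, ← Finset.card_univ, ← Finset.prod_const,
    ← Finset.prod_mul_distrib]
  exact Finset.prod_le_prod (fun j _ => sq_nonneg _) fun j _ => sq_integral_abs_hermFun_le (n j)

/-- The Hermite functions in `L²`. -/
def hermLp (y : EuclideanSpace ℝ ι) (n : ι → ℕ) :
    Lp ℂ 2 (volume : Measure (EuclideanSpace ℝ ι)) := (herm y n).toLp 2 volume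

theorem hermLp_ae (y : EuclideanSpace ℝ ι) (n : ι → ℕ) : hermLp y n =ᵐ[volume] herm y n :=
  (herm y n).coeFn_toLp 2 volume

theorem orthonormal_hermLp (y : EuclideanSpace ℝ ι) : Orthonormal ℂ (hermLp y) := by
  classical
  rw [orthonormal_iff_ite]
  intro m n
  rw [← integral_herm_mul_herm y m n, L2.inner_def]
  refine integral_congr_ae ?_
  filter_upwards [hermLp_ae y m, hermLp_ae y n] with x h1 h2
  rw [h1, h2, RCLike.inner_apply, mul_comm]

end FreeFermions

end

noncomputable section

namespace FreeFermions

/-! ### Totality of the Hermite functions -/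

/-- Continuous functions with Gaussian decay. -/
def GaussDecay (φ : ℝ → ℂ) : Prop :=
  Continuous φ ∧ ∃ C : ℝ, 0 ≤ C ∧ ∀ t, ‖φ t‖ ≤ C * Real.exp (-(1 / 4) * t ^ 2)

theorem gaussDecay_eval (p : Polynomial ℝ) :
    GaussDecay fun t => ((p.eval t * Real.exp (-(t ^ 2 / 2)) : ℝ) : ℂ) := by
  refine ⟨by fun_prop, ?_⟩
  obtain ⟨C, hC, h⟩ := exists_abs_eval_le p (show (0 : ℝ) < 1 / 4 by norm_num)
  refine ⟨C, hC, fun t => ?_⟩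
  rw [Complex.norm_real, Real.norm_eq_abs, abs_mul, Real.abs_exp]
  calc _ ≤ C * Real.exp (1 / 4 * t ^ 2) * Real.exp (-(t ^ 2 / 2)) := by
        gcongr
        exact h t
    _ = _ := by
        rw [mul_assoc, ← Real.exp_add]
        congr 2
        ring

theorem gaussDecay_exp (c : ℝ) :
    GaussDecay fun t => ((Real.exp (|c * t|) * Real.exp (-(t ^ 2 / 2)) : ℝ) : ℂ) := by
  refine ⟨by fun_prop, Real.exp (c ^ 2), (Real.exp_pos _).le, fun t => ?_⟩
  rw [Complex.norm_real, Real.norm_eq_abs, ← Real.exp_add, Real.abs_exp, ← Real.exp_add,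
    Real.exp_le_exp, abs_mul]
  nlinarith [sq_nonneg (|c| - |t| / 2), sq_abs c, sq_abs t]

theorem gaussDecay_cexp (c : ℝ) :
    GaussDecay fun t => Complex.exp (((c * t : ℝ) : ℂ) * Complex.I) *
      ((Real.exp (-(t ^ 2 / 2)) : ℝ) : ℂ) := by
  refine ⟨by fun_prop, 1, zero_le_one, fun t => ?_⟩
  rw [norm_mul, Complex.norm_exp_ofReal_mul_I, one_mul, one_mul, Complex.norm_real,
    Real.norm_eq_abs, Real.abs_exp, Real.exp_le_exp]
  nlinarith [sq_nonneg t]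

variable {ι : Type} [Fintype ι]

theorem integrable_exp_sub (y : EuclideanSpace ℝ ι) :
    Integrable fun x : EuclideanSpace ℝ ι => Real.exp (-(‖x - y‖ ^ 2 / 2)) := by
  have h : Integrable (SchwartzMap.compSubConstCLM ℂ y (gaussian ι)) := SchwartzMap.integrable _
  refine h.norm.congr (Filter.Eventually.of_forall fun x => ?_)
  simp only [SchwartzMap.compSubConstCLM_apply, gaussian_apply, Complex.norm_real,
    Real.norm_eq_abs, Real.abs_exp]

theorem memLp_prod_gaussDecay {F : ι → ℝ → ℂ} (hF : ∀ j, GaussDecay (F j))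
    (y : EuclideanSpace ℝ ι) :
    MemLp (fun x : EuclideanSpace ℝ ι => ∏ j, F j (x j - y j)) 2 volume := by
  choose hc C hC hb using hF
  have hcont : Continuous fun x : EuclideanSpace ℝ ι => ∏ j, F j (x j - y j) :=
    continuous_finsetProd _ fun j _ => (hc j).comp (by fun_prop)
  have hg : MemLp (fun x : EuclideanSpace ℝ ι => (∏ j, C j) * Real.exp (-(1 / 4) * ‖x - y‖ ^ 2))
      2 volume := by
    refine MemLp.const_mul ?_ _
    rw [memLp_two_iff_integrable_sq_norm (by fun_prop)]
    refine (integrable_exp_sub y).congr (Filter.Eventually.of_forall fun x => ?_)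
    simp only [Real.norm_eq_abs, Real.abs_exp]
    rw [← Real.exp_nat_mul]
    congr 1
    push_cast
    ring
  refine hg.mono hcont.aestronglyMeasurable (Filter.Eventually.of_forall fun x => ?_)
  rw [norm_prod, exp_norm_sq, ← Finset.prod_mul_distrib, Real.norm_eq_abs]
  exact (Finset.prod_le_prod (fun j _ => norm_nonneg _) fun j _ => hb j _).trans (le_abs_self _)

theorem integrable_prod_gaussDecay {F : ι → ℝ → ℂ} (hF : ∀ j, GaussDecay (F j))
    (y : EuclideanSpace ℝ ι) (f : Lp ℂ 2 (volume : Measure (EuclideanSpace ℝ ι))) :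
    Integrable fun x : EuclideanSpace ℝ ι => (∏ j, F j (x j - y j)) * f x :=
  (memLp_prod_gaussDecay hF y).integrable_mul (Lp.memLp f)

section Decidable

variable [DecidableEq ι]

theorem prod_update_mul {F : ι → ℝ → ℂ} (j : ι) (φ : ℝ → ℂ) (y x : EuclideanSpace ℝ ι) (c : ℂ) :
    (∏ i, Function.update F j φ i (x i - y i)) * c =
      φ (x j - y j) * ((∏ i ∈ Finset.univ.erase j, F i (x i - y i)) * c) := by
  rw [← Finset.mul_prod_erase Finset.univ _ (Finset.mem_univ j), Function.update_self, mul_assoc]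
  congr 2
  refine Finset.prod_congr rfl fun i hi => ?_
  rw [Function.update_of_ne (Finset.ne_of_mem_erase hi)]

theorem integrable_update {F : ι → ℝ → ℂ} (hF : ∀ j, GaussDecay (F j)) (j : ι) {φ : ℝ → ℂ}
    (hφ : GaussDecay φ) (y : EuclideanSpace ℝ ι)
    (f : Lp ℂ 2 (volume : Measure (EuclideanSpace ℝ ι))) :
    Integrable fun x : EuclideanSpace ℝ ι =>
      φ (x j - y j) * ((∏ i ∈ Finset.univ.erase j, F i (x i - y i)) * f x) := by
  have h : ∀ i, GaussDecay (Function.update F j φ i) := by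
    intro i
    by_cases hi : i = j
    · subst hi
      rwa [Function.update_self]
    · rw [Function.update_of_ne hi]
      exact hF i
  refine (integrable_prod_gaussDecay h y f).congr (Filter.Eventually.of_forall fun x => ?_)
  exact prod_update_mul j φ y x (f x)

/-- If a function is orthogonal to the Hermite functions in one variable, then it is orthogonal to
the exponentials (times a Gaussian) in this variable. -/
theorem integral_cexp_eq_zero {F : ι → ℝ → ℂ} (hF : ∀ j, GaussDecay (F j)) (j : ι)
    (y : EuclideanSpace ℝ ι) (f : Lp ℂ 2 (volume : Measure (EuclideanSpace ℝ ι)))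
    (h : ∀ n : ℕ, ∫ x : EuclideanSpace ℝ ι, ((hermFun n (x j - y j) : ℝ) : ℂ) *
      ((∏ i ∈ Finset.univ.erase j, F i (x i - y i)) * f x) = 0) (c : ℝ) :
    ∫ x : EuclideanSpace ℝ ι, (Complex.exp (((c * (x j - y j) : ℝ) : ℂ) * Complex.I) *
      ((Real.exp (-((x j - y j) ^ 2 / 2)) : ℝ) : ℂ)) *
      ((∏ i ∈ Finset.univ.erase j, F i (x i - y i)) * f x) = 0 := by
  set R : EuclideanSpace ℝ ι → ℂ := fun x => (∏ i ∈ Finset.univ.erase j, F i (x i - y i)) * f x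
    with hR
  have hint : ∀ p : Polynomial ℝ, Integrable fun x : EuclideanSpace ℝ ι =>
      ((p.eval (x j - y j) * Real.exp (-((x j - y j) ^ 2 / 2)) : ℝ) : ℂ) * R x :=
    fun p => integrable_update hF j (gaussDecay_eval p) y f
  -- The polynomials whose product with the Gaussian is orthogonal to R form a subspace. It contains
  -- the Hermite polynomials, hence everything.
  let S : Submodule ℝ (Polynomial ℝ) :=
    { carrier := {p | ∫ x : EuclideanSpace ℝ ι,
        ((p.eval (x j - y j) * Real.exp (-((x j - y j) ^ 2 / 2)) : ℝ) : ℂ) * R x = 0}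
      add_mem' := by
        intro p q hp hq
        have e : ∀ x : EuclideanSpace ℝ ι,
            (((p + q).eval (x j - y j) * Real.exp (-((x j - y j) ^ 2 / 2)) : ℝ) : ℂ) * R x =
            ((p.eval (x j - y j) * Real.exp (-((x j - y j) ^ 2 / 2)) : ℝ) : ℂ) * R x +
            ((q.eval (x j - y j) * Real.exp (-((x j - y j) ^ 2 / 2)) : ℝ) : ℂ) * R x := by
          intro x
          rw [Polynomial.eval_add]
          push_cast
          ring
        simp only [Set.mem_ofPred_eq, e] at hp hq ⊢
        rw [integral_add (hint p) (hint q), hp, hq, add_zero]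
      zero_mem' := by simp
      smul_mem' := by
        intro a p hp
        have e : ∀ x : EuclideanSpace ℝ ι,
            (((a • p).eval (x j - y j) * Real.exp (-((x j - y j) ^ 2 / 2)) : ℝ) : ℂ) * R x =
            (a : ℂ) * (((p.eval (x j - y j) * Real.exp (-((x j - y j) ^ 2 / 2)) : ℝ) : ℂ) *
              R x) := by
          intro x
          rw [Polynomial.eval_smul]
          simp only [smul_eq_mul]
          push_cast
          ring
        simp only [Set.mem_ofPred_eq, e] at hp ⊢
        rw [integral_const_mul, hp, mul_zero] }
  have hS : ∀ p : Polynomial ℝ, ∫ x : EuclideanSpace ℝ ι,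
      ((p.eval (x j - y j) * Real.exp (-((x j - y j) ^ 2 / 2)) : ℝ) : ℂ) * R x = 0 :=
    fun p => mem_of_hermPoly_mem S h p
  -- The terms of the exponential series. Their partial sums are polynomials times the Gaussian, so
  -- they integrate to 0 against R, and they are dominated by e^{|ct|} e^{-t²/2}|R|.
  let T : ℕ → EuclideanSpace ℝ ι → ℂ := fun m x =>
    (((c * (x j - y j) : ℝ) : ℂ) * Complex.I) ^ m / (m.factorial : ℂ) *
      ((Real.exp (-((x j - y j) ^ 2 / 2)) : ℝ) : ℂ) * R x
  have eT : ∀ m x, T m x = (Complex.I ^ m / (m.factorial : ℂ)) *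
      ((((Polynomial.C c * Polynomial.X) ^ m).eval (x j - y j) *
        Real.exp (-((x j - y j) ^ 2 / 2)) : ℝ) * R x) := by
    intro m x
    simp only [T, Polynomial.eval_pow, Polynomial.eval_mul, Polynomial.eval_C, Polynomial.eval_X]
    rw [mul_pow, Complex.ofReal_mul (_ ^ m), Complex.ofReal_pow]
    ring
  have iT : ∀ m, Integrable (T m) := fun m => by
    rw [funext (eT m)]
    exact (hint _).const_mul _
  have zT : ∀ N : ℕ, ∫ x, ∑ m ∈ Finset.range N, T m x = 0 := by
    intro N
    rw [integral_finsetSum _ fun m _ => iT m]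
    refine Finset.sum_eq_zero fun m _ => ?_
    rw [funext (eT m), integral_const_mul, hS, mul_zero]
  have hlim : Filter.Tendsto (fun N : ℕ => ∫ x, ∑ m ∈ Finset.range N, T m x) Filter.atTop
      (nhds (∫ x : EuclideanSpace ℝ ι, (Complex.exp (((c * (x j - y j) : ℝ) : ℂ) * Complex.I) *
        ((Real.exp (-((x j - y j) ^ 2 / 2)) : ℝ) : ℂ)) * R x)) := by
    refine tendsto_integral_of_dominated_convergence
      (fun x => ‖((Real.exp (|c * (x j - y j)|) * Real.exp (-((x j - y j) ^ 2 / 2)) : ℝ) : ℂ) *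
        R x‖)
      (fun N => (integrable_finsetSum _ fun m _ => iT m).aestronglyMeasurable)
      (integrable_update hF j (gaussDecay_exp c) y f).norm
      (fun N => Filter.Eventually.of_forall fun x => ?_)
      (Filter.Eventually.of_forall fun x => ?_)
    · simp only [T]
      rw [← Finset.sum_mul, ← Finset.sum_mul, norm_mul _ (R x), norm_mul _ (R x),
        Complex.ofReal_mul (Real.exp _), norm_mul]
      gcongr
      rw [norm_mul]
      gcongr
      rw [Complex.norm_real (Real.exp |_|), Real.norm_eq_abs, Real.abs_exp]
      refine (norm_sum_le _ _).trans (le_trans (le_of_eq ?_)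
        (Real.sum_le_exp_of_nonneg (abs_nonneg (c * (x j - y j))) N))
      refine Finset.sum_congr rfl fun m _ => ?_
      rw [norm_div, norm_pow, norm_mul, Complex.norm_I, mul_one, Complex.norm_real,
        Real.norm_eq_abs, Complex.norm_natCast]
    · simp only [T, ← Finset.sum_mul]
      refine Filter.Tendsto.mul_const _ (Filter.Tendsto.mul_const _ ?_)
      rw [Complex.exp_eq_exp_ℂ]
      exact (NormedSpace.expSeries_div_hasSum_exp
        (((c * (x j - y j) : ℝ) : ℂ) * Complex.I)).tendsto_sum_nat
  simp only [zT] at hlim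
  exact (tendsto_nhds_unique hlim tendsto_const_nhds)

/-- Hermite functions are replaced by exponentials one variable at a time; in the proof, s is the
set of variables already treated. -/
theorem integral_cexp_prod_eq_zero (y : EuclideanSpace ℝ ι)
    (f : Lp ℂ 2 (volume : Measure (EuclideanSpace ℝ ι)))
    (h : ∀ n, ⟪hermLp y n, f⟫ = 0) (c : ι → ℝ) :
    ∫ x : EuclideanSpace ℝ ι, (∏ j, (Complex.exp (((c j * (x j - y j) : ℝ) : ℂ) * Complex.I) *
      ((Real.exp (-((x j - y j) ^ 2 / 2)) : ℝ) : ℂ))) * f x = 0 := by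
  let F : Finset ι → (ι → ℕ) → ι → ℝ → ℂ := fun s n j t =>
    if j ∈ s then Complex.exp (((c j * t : ℝ) : ℂ) * Complex.I) *
      ((Real.exp (-(t ^ 2 / 2)) : ℝ) : ℂ) else ((hermFun (n j) t : ℝ) : ℂ)
  have hF : ∀ s n j, GaussDecay (F s n j) := by
    intro s n j
    by_cases hj : j ∈ s
    · simp only [F, hj, if_true]
      exact gaussDecay_cexp (c j)
    · simp only [F, hj, if_false]
      exact gaussDecay_eval (hermPoly (n j))
  have key : ∀ s n, ∫ x : EuclideanSpace ℝ ι, (∏ j, F s n j (x j - y j)) * f x = 0 := by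
    intro s
    induction s using Finset.induction_on with
    | empty =>
      intro n
      rw [← h n, L2.inner_def]
      refine integral_congr_ae ?_
      filter_upwards [hermLp_ae y n] with x hx
      rw [RCLike.inner_apply, hx, conj_herm, herm_apply, mul_comm]
      simp [F]
    | insert j s hj ih =>
      intro n
      have h1 := integral_cexp_eq_zero (hF s n) j y f (fun m => by
        rw [← ih (Function.update n j m)]
        refine integral_congr_ae (Filter.Eventually.of_forall fun x => ?_)
        simp only
        have e : F s (Function.update n j m) = Function.update (F s n) j fun t =>
            ((hermFun m t : ℝ) : ℂ) := by
          funext i t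
          by_cases hi : i = j
          · subst hi
            simp [F, hj]
          · simp [F, hi]
        rw [e, prod_update_mul]) (c j)
      rw [← h1]
      refine integral_congr_ae (Filter.Eventually.of_forall fun x => ?_)
      simp only
      have e : F (insert j s) n = Function.update (F s n) j fun t =>
          Complex.exp (((c j * t : ℝ) : ℂ) * Complex.I) * ((Real.exp (-(t ^ 2 / 2)) : ℝ) : ℂ) := by
        funext i t
        by_cases hi : i = j
        · subst hi
          simp [F]
        · simp [F, hi]
      rw [e, prod_update_mul]
  have := key Finset.univ 0
  simpa [F] using this

end Decidable

/-- The Fourier transform of G f vanishes, where G is the Gaussian centred at y. Fourier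
transformation is injective and G has no zeros. -/
theorem eq_zero_of_inner_hermLp (y : EuclideanSpace ℝ ι)
    (f : Lp ℂ 2 (volume : Measure (EuclideanSpace ℝ ι)))
    (h : ∀ n, ⟪hermLp y n, f⟫ = 0) : f = 0 := by
  classical
  have h0 := gaussDecay_cexp 0
  let G : EuclideanSpace ℝ ι → ℂ := fun x => ∏ j, ((Real.exp (-((x j - y j) ^ 2 / 2)) : ℝ) : ℂ)
  have hGc : Continuous G := by
    simp only [G]
    fun_prop
  have hGi : Integrable fun x => G x * f x := by
    have := integrable_prod_gaussDecay (fun _ : ι => h0) y f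
    simpa [G] using this
  have hG1 : ∀ x, ‖G x‖ ≤ 1 := by
    intro x
    simp only [G]
    rw [norm_prod]
    refine Finset.prod_le_one (fun j _ => norm_nonneg _) fun j _ => ?_
    rw [Complex.norm_real, Real.norm_eq_abs, Real.abs_exp, Real.exp_le_one_iff]
    nlinarith [sq_nonneg (x j - y j)]
  have hG2 : MemLp (fun x => G x * f x) 2 volume :=
    (Lp.memLp f).of_le (hGc.aestronglyMeasurable.mul (Lp.aestronglyMeasurable f))
      (Filter.Eventually.of_forall fun x => by
        rw [norm_mul]
        exact mul_le_of_le_one_left (norm_nonneg _) (hG1 x))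
  have hF : 𝓕 hG2.toLp = 0 := by
    refine fourier_eq_of_integrable (hGi.congr hG2.coeFn_toLp.symm) ?_
    filter_upwards [Lp.coeFn_zero ℂ 2 (volume : Measure (EuclideanSpace ℝ ι))] with w hw
    rw [hw, Real.fourier_congr_ae hG2.coeFn_toLp, Real.fourier_eq, Pi.zero_apply]
    -- With these frequencies the exponentials form the Fourier character at w, up to a constant
    -- phase due to the centre y.
    have h1 := integral_cexp_prod_eq_zero y f h fun j => -(2 * Real.pi * w j)
    have h2 : ∀ x : EuclideanSpace ℝ ι, (Real.fourierChar (-inner ℝ x w) • (G x * f x) : ℂ) =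
        Complex.exp (((-(2 * Real.pi * inner ℝ y w) : ℝ) : ℂ) * Complex.I) *
        ((∏ j, (Complex.exp (((-(2 * Real.pi * w j) * (x j - y j) : ℝ) : ℂ) * Complex.I) *
      ((Real.exp (-((x j - y j) ^ 2 / 2)) : ℝ) : ℂ))) * f x) := by
      intro x
      rw [Circle.smul_def, Real.fourierChar_apply, Finset.prod_mul_distrib, ← Complex.exp_sum,
        smul_eq_mul, ← mul_assoc, ← mul_assoc, ← mul_assoc, ← Complex.exp_add]
      congr 3
      rw [← Finset.sum_mul, ← add_mul, ← Complex.ofReal_sum, ← Complex.ofReal_add]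
      congr 2
      rw [PiLp.inner_apply, PiLp.inner_apply, mul_neg, Finset.mul_sum, Finset.mul_sum,
        ← Finset.sum_neg_distrib, ← Finset.sum_neg_distrib, ← Finset.sum_add_distrib]
      refine Finset.sum_congr rfl fun j _ => ?_
      simp only [RCLike.inner_apply, conj_trivial]
      ring
    simp only [h2]
    rw [integral_const_mul, h1, mul_zero]
  have hz : hG2.toLp = 0 :=
    (Lp.fourierTransformₗᵢ (EuclideanSpace ℝ ι) ℂ).injective (hF.trans (map_zero _).symm)
  apply Lp.ext
  filter_upwards [hG2.coeFn_toLp, Lp.coeFn_zero ℂ 2 (volume : Measure (EuclideanSpace ℝ ι))]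
    with x h1 h2
  rw [hz, h2, Pi.zero_apply] at h1
  rw [h2, Pi.zero_apply]
  refine (mul_eq_zero.1 h1.symm).resolve_left (Finset.prod_ne_zero_iff.2 fun j _ => ?_)
  exact Complex.ofReal_ne_zero.2 (Real.exp_pos _).ne'

/-- The Hermite basis of `L²`. -/
def hermBasis (y : EuclideanSpace ℝ ι) :
    HilbertBasis (ι → ℕ) ℂ (Lp ℂ 2 (volume : Measure (EuclideanSpace ℝ ι))) :=
  HilbertBasis.mkOfOrthogonalEqBot (orthonormal_hermLp y) (by
    rw [Submodule.eq_bot_iff]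
    intro f hf
    exact eq_zero_of_inner_hermLp y f fun n =>
      (Submodule.mem_orthogonal _ f).1 hf _ (Submodule.subset_span ⟨n, rfl⟩))

end FreeFermions

end

noncomputable section

namespace FreeFermions

/-! ### Decay of the Hermite coefficients -/

variable {ι : Type} [Fintype ι]

/-- The weight `∏_j (n_j + 1)^{1/2}`. -/
def hermWeight (n : ι → ℕ) : ℝ := ∏ j, Real.sqrt ((n j : ℝ) + 1)

theorem one_le_hermWeight (n : ι → ℕ) : 1 ≤ hermWeight n := by
  have h : ∏ _j : ι, (1 : ℝ) ≤ hermWeight n := Finset.prod_le_prod (fun _ _ => zero_le_one)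
    fun j _ => Real.one_le_sqrt.2 (by linarith [(n j).cast_nonneg (α := ℝ)])
  simpa using h

theorem hermWeight_pos (n : ι → ℕ) : 0 < hermWeight n := zero_lt_one.trans_le (one_le_hermWeight n)

theorem hermWeight_sq (n : ι → ℕ) : hermWeight n ^ 2 = ∏ j, ((n j : ℝ) + 1) := by
  rw [hermWeight, ← Finset.prod_pow]
  exact Finset.prod_congr rfl fun j _ => Real.sq_sqrt (by positivity)

theorem hermEigen_eq (n : ι → ℕ) :
    (hermEigen n : ℝ) = 8 ^ Fintype.card ι * hermWeight n ^ 6 := by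
  have h : hermWeight n ^ 6 = ∏ j, ((n j : ℝ) + 1) ^ 3 := by
    rw [show 6 = 2 * 3 from rfl, pow_mul, hermWeight_sq, Finset.prod_pow]
  rw [h, hermEigen, ← Finset.card_univ, ← Finset.prod_const, ← Finset.prod_mul_distrib]
  push_cast
  refine Finset.prod_congr rfl fun j _ => ?_
  ring

/-- Comparison with a telescoping sum. -/
theorem sum_inv_sq_le (K : ℕ) : ∑ i ∈ Finset.range K, (((i : ℝ) + 1) ^ 2)⁻¹ ≤ 2 := by
  have h : ∀ K : ℕ, ∑ i ∈ Finset.range (K + 1), (((i : ℝ) + 1) ^ 2)⁻¹ ≤ 2 - ((K : ℝ) + 1)⁻¹ := by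
    intro K
    induction K with
    | zero => norm_num
    | succ K ih =>
      rw [Finset.sum_range_succ]
      have h1 : ((((K + 1 : ℕ) : ℝ) + 1) ^ 2)⁻¹ ≤
          ((K : ℝ) + 1)⁻¹ - (((K + 1 : ℕ) : ℝ) + 1)⁻¹ := by
        push_cast
        rw [inv_sub_inv (by positivity) (by positivity), inv_eq_one_div,
          div_le_div_iff₀ (by positivity) (by positivity)]
        have := K.cast_nonneg (α := ℝ)
        nlinarith
      linarith
  cases K with
  | zero => simp
  | succ K =>
    have : 0 ≤ ((K : ℝ) + 1)⁻¹ := by positivity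
    linarith [h K]

/-- The finite set lies in a cube, where the sum is a product of one-variable sums. -/
theorem sum_inv_hermWeight_le (S : Finset (ι → ℕ)) :
    ∑ n ∈ S, (hermWeight n ^ 4)⁻¹ ≤ 2 ^ Fintype.card ι := by
  classical
  obtain ⟨K, hK⟩ : ∃ K : ℕ, S ⊆ Fintype.piFinset fun _ : ι => Finset.range K := by
    refine ⟨(S.sup fun n => Finset.univ.sup n) + 1, fun n hn => ?_⟩
    rw [Fintype.mem_piFinset]
    intro j
    rw [Finset.mem_range, Nat.lt_succ_iff]
    exact (Finset.le_sup (f := n) (Finset.mem_univ j)).trans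
      (Finset.le_sup (f := fun n : ι → ℕ => Finset.univ.sup n) hn)
  have h1 : ∀ n : ι → ℕ, (hermWeight n ^ 4)⁻¹ = ∏ j, (((n j : ℝ) + 1) ^ 2)⁻¹ := by
    intro n
    rw [show 4 = 2 * 2 from rfl, pow_mul, hermWeight_sq, ← Finset.prod_pow, ← Finset.prod_inv_distrib]
  calc ∑ n ∈ S, (hermWeight n ^ 4)⁻¹
      ≤ ∑ n ∈ Fintype.piFinset fun _ : ι => Finset.range K, (hermWeight n ^ 4)⁻¹ :=
        Finset.sum_le_sum_of_subset_of_nonneg hK fun n _ _ => by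
          have := hermWeight_pos n
          positivity
    _ = ∏ _j : ι, ∑ i ∈ Finset.range K, (((i : ℝ) + 1) ^ 2)⁻¹ := by
        simp only [h1]
        rw [Finset.prod_univ_sum]
    _ ≤ ∏ _j : ι, (2 : ℝ) := Finset.prod_le_prod
        (fun _ _ => Finset.sum_nonneg fun i _ => by positivity) fun _ _ => sum_inv_sq_le K
    _ = _ := by rw [Finset.prod_const, Finset.card_univ]

variable [DecidableEq ι]

/-- The Cauchy-Schwarz inequality Σ |c| w ≤ (Σ |c|² w⁶)^{1/2} (Σ w⁻⁴)^{1/2} in dual form. As the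
Sobolev norm is a supremum over test functions, it is enough to exhibit the optimal one. -/
theorem sum_coeff_le (y : EuclideanSpace ℝ ι)
    (f : Lp ℂ 2 (volume : Measure (EuclideanSpace ℝ ι))) (S : Finset (ι → ℕ)) :
    ENNReal.ofReal (∑ n ∈ S, ‖⟪hermLp y n, f⟫‖ * hermWeight n) ≤
      2 ^ ((Fintype.card ι : ℝ) / 2) * sobolevNorm y f := by
  set M := Fintype.card ι with hM
  let c : (ι → ℕ) → ℂ := fun n => ⟪hermLp y n, f⟫
  -- The power -5 makes |a|² w⁶ equal to w⁻⁴ and a w⁶ equal to w, up to constants. The factor 4^{-M}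
  -- normalises the form, since 4^{-2M} 8^M 2^M = 1. The phase c/|c| is 0 where c vanishes.
  let a : (ι → ℕ) → ℂ := fun n => (((4 : ℝ) ^ M)⁻¹ * (hermWeight n ^ 5)⁻¹ : ℝ) * (c n / ‖c n‖)
  let φ : 𝓢(EuclideanSpace ℝ ι, ℂ) := ∑ n ∈ S, a n • herm y n
  have hBφ : harmProd y φ = ∑ n ∈ S, (a n * hermEigen n) • herm y n := by
    rw [map_sum]
    refine Finset.sum_congr rfl fun n _ => ?_
    rw [map_smul, harmProd_herm, smul_smul]
  have hφL : φ.toLp 2 volume = ∑ n ∈ S, a n • hermLp y n := by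
    change SchwartzMap.toLpCLM ℂ ℂ 2 volume φ = _
    rw [map_sum]
    simp only [map_smul]
    rfl
  have hBL : (harmProd y φ).toLp 2 volume = ∑ n ∈ S, (a n * hermEigen n) • hermLp y n := by
    change SchwartzMap.toLpCLM ℂ ℂ 2 volume (harmProd y φ) = _
    rw [hBφ, map_sum]
    simp only [map_smul]
    rfl
  have hi : ∀ g : Lp ℂ 2 (volume : Measure (EuclideanSpace ℝ ι)), ∀ g' : EuclideanSpace ℝ ι → ℂ,
      g =ᵐ[volume] g' → ∫ x, starRingEnd ℂ (g' x) * harmProd y φ x =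
        ⟪g, (harmProd y φ).toLp 2 volume⟫ := by
    intro g g' e
    rw [L2.inner_def]
    refine integral_congr_ae ?_
    filter_upwards [e, (harmProd y φ).coeFn_toLp 2 volume] with x h1 h2
    rw [h1, h2, RCLike.inner_apply, mul_comm]
  have ha : ∀ n, ‖a n‖ ≤ ((4 : ℝ) ^ M)⁻¹ * (hermWeight n ^ 5)⁻¹ := by
    intro n
    have := hermWeight_pos n
    have h1 : ‖c n / ‖c n‖‖ ≤ 1 := by
      rw [norm_div, Complex.norm_real, norm_norm]
      exact div_self_le_one _
    simp only [a]
    rw [norm_mul, Complex.norm_real, Real.norm_eq_abs, abs_of_nonneg (by positivity)]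
    exact mul_le_of_le_one_right (by positivity) h1
  have h48 : ((4 : ℝ) ^ M)⁻¹ ^ 2 * (8 ^ M * 2 ^ M) = 1 := by
    rw [← mul_pow, ← inv_pow, ← pow_mul, mul_comm M 2, pow_mul, ← mul_pow]
    norm_num
  have hform : (∫ x, starRingEnd ℂ (φ x) * harmProd y φ x).re ≤ 1 := by
    rw [hi _ φ (φ.coeFn_toLp 2 volume), hφL, hBL, (orthonormal_hermLp y).inner_sum, Complex.re_sum]
    calc _ ≤ ∑ n ∈ S, ((4 : ℝ) ^ M)⁻¹ ^ 2 * 8 ^ M * (hermWeight n ^ 4)⁻¹ := by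
          refine Finset.sum_le_sum fun n _ => ?_
          have hw := hermWeight_pos n
          have e : starRingEnd ℂ (a n) * (a n * hermEigen n) =
              ((‖a n‖ ^ 2 * (hermEigen n : ℝ) : ℝ) : ℂ) := by
            rw [← mul_assoc, Complex.conj_mul']
            push_cast
            rfl
          rw [e, Complex.ofReal_re, hermEigen_eq]
          calc _ ≤ (((4 : ℝ) ^ M)⁻¹ * (hermWeight n ^ 5)⁻¹) ^ 2 * (8 ^ M * hermWeight n ^ 6) := by
                gcongr
                exact ha n
            _ = _ := by
                field_simp
      _ = ((4 : ℝ) ^ M)⁻¹ ^ 2 * 8 ^ M * ∑ n ∈ S, (hermWeight n ^ 4)⁻¹ := by rw [Finset.mul_sum]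
      _ ≤ ((4 : ℝ) ^ M)⁻¹ ^ 2 * 8 ^ M * 2 ^ M := by
          gcongr
          exact sum_inv_hermWeight_le S
      _ = 1 := by rw [mul_assoc, h48]
  have hval : ∫ x, starRingEnd ℂ (f x) * harmProd y φ x =
      ((2 ^ M * ∑ n ∈ S, ‖c n‖ * hermWeight n : ℝ) : ℂ) := by
    rw [hi f f (ae_eq_refl _), hBL, inner_sum, Finset.mul_sum, Complex.ofReal_sum]
    refine Finset.sum_congr rfl fun n _ => ?_
    have hw := hermWeight_pos n
    have e1 : ⟪f, hermLp y n⟫ = starRingEnd ℂ (c n) := (inner_conj_symm _ _).symm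
    have e2 : c n / ‖c n‖ * starRingEnd ℂ (c n) = ‖c n‖ := by
      rw [div_mul_eq_mul_div, Complex.mul_conj']
      rcases eq_or_ne (‖c n‖ : ℂ) 0 with h | h
      · rw [h]
        simp
      · field_simp
    have e3 : ((4 : ℝ) ^ M)⁻¹ * 8 ^ M = 2 ^ M := by
      rw [← inv_pow, ← mul_pow]
      norm_num
    have e4 : (hermWeight n ^ 5)⁻¹ * hermWeight n ^ 6 = hermWeight n := by
      field_simp
    have e5 : (hermEigen n : ℂ) = ((8 ^ M * hermWeight n ^ 6 : ℝ) : ℂ) := by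
      rw [← hermEigen_eq]
      push_cast
      rfl
    rw [inner_smul_right, e1, e5]
    calc _ = (((4 : ℝ) ^ M)⁻¹ * (hermWeight n ^ 5)⁻¹ * (8 ^ M * hermWeight n ^ 6) : ℝ) *
          (c n / ‖c n‖ * starRingEnd ℂ (c n)) := by
          simp only [a]
          push_cast
          ring
      _ = (((4 : ℝ) ^ M)⁻¹ * 8 ^ M * ((hermWeight n ^ 5)⁻¹ * hermWeight n ^ 6) * ‖c n‖ : ℝ) := by
          rw [e2, ← Complex.ofReal_mul]
          congr 1
          ring
      _ = _ := by
          rw [e3, e4]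
          congr 1
          ring
  have hsum : 0 ≤ ∑ n ∈ S, ‖c n‖ * hermWeight n :=
    Finset.sum_nonneg fun n _ => mul_nonneg (norm_nonneg _) (hermWeight_pos n).le
  have hsup : ‖∫ x, starRingEnd ℂ (f x) * harmProd y φ x‖ₑ ≤
      ⨆ (φ : 𝓢(EuclideanSpace ℝ ι, ℂ))
      (_ : (∫ x, starRingEnd ℂ (φ x) * harmProd y φ x).re ≤ 1),
      ‖∫ x, starRingEnd ℂ (f x) * harmProd y φ x‖ₑ :=
    le_iSup₂ (f := fun (φ : 𝓢(EuclideanSpace ℝ ι, ℂ))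
      (_ : (∫ x, starRingEnd ℂ (φ x) * harmProd y φ x).re ≤ 1) =>
      ‖∫ x, starRingEnd ℂ (f x) * harmProd y φ x‖ₑ) φ hform
  have hnorm : ‖∫ x, starRingEnd ℂ (f x) * harmProd y φ x‖ₑ =
      2 ^ M * ENNReal.ofReal (∑ n ∈ S, ‖c n‖ * hermWeight n) := by
    rw [hval, ← ofReal_norm, Complex.norm_real, Real.norm_eq_abs,
      abs_of_nonneg (by positivity), ENNReal.ofReal_mul (by positivity),
      ENNReal.ofReal_pow (by norm_num), ENNReal.ofReal_ofNat]
  -- The pairing of f with Bφ produces 2^M, and the norm carries 2^{-3M/2}; the missing factor is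
  -- 2^{M/2}.
  have hpow : (2 : ℝ≥0∞) ^ ((M : ℝ) / 2) * (2 ^ (-(3 * (M : ℝ) / 2)) * 2 ^ M) = 1 := by
    rw [← ENNReal.rpow_natCast, ← ENNReal.rpow_add _ _ (by norm_num) (by norm_num),
      ← ENNReal.rpow_add _ _ (by norm_num) (by norm_num)]
    have : (M : ℝ) / 2 + (-(3 * (M : ℝ) / 2) + M) = 0 := by ring
    rw [this, ENNReal.rpow_zero]
  calc _ = 2 ^ ((M : ℝ) / 2) * (2 ^ (-(3 * (M : ℝ) / 2)) * 2 ^ M) *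
        ENNReal.ofReal (∑ n ∈ S, ‖c n‖ * hermWeight n) := by rw [hpow, one_mul]
    _ = 2 ^ ((M : ℝ) / 2) * (2 ^ (-(3 * (M : ℝ) / 2)) *
        ‖∫ x, starRingEnd ℂ (f x) * harmProd y φ x‖ₑ) := by rw [hnorm]; ring
    _ ≤ _ := by
        rw [sobolevNorm]
        gcongr

theorem tsum_coeff_le (y : EuclideanSpace ℝ ι)
    (f : Lp ℂ 2 (volume : Measure (EuclideanSpace ℝ ι))) :
    ∑' n : ι → ℕ, ‖⟪hermLp y n, f⟫‖ₑ * ENNReal.ofReal (hermWeight n) ≤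
      2 ^ ((Fintype.card ι : ℝ) / 2) * sobolevNorm y f := by
  rw [ENNReal.tsum_eq_iSup_sum]
  refine iSup_le fun S => le_trans (le_of_eq ?_) (sum_coeff_le y f S)
  rw [ENNReal.ofReal_sum_of_nonneg fun n _ =>
    mul_nonneg (norm_nonneg _) (hermWeight_pos n).le]
  refine Finset.sum_congr rfl fun n _ => ?_
  rw [ENNReal.ofReal_mul (norm_nonneg _), ofReal_norm]

end FreeFermions

end

noncomputable section

namespace FreeFermions

/-! ### The dispersive estimate -/

theorem integral_fourier_mul_eq {E : Type*} [NormedAddCommGroup E] [MeasurableSpace E]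
    [BorelSpace E] [InnerProductSpace ℝ E] [FiniteDimensional ℝ E] {f g : E → ℂ}
    (hf : Integrable f) (hg : Integrable g) : ∫ ξ, 𝓕 f ξ * g ξ = ∫ x, f x * 𝓕 g x := by
  have h := VectorFourier.integral_fourierIntegral_smul_eq_flip (μ := (volume : Measure E))
    (ν := (volume : Measure E)) (L := innerₗ E) (f := f) (g := g) Real.continuous_fourierChar
    continuous_inner hf hg
  rw [flip_innerₗ] at h
  exact h

theorem norm_integral_mul_le {E : Type*} [MeasurableSpace E] {μ : Measure E} {f g : E → ℂ}
    (hf : Integrable f μ) {C : ℝ} (hg : ∀ x, ‖g x‖ ≤ C) :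
    ‖∫ x, f x * g x ∂μ‖ ≤ (∫ x, ‖f x‖ ∂μ) * C := by
  rw [← integral_mul_const]
  refine norm_integral_le_of_norm_le (hf.norm.mul_const C) (Filter.Eventually.of_forall fun x => ?_)
  rw [norm_mul]
  exact mul_le_mul_of_nonneg_left (hg x) (norm_nonneg _)

variable {d : ℕ}

/-- The Fourier transform of a modulated complex Gaussian is bounded. -/
theorem norm_fourier_gaussian_le {z : ℂ} (hz : 0 < z.re) (y x : EuclideanSpace ℝ (Fin d)) :
    ‖𝓕 (fun v : EuclideanSpace ℝ (Fin d) =>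
      Complex.exp (-z * ‖v‖ ^ 2 + 2 * Real.pi * Complex.I * inner ℝ y v)) x‖ ≤
      (Real.pi / ‖z‖) ^ ((d : ℝ) / 2) := by
  rw [fourier_gaussian_innerProductSpace' hz, finrank_euclideanSpace_fin, norm_mul]
  have hz0 : z ≠ 0 := fun h => by simp [h] at hz
  have e1 : ((d : ℂ) / 2) = (((d : ℝ) / 2 : ℝ) : ℂ) := by push_cast; rfl
  have h1 : ‖((Real.pi : ℂ) / z) ^ ((d : ℂ) / 2)‖ = (Real.pi / ‖z‖) ^ ((d : ℝ) / 2) := by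
    rw [e1, Complex.norm_cpow_real, norm_div, Complex.norm_real, Real.norm_eq_abs,
      abs_of_pos Real.pi_pos]
  have h2 : ‖Complex.exp (-(Real.pi : ℂ) ^ 2 * ‖y - x‖ ^ 2 / z)‖ ≤ 1 := by
    rw [Complex.norm_exp, Real.exp_le_one_iff]
    have : -(Real.pi : ℂ) ^ 2 * ‖y - x‖ ^ 2 / z =
        ((-(Real.pi ^ 2 * ‖y - x‖ ^ 2) : ℝ) : ℂ) * z⁻¹ := by
      push_cast
      ring
    rw [this, Complex.re_ofReal_mul, Complex.inv_re]
    have h3 : 0 ≤ z.re / Complex.normSq z := div_nonneg hz.le (Complex.normSq_nonneg z)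
    have h4 : 0 ≤ Real.pi ^ 2 * ‖y - x‖ ^ 2 := by positivity
    nlinarith
  rw [h1]
  exact mul_le_of_le_one_right (by positivity) h2

theorem norm_cexp_neg_mul_sq (z : ℂ) (v : EuclideanSpace ℝ (Fin d)) :
    ‖Complex.exp (-z * ‖v‖ ^ 2)‖ = Real.exp (-z.re * ‖v‖ ^ 2) := by
  rw [Complex.norm_exp]
  congr 1
  rw [← Complex.ofReal_pow, mul_comm, Complex.re_ofReal_mul, Complex.neg_re, mul_comm]

theorem integrable_cexp {z : ℂ} (hz : 0 < z.re) {φ : EuclideanSpace ℝ (Fin d) → ℂ} {C : ℝ}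
    (hφ : Continuous φ) (hb : ∀ v, ‖φ v‖ ≤ C) :
    Integrable fun v : EuclideanSpace ℝ (Fin d) => Complex.exp (-z * ‖v‖ ^ 2) * φ v := by
  have h1 : Integrable fun v : EuclideanSpace ℝ (Fin d) => Complex.exp (-z * ‖v‖ ^ 2) := by
    have := GaussianFourier.integrable_cexp_neg_mul_sq_norm_add hz 0 (0 : EuclideanSpace ℝ (Fin d))
    simpa using this
  exact h1.mul_bdd hφ.aestronglyMeasurable (Filter.Eventually.of_forall hb)

/-- For Re z > 0 the Gaussian is integrable, so the multiplication formula can be used twice to move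
both Fourier transforms onto it. What remains is the supremum of a transformed Gaussian and two L¹
norms. -/
theorem norm_integral_regularized_le {z : ℂ} (hz : 0 < z.re)
    (f g : 𝓢(EuclideanSpace ℝ (Fin d), ℂ)) :
    ‖∫ ξ, Complex.exp (-z * ‖ξ‖ ^ 2) * (starRingEnd ℂ (𝓕 f ξ) * 𝓕 g ξ)‖ ≤
      (Real.pi / ‖z‖) ^ ((d : ℝ) / 2) * (∫ x, ‖f x‖) * ∫ x, ‖g x‖ := by
  let F : EuclideanSpace ℝ (Fin d) → ℂ := fun ξ =>
    Complex.exp (-z * ‖ξ‖ ^ 2) * starRingEnd ℂ (𝓕 f ξ)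
  have hFf : ∀ ξ, ‖starRingEnd ℂ (𝓕 f ξ)‖ ≤ ∫ x, ‖f x‖ := by
    intro ξ
    rw [RCLike.norm_conj, SchwartzMap.fourier_coe]
    exact VectorFourier.norm_fourierIntegral_le_integral_norm _ _ _ _ _
  have hF : Integrable F :=
    integrable_cexp hz (Complex.continuous_conj.comp (𝓕 f).continuous) hFf
  have hzc : 0 < (starRingEnd ℂ z).re := by rwa [Complex.conj_re]
  have hbound : ∀ y, ‖𝓕 F y‖ ≤ (∫ x, ‖f x‖) * (Real.pi / ‖z‖) ^ ((d : ℝ) / 2) := by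
    intro y
    have e1 : starRingEnd ℂ (𝓕 F y) = ∫ ξ, 𝓕 (f : EuclideanSpace ℝ (Fin d) → ℂ) ξ *
        Complex.exp (-(starRingEnd ℂ z) * ‖ξ‖ ^ 2 + 2 * Real.pi * Complex.I * inner ℝ y ξ) := by
      rw [Real.fourier_eq, ← integral_conj]
      refine integral_congr_ae (Filter.Eventually.of_forall fun ξ => ?_)
      simp only [F]
      rw [Circle.smul_def, Real.fourierChar_apply, smul_eq_mul, map_mul, map_mul, Complex.conj_conj,
        ← Complex.exp_conj, ← Complex.exp_conj, ← mul_assoc, ← Complex.exp_add, mul_comm,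
        SchwartzMap.fourier_coe, add_comm]
      congr 2
      simp only [map_mul, map_neg, map_pow, Complex.conj_ofReal, Complex.conj_I]
      rw [real_inner_comm]
      push_cast
      ring
    have hi : Integrable fun ξ : EuclideanSpace ℝ (Fin d) =>
        Complex.exp (-(starRingEnd ℂ z) * ‖ξ‖ ^ 2 + 2 * Real.pi * Complex.I * inner ℝ y ξ) :=
      GaussianFourier.integrable_cexp_neg_mul_sq_norm_add hzc _ _
    rw [← RCLike.norm_conj, e1, integral_fourier_mul_eq f.integrable hi]
    refine norm_integral_mul_le f.integrable fun x => ?_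
    have := norm_fourier_gaussian_le hzc y x
    rwa [RCLike.norm_conj] at this
  have e : ∫ ξ, Complex.exp (-z * ‖ξ‖ ^ 2) * (starRingEnd ℂ (𝓕 f ξ) * 𝓕 g ξ) =
      ∫ ξ, 𝓕 (g : EuclideanSpace ℝ (Fin d) → ℂ) ξ * F ξ := by
    refine integral_congr_ae (Filter.Eventually.of_forall fun ξ => ?_)
    simp only [F, SchwartzMap.fourier_coe g]
    ring
  rw [e, integral_fourier_mul_eq g.integrable hF]
  refine (norm_integral_mul_le g.integrable hbound).trans (le_of_eq ?_)
  ring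

/-- The dispersive estimate, as the limit of the regularised one when the real part of z tends to 0.
-/
theorem norm_inner_oneEvol_le (f g : 𝓢(EuclideanSpace ℝ (Fin d), ℂ)) {t : ℝ} (ht : t ≠ 0) :
    ‖(⟪f.toLp 2 volume, oneEvol t (g.toLp 2 volume)⟫ : ℂ)‖ ≤
      (4 * Real.pi * |t|)⁻¹ ^ ((d : ℝ) / 2) * (∫ x, ‖f x‖) * ∫ x, ‖g x‖ := by
  have hp := Real.pi_pos
  have e1 : (⟪f.toLp 2 volume, oneEvol t (g.toLp 2 volume)⟫ : ℂ) =
      ∫ ξ, onePhaseFun d t ξ * (starRingEnd ℂ (𝓕 f ξ) * 𝓕 g ξ) := by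
    have h0 := inner_onePhaseOp 0 t ((𝓕 f).toLp 2 volume) ((𝓕 g).toLp 2 volume)
    rw [onePhaseOp_zero, sub_zero] at h0
    rw [← Lp.inner_fourier_eq, fourier_oneEvol, SchwartzMap.toLp_fourier_eq,
      SchwartzMap.toLp_fourier_eq, h0]
    refine integral_congr_ae ?_
    filter_upwards [(𝓕 f).coeFn_toLp 2 volume, (𝓕 g).coeFn_toLp 2 volume] with ξ h1 h2
    rw [h1, h2, RCLike.inner_apply, mul_comm (𝓕 g ξ)]
  have hint : Integrable fun ξ => starRingEnd ℂ (𝓕 f ξ) * 𝓕 g ξ := by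
    have h1 : MemLp (fun ξ => starRingEnd ℂ (𝓕 f ξ)) 2
        (volume : Measure (EuclideanSpace ℝ (Fin d))) := ((𝓕 f).memLp 2 volume).star
    exact h1.integrable_mul ((𝓕 g).memLp 2 volume)
  -- The limit 4π²it is the exponent of the free evolution in the variable ξ. All z n have modulus
  -- at least 4π²|t|, and π/(4π²|t|) = (4π|t|)⁻¹.
  let z : ℕ → ℂ := fun n => (((n : ℝ) + 1)⁻¹ : ℝ) + ((4 * Real.pi ^ 2 * t : ℝ) : ℂ) * Complex.I
  have hz : ∀ n, 0 < (z n).re := by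
    intro n
    have : (z n).re = ((n : ℝ) + 1)⁻¹ := by
      simp only [z, Complex.add_re, Complex.ofReal_re, Complex.mul_I_re, Complex.ofReal_im,
        neg_zero, add_zero]
    rw [this]
    positivity
  have hzn : ∀ n, 4 * Real.pi ^ 2 * |t| ≤ ‖z n‖ := by
    intro n
    have h1 : (z n).im = 4 * Real.pi ^ 2 * t := by
      simp only [z, Complex.add_im, Complex.ofReal_im, Complex.mul_I_im,
        Complex.ofReal_re, zero_add]
    have h2 := Complex.abs_im_le_norm (z n)
    rwa [h1, abs_mul, abs_of_nonneg (by positivity : 0 ≤ 4 * Real.pi ^ 2)] at h2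
  have hlim : Filter.Tendsto
      (fun n => ∫ ξ, Complex.exp (-z n * ‖ξ‖ ^ 2) * (starRingEnd ℂ (𝓕 f ξ) * 𝓕 g ξ))
      Filter.atTop (nhds (∫ ξ, onePhaseFun d t ξ * (starRingEnd ℂ (𝓕 f ξ) * 𝓕 g ξ))) := by
    refine tendsto_integral_of_dominated_convergence
      (fun ξ => ‖starRingEnd ℂ (𝓕 f ξ) * 𝓕 g ξ‖) (fun n => ?_) hint.norm
      (fun n => Filter.Eventually.of_forall fun ξ => ?_) (Filter.Eventually.of_forall fun ξ => ?_)
    · exact (by fun_prop : Continuous fun ξ : EuclideanSpace ℝ (Fin d) =>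
        Complex.exp (-z n * ‖ξ‖ ^ 2)).aestronglyMeasurable.mul hint.aestronglyMeasurable
    · rw [norm_mul]
      refine mul_le_of_le_one_left (norm_nonneg _) ?_
      rw [norm_cexp_neg_mul_sq, Real.exp_le_one_iff]
      nlinarith [hz n, sq_nonneg ‖ξ‖]
    · refine Filter.Tendsto.mul_const _ ?_
      have h1 : Filter.Tendsto z Filter.atTop
          (nhds (((0 : ℝ) : ℂ) + ((4 * Real.pi ^ 2 * t : ℝ) : ℂ) * Complex.I)) := by
        refine Filter.Tendsto.add_const _ ((Complex.continuous_ofReal.tendsto 0).comp ?_)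
        have := tendsto_one_div_add_atTop_nhds_zero_nat (𝕜 := ℝ)
        simpa using this
      have h2 := ((by fun_prop : Continuous fun w : ℂ =>
        Complex.exp (-w * ‖ξ‖ ^ 2)).tendsto _).comp h1
      have h3 : onePhaseFun d t ξ = Complex.exp (-(((0 : ℝ) : ℂ) +
          ((4 * Real.pi ^ 2 * t : ℝ) : ℂ) * Complex.I) * ‖ξ‖ ^ 2) := by
        simp only [onePhaseFun]
        congr 1
        push_cast
        ring
      rw [h3]
      exact h2
  rw [e1]
  refine le_of_tendsto hlim.norm (Filter.Eventually.of_forall fun n => ?_)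
  refine (norm_integral_regularized_le (hz n) f g).trans ?_
  have hf0 : 0 ≤ ∫ x, ‖f x‖ := integral_nonneg fun x => norm_nonneg _
  have hg0 : 0 ≤ ∫ x, ‖g x‖ := integral_nonneg fun x => norm_nonneg _
  have ht0 : 0 < |t| := abs_pos.2 ht
  gcongr
  rw [inv_eq_one_div, div_le_div_iff₀ (norm_pos_iff.2 fun h => by
    have := hz n; simp [h] at this) (by positivity)]
  have := hzn n
  nlinarith

/-- Splitting at t = C gives C from the bound 1 and 2C/(d-2) from the tail, which is integrable as
d/2 > 1. -/
theorem lintegral_min_rpow_le (hd : 3 ≤ d) {C : ℝ} (hC : 0 < C) {u : ℝ → ℝ≥0∞}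
    (h1 : ∀ t, u t ≤ 1) (h2 : ∀ t, 0 < t → u t ≤ ENNReal.ofReal ((C / t) ^ ((d : ℝ) / 2))) :
    ∫⁻ t in Set.Ioi 0, u t ≤ ENNReal.ofReal (C * (d / ((d : ℝ) - 2))) := by
  have hd' : (3 : ℝ) ≤ d := by exact_mod_cast hd
  have hr : -((d : ℝ) / 2) < -1 := by linarith
  have e1 : Set.Ioi (0 : ℝ) = Set.Ioc 0 C ∪ Set.Ioi C := (Set.Ioc_union_Ioi_eq_Ioi hC.le).symm
  have i1 : IntegrableOn (fun t : ℝ => C ^ ((d : ℝ) / 2) * t ^ (-((d : ℝ) / 2))) (Set.Ioi C) :=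
    (integrableOn_Ioi_rpow_of_lt hr hC).const_mul _
  have b1 : ∫⁻ t in Set.Ioc 0 C, u t ≤ ENNReal.ofReal C := by
    refine (lintegral_mono fun t => h1 t).trans (le_of_eq ?_)
    rw [lintegral_one, Measure.restrict_apply_univ, Real.volume_Ioc, sub_zero]
  have b2 : ∫⁻ t in Set.Ioi C, u t ≤ ENNReal.ofReal (C * (2 / ((d : ℝ) - 2))) := by
    calc _ ≤ ∫⁻ t in Set.Ioi C, ENNReal.ofReal (C ^ ((d : ℝ) / 2) * t ^ (-((d : ℝ) / 2))) := by
          refine setLIntegral_mono' measurableSet_Ioi fun t ht => ?_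
          have ht0 : 0 < t := hC.trans ht
          refine (h2 t ht0).trans (le_of_eq ?_)
          rw [Real.div_rpow hC.le ht0.le, Real.rpow_neg ht0.le]
          rfl
      _ = ENNReal.ofReal (∫ t in Set.Ioi C, C ^ ((d : ℝ) / 2) * t ^ (-((d : ℝ) / 2))) := by
          rw [ofReal_integral_eq_lintegral_ofReal i1]
          filter_upwards [ae_restrict_mem measurableSet_Ioi] with t ht
          have ht0 : 0 < t := hC.trans ht
          exact mul_nonneg (by positivity) (by positivity)
      _ = _ := by
          rw [integral_const_mul, integral_Ioi_rpow_of_lt hr hC, Real.rpow_add hC, Real.rpow_one,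
            Real.rpow_neg hC.le]
          have h3 : C ^ ((d : ℝ) / 2) ≠ 0 := (Real.rpow_pos_of_pos hC _).ne'
          have h4 : (d : ℝ) - 2 ≠ 0 := by linarith
          have h5 : -((d : ℝ) / 2) + 1 ≠ 0 := by linarith
          have h6 : -((d : ℝ) / 2) + 1 = -(((d : ℝ) - 2) / 2) := by ring
          congr 1
          rw [h6]
          field_simp
  calc _ ≤ (∫⁻ t in Set.Ioc 0 C, u t) + ∫⁻ t in Set.Ioi C, u t := by
        rw [e1]
        exact lintegral_union_le _ _ _
    _ ≤ ENNReal.ofReal C + ENNReal.ofReal (C * (2 / ((d : ℝ) - 2))) := add_le_add b1 b2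
    _ = _ := by
        have : 0 < (d : ℝ) - 2 := by linarith
        rw [← ENNReal.ofReal_add hC.le (by positivity)]
        congr 1
        field_simp
        ring

theorem enorm_inner_hermLp_le_one (y y' : EuclideanSpace ℝ (Fin d)) (n n' : Fin d → ℕ) (t : ℝ) :
    ‖(⟪hermLp y n, oneEvol t (hermLp y' n')⟫ : ℂ)‖ₑ ≤ 1 := by
  rw [← ofReal_norm, ← ENNReal.ofReal_one]
  refine ENNReal.ofReal_le_ofReal ((norm_inner_le_norm _ _).trans ?_)
  rw [norm_oneEvol, (orthonormal_hermLp y).1 n, (orthonormal_hermLp y').1 n', one_mul]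

/-- The constants combine to (2π)^d (4π|t|)^{-d/2} = (π/|t|)^{d/2}. The weights may be raised to the
power d/2 ≥ 1 because they are at least 1; the time integral then scales linearly in them. -/
theorem enorm_inner_hermLp_le (hd : 3 ≤ d) (y y' : EuclideanSpace ℝ (Fin d)) (n n' : Fin d → ℕ)
    {t : ℝ} (ht : t ≠ 0) :
    ‖(⟪hermLp y n, oneEvol t (hermLp y' n')⟫ : ℂ)‖ₑ ≤
      ENNReal.ofReal ((Real.pi * (hermWeight n * hermWeight n') / |t|) ^ ((d : ℝ) / 2)) := by
  have hp := Real.pi_pos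
  have hd' : (3 : ℝ) ≤ d := by exact_mod_cast hd
  have hL1 : ∀ (y : EuclideanSpace ℝ (Fin d)) (n : Fin d → ℕ),
      ∫ x, ‖herm y n x‖ ≤ (2 * Real.pi) ^ ((d : ℝ) / 2) * hermWeight n := by
    intro y n
    have hw := hermWeight_pos n
    refine le_of_sq_le_sq ?_ (by positivity)
    refine (sq_integral_norm_herm_le y n).trans (le_of_eq ?_)
    rw [mul_pow _ (hermWeight n), hermWeight_sq, Fintype.card_fin, ← Real.rpow_natCast _ 2,
      ← Real.rpow_mul (by positivity)]
    congr 1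
    rw [← Real.rpow_natCast]
    congr 1
    push_cast
    ring
  rw [← ofReal_norm]
  refine ENNReal.ofReal_le_ofReal ((norm_inner_oneEvol_le (herm y n) (herm y' n') ht).trans ?_)
  have ht0 : 0 < |t| := abs_pos.2 ht
  have hw := hermWeight_pos n
  have hw' := hermWeight_pos n'
  have hww : hermWeight n * hermWeight n' ≤ (hermWeight n * hermWeight n') ^ ((d : ℝ) / 2) := by
    have h1 : 1 ≤ hermWeight n * hermWeight n' :=
      one_le_mul_of_one_le_of_one_le (one_le_hermWeight n) (one_le_hermWeight n')
    calc _ = (hermWeight n * hermWeight n') ^ (1 : ℝ) := (Real.rpow_one _).symm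
      _ ≤ _ := Real.rpow_le_rpow_of_exponent_le h1 (by linarith)
  have h0 : 0 ≤ ∫ x, ‖herm y n x‖ := integral_nonneg fun x => norm_nonneg _
  have h0' : 0 ≤ ∫ x, ‖herm y' n' x‖ := integral_nonneg fun x => norm_nonneg _
  calc _ ≤ (4 * Real.pi * |t|)⁻¹ ^ ((d : ℝ) / 2) * ((2 * Real.pi) ^ ((d : ℝ) / 2) * hermWeight n) *
        ((2 * Real.pi) ^ ((d : ℝ) / 2) * hermWeight n') := by
        gcongr
        · exact hL1 y n
        · exact hL1 y' n'
    _ = (4 * Real.pi * |t|)⁻¹ ^ ((d : ℝ) / 2) * (2 * Real.pi) ^ ((d : ℝ) / 2) *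
        (2 * Real.pi) ^ ((d : ℝ) / 2) * (hermWeight n * hermWeight n') := by ring
    _ ≤ (4 * Real.pi * |t|)⁻¹ ^ ((d : ℝ) / 2) * (2 * Real.pi) ^ ((d : ℝ) / 2) *
        (2 * Real.pi) ^ ((d : ℝ) / 2) * (hermWeight n * hermWeight n') ^ ((d : ℝ) / 2) := by
        gcongr
    _ = _ := by
        rw [← Real.mul_rpow (by positivity) (by positivity),
          ← Real.mul_rpow (by positivity) (by positivity),
          ← Real.mul_rpow (by positivity) (by positivity)]
        congr 1
        field_simp
        ring

theorem lintegral_inner_hermLp_le (hd : 3 ≤ d) (y y' : EuclideanSpace ℝ (Fin d))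
    (n n' : Fin d → ℕ) (s σ : ℝ) (hσ : |σ| = 1) :
    ∫⁻ t in Set.Ioi s, ‖(⟪hermLp y n, oneEvol (σ * (t - s)) (hermLp y' n')⟫ : ℂ)‖ₑ ≤
      ENNReal.ofReal (Real.pi * (d / ((d : ℝ) - 2))) * ENNReal.ofReal (hermWeight n) *
        ENNReal.ofReal (hermWeight n') := by
  have hp := Real.pi_pos
  have hw := hermWeight_pos n
  have hw' := hermWeight_pos n'
  have hd' : (3 : ℝ) ≤ d := by exact_mod_cast hd
  have h1 := lintegral_min_rpow_le hd (C := Real.pi * (hermWeight n * hermWeight n'))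
    (by positivity) (u := fun t => ‖(⟪hermLp y n, oneEvol (σ * t) (hermLp y' n')⟫ : ℂ)‖ₑ)
    (fun t => enorm_inner_hermLp_le_one y y' n n' _) (fun t ht => by
      have hσ0 : σ ≠ 0 := fun h => by simp [h] at hσ
      have := enorm_inner_hermLp_le hd y y' n n' (t := σ * t) (mul_ne_zero hσ0 ht.ne')
      rwa [abs_mul, hσ, one_mul, abs_of_pos ht] at this)
  have h2 : ∫⁻ t in Set.Ioi s, ‖(⟪hermLp y n, oneEvol (σ * (t - s)) (hermLp y' n')⟫ : ℂ)‖ₑ =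
      ∫⁻ t in Set.Ioi 0, ‖(⟪hermLp y n, oneEvol (σ * t) (hermLp y' n')⟫ : ℂ)‖ₑ := by
    rw [← lintegral_indicator measurableSet_Ioi, ← lintegral_indicator measurableSet_Ioi,
      ← lintegral_sub_right_eq_self ((Set.Ioi 0).indicator _) s]
    refine lintegral_congr fun t => ?_
    simp only [Set.indicator, Set.mem_Ioi, sub_pos]
  rw [h2]
  refine h1.trans (le_of_eq ?_)
  have : 0 < (d : ℝ) - 2 := by linarith
  rw [← ENNReal.ofReal_mul (by positivity), ← ENNReal.ofReal_mul (by positivity)]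
  congr 1
  ring

end FreeFermions

end

noncomputable section

namespace FreeFermions

/-! ### Partial scalar products of square integrable functions -/

theorem MemLp.prod_mul {X Y : Type*} [MeasurableSpace X] [MeasurableSpace Y] {μ : Measure X}
    {ν : Measure Y} {u : X → ℂ} {v : Y → ℂ} (hu : MemLp u 2 μ) (hv : MemLp v 2 ν) :
    MemLp (fun p : X × Y => u p.1 * v p.2) 2 (μ.prod ν) := by
  have := MemLp.smul_prod hv hu
  simp only [smul_eq_mul, mul_comm] at this ⊢
  exact this

section Pairing

variable {X Y Z : Type*} [MeasurableSpace X] [MeasurableSpace Y] [MeasurableSpace Z]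
  {μ : Measure X} {ν : Measure Y} {ρ : Measure Z} [SFinite μ] [SFinite ν] [SFinite ρ]

/-- Cauchy-Schwarz in z, after which the square norm factorises into those of F and G. -/
theorem MemLp.integral_conj_mul {F : Z × X → ℂ} {G : Z × Y → ℂ} (hF : MemLp F 2 (ρ.prod μ))
    (hG : MemLp G 2 (ρ.prod ν)) :
    MemLp (fun p : X × Y => ∫ z, starRingEnd ℂ (F (z, p.1)) * G (z, p.2) ∂ρ) 2 (μ.prod ν) := by
  have hF' : MemLp (fun q : X × Z => starRingEnd ℂ (F q.swap)) 2 (μ.prod ρ) :=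
    (hF.comp_measurePreserving Measure.measurePreserving_swap).star
  have hG' : MemLp (fun q : Y × Z => G q.swap) 2 (ν.prod ρ) :=
    hG.comp_measurePreserving Measure.measurePreserving_swap
  have m1 : Measure.QuasiMeasurePreserving (fun q : (X × Y) × Z => (q.1.1, q.2))
      ((μ.prod ν).prod ρ) (μ.prod ρ) :=
    QuasiMeasurePreserving.prodMap Measure.quasiMeasurePreserving_fst (.id ρ)
  have m2 : Measure.QuasiMeasurePreserving (fun q : (X × Y) × Z => (q.1.2, q.2))
      ((μ.prod ν).prod ρ) (ν.prod ρ) :=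
    QuasiMeasurePreserving.prodMap Measure.quasiMeasurePreserving_snd (.id ρ)
  refine ⟨((hF'.1.comp_quasiMeasurePreserving m1).mul
    (hG'.1.comp_quasiMeasurePreserving m2)).integral_prod_right', ?_⟩
  rw [eLpNorm_lt_top_iff_lintegral_rpow_enorm_lt_top two_ne_zero ENNReal.ofNat_ne_top]
  have hF2 := (eLpNorm_lt_top_iff_lintegral_rpow_enorm_lt_top two_ne_zero
    ENNReal.ofNat_ne_top).1 hF'.2
  have hG2 := (eLpNorm_lt_top_iff_lintegral_rpow_enorm_lt_top two_ne_zero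
    ENNReal.ofNat_ne_top).1 hG'.2
  simp only [ENNReal.toReal_ofNat] at hF2 hG2 ⊢
  have e1 := hF'.1.enorm.pow_const (2 : ℝ)
  have e2 := hG'.1.enorm.pow_const (2 : ℝ)
  rw [lintegral_prod _ e1] at hF2
  rw [lintegral_prod _ e2] at hG2
  refine lt_of_le_of_lt (lintegral_mono_ae ?_) ((lintegral_prod_mul (μ := μ) (ν := ν)
    e1.lintegral_prod_right' e2.lintegral_prod_right').trans_lt (ENNReal.mul_lt_top hF2 hG2))
  filter_upwards [Measure.quasiMeasurePreserving_fst.ae (MemLp.ae_memLp_slice hF'),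
    Measure.quasiMeasurePreserving_snd.ae (MemLp.ae_memLp_slice hG')] with p h1 h2
  exact enorm_integral_smul_sq_le h1 h2.1

theorem integral_mul_integral_conj_mul {F : Z × X → ℂ} {G : Z × Y → ℂ} {u : X → ℂ} {v : Y → ℂ}
    (hF : MemLp F 2 (ρ.prod μ)) (hG : MemLp G 2 (ρ.prod ν)) (hu : MemLp u 2 μ)
    (hv : MemLp v 2 ν) :
    ∫ p : X × Y, (u p.1 * v p.2) * ∫ z, starRingEnd ℂ (F (z, p.1)) * G (z, p.2) ∂ρ ∂(μ.prod ν) =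
      ∫ z, starRingEnd ℂ (∫ x, starRingEnd ℂ (u x) * F (z, x) ∂μ) * ∫ y, v y * G (z, y) ∂ν ∂ρ := by
  have hu' : MemLp (fun x => starRingEnd ℂ (u x)) 2 μ := hu.star
  have hF' : MemLp (fun q => starRingEnd ℂ (F q)) 2 (ρ.prod μ) := hF.star
  have hm : AEStronglyMeasurable (fun q : Z × (X × Y) =>
      (u q.2.1 * starRingEnd ℂ (F (q.1, q.2.1))) * (v q.2.2 * G (q.1, q.2.2)))
      (ρ.prod (μ.prod ν)) := by
    have m1 : Measure.QuasiMeasurePreserving (fun q : Z × (X × Y) => (q.1, q.2.1))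
        (ρ.prod (μ.prod ν)) (ρ.prod μ) :=
      QuasiMeasurePreserving.prodMap (.id ρ) Measure.quasiMeasurePreserving_fst
    have m2 : Measure.QuasiMeasurePreserving (fun q : Z × (X × Y) => (q.1, q.2.2))
        (ρ.prod (μ.prod ν)) (ρ.prod ν) :=
      QuasiMeasurePreserving.prodMap (.id ρ) Measure.quasiMeasurePreserving_snd
    exact ((hu.1.comp_snd.mul hF'.1).comp_quasiMeasurePreserving m1).mul
      ((hv.1.comp_snd.mul hG.1).comp_quasiMeasurePreserving m2)
  have hi : Integrable (fun q : Z × (X × Y) =>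
      (u q.2.1 * starRingEnd ℂ (F (q.1, q.2.1))) * (v q.2.2 * G (q.1, q.2.2)))
      (ρ.prod (μ.prod ν)) := by
    refine (integrable_prod_iff hm).2 ⟨?_, ?_⟩
    · filter_upwards [MemLp.ae_memLp_slice hF', MemLp.ae_memLp_slice hG] with z h1 h2
      exact (MemLp.integrable_smul_two hu h1).mul_prod (MemLp.integrable_smul_two hv h2)
    -- Absolute integrability for Fubini: the inner integral is a product of two partial pairings of
    -- absolute values, each square integrable in z.
    · have e : ∀ z, ∫ p : X × Y, ‖(u p.1 * starRingEnd ℂ (F (z, p.1))) * (v p.2 * G (z, p.2))‖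
          ∂(μ.prod ν) = (∫ x, ‖u x‖ * ‖F (z, x)‖ ∂μ) * ∫ y, ‖v y‖ * ‖G (z, y)‖ ∂ν := by
        intro z
        rw [← integral_prod_mul]
        simp only [norm_mul, RCLike.norm_conj]
      simp only [e]
      have h1 := MemLp.integral_smul_slice (F := ℂ) (h := fun x => ((‖u x‖ : ℝ) : ℂ))
        (Ψ := fun q => ((‖F q‖ : ℝ) : ℂ)) hu.norm.ofReal hF.norm.ofReal
      have h2 := MemLp.integral_smul_slice (F := ℂ) (h := fun x => ((‖v x‖ : ℝ) : ℂ))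
        (Ψ := fun q => ((‖G q‖ : ℝ) : ℂ)) hv.norm.ofReal hG.norm.ofReal
      simp only [smul_eq_mul, ← Complex.ofReal_mul, integral_complex_ofReal] at h1 h2
      exact (MemLp.integrable_smul_two h1 h2).re.congr
        (Filter.Eventually.of_forall fun z => by simp [← Complex.ofReal_mul])
  have h1 : ∀ z, starRingEnd ℂ (∫ x, starRingEnd ℂ (u x) * F (z, x) ∂μ) * ∫ y, v y * G (z, y) ∂ν =
      ∫ p : X × Y, (u p.1 * starRingEnd ℂ (F (z, p.1))) * (v p.2 * G (z, p.2)) ∂(μ.prod ν) := by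
    intro z
    rw [integral_prod_mul (μ := μ) (ν := ν) (fun x => u x * starRingEnd ℂ (F (z, x)))
      fun y => v y * G (z, y), ← integral_conj]
    simp only [map_mul, Complex.conj_conj]
  simp only [h1]
  rw [integral_integral_swap hi]
  refine integral_congr_ae (Filter.Eventually.of_forall fun p => ?_)
  beta_reduce
  rw [← integral_const_mul]
  refine integral_congr_ae (Filter.Eventually.of_forall fun z => ?_)
  ring

theorem integrable_mul_integral_conj_mul {F : Z × X → ℂ} {G : Z × Y → ℂ} {u : X → ℂ} {v : Y → ℂ}
    (hF : MemLp F 2 (ρ.prod μ)) (hG : MemLp G 2 (ρ.prod ν)) (hu : MemLp u 2 μ)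
    (hv : MemLp v 2 ν) :
    Integrable (fun p : X × Y => (u p.1 * v p.2) *
      ∫ z, starRingEnd ℂ (F (z, p.1)) * G (z, p.2) ∂ρ) (μ.prod ν) :=
  MemLp.integrable_smul_two (MemLp.prod_mul hu hv) (MemLp.integral_conj_mul hF hG)

end Pairing

/-! ### Coordinates -/

section Coords

variable {ι : Type} [Fintype ι] {d : ℕ}

theorem measurePreserving_coords :
    MeasurePreserving (coords : (ι → EuclideanSpace ℝ (Fin d)) → EuclideanSpace ℝ (ι × Fin d))
      volume volume := by
  have h1 : MeasurePreserving (MeasurableEquiv.curry ι (Fin d) ℝ).symm volume volume := by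
    refine ⟨(MeasurableEquiv.curry ι (Fin d) ℝ).symm.measurable, ?_⟩
    refine (Measure.pi_eq fun s hs => ?_).symm
    rw [MeasurableEquiv.map_apply]
    have e : (MeasurableEquiv.curry ι (Fin d) ℝ).symm ⁻¹' Set.univ.pi s =
        Set.univ.pi fun i => Set.univ.pi fun j => s (i, j) := by
      ext x
      simp [Set.mem_pi, MeasurableEquiv.coe_curry_symm, Function.uncurry, Prod.forall]
    rw [e, volume_pi_pi]
    simp only [volume_pi_pi, Fintype.prod_prod_type]
  have h2 : MeasurePreserving (fun (x : ι → EuclideanSpace ℝ (Fin d)) i => (x i).ofLp)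
      volume volume :=
    volume_preserving_pi fun _ => PiLp.volume_preserving_ofLp (Fin d)
  exact (PiLp.volume_preserving_toLp (ι × Fin d)).comp (h1.comp h2)

theorem measurePreserving_coords_sumElim {ι' : Type} [Fintype ι'] :
    MeasurePreserving (fun p : (ι → EuclideanSpace ℝ (Fin d)) × (ι' → EuclideanSpace ℝ (Fin d)) =>
      coords (Sum.elim p.1 p.2)) volume volume := by
  have e : (fun p : (ι → EuclideanSpace ℝ (Fin d)) × (ι' → EuclideanSpace ℝ (Fin d)) =>
      coords (Sum.elim p.1 p.2)) = coords ∘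
        (MeasurableEquiv.sumPiEquivProdPi fun _ : ι ⊕ ι' => EuclideanSpace ℝ (Fin d)).symm := by
    ext p ⟨j | j, i⟩ <;> rfl
  rw [e]
  exact measurePreserving_coords.comp (volume_measurePreserving_sumPiEquivProdPi_symm _)

end Coords

end FreeFermions

end

noncomputable section

namespace FreeFermions

variable {d k n N : ℕ}

/-! ### Smeared products of pointwise annihilation operators -/

/-- The one-particle configuration space `ℝ^d`. -/
abbrev Space (d : ℕ) : Type := EuclideanSpace ℝ (Fin d)

theorem cons_pair (x : Space d) (z : Fin n → Space d) (l : Label k) (s : Fin n → Label k) :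
    (Fin.cons (x, l) fun j => (z j, s j) : Fin (n + 1) → Pt d k) = fun j =>
      ((Fin.cons x z : Fin (n + 1) → Space d) j, (Fin.cons l s : Fin (n + 1) → Label k) j) := by
  funext j
  refine Fin.cases ?_ (fun j => ?_) j <;> simp

theorem measurePreserving_cons :
    MeasurePreserving (fun p : Space d × (Fin n → Space d) => (Fin.cons p.1 p.2 :
      Fin (n + 1) → Space d)) (volume.prod volume) volume := by
  have h := (volume_preserving_piFinSuccAbove (fun _ : Fin (n + 1) => Space d) 0).symm
  have e : (fun p : Space d × (Fin n → Space d) => (Fin.cons p.1 p.2 : Fin (n + 1) → Space d)) =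
      (MeasurableEquiv.piFinSuccAbove (fun _ : Fin (n + 1) => Space d) 0).symm := by
    funext p
    exact (Fin.insertNth_zero' p.1 p.2).symm
  rw [e]
  exact h

theorem integral_cons {f : (Fin (n + 1) → Space d) → ℂ} (hf : Integrable
    (fun p : Space d × (Fin n → Space d) => f (Fin.cons p.1 p.2)) (volume.prod volume)) :
    ∫ y, f y = ∫ x : Space d, ∫ y : Fin n → Space d, f (Fin.cons x y) := by
  have h := (volume_preserving_piFinSuccAbove (fun _ : Fin (n + 1) => Space d) 0).symm
  have e : ∀ p : Space d × (Fin n → Space d),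
      (MeasurableEquiv.piFinSuccAbove (fun _ : Fin (n + 1) => Space d) 0).symm p =
        Fin.cons p.1 p.2 := fun p => Fin.insertNth_zero' p.1 p.2
  rw [← h.integral_comp', ← integral_prod _ hf]
  simp only [e]
  rfl

/-- Moving the first of the points `y` in front of the points `z`. -/
theorem measurePreserving_consTail : MeasurePreserving
    (fun p : (Fin n → Space d) × (Space d × (Fin N → Space d)) =>
      ((Fin.cons p.2.1 p.1 : Fin (n + 1) → Space d), p.2.2))
    (volume.prod (volume.prod volume)) (volume.prod volume) := by
  have h1 : MeasurePreserving (MeasurableEquiv.prodAssoc.symm :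
      (Fin n → Space d) × (Space d × (Fin N → Space d)) ≃ᵐ _)
      (volume.prod (volume.prod volume)) ((volume.prod volume).prod volume) :=
    (measurePreserving_prodAssoc _ _ _).symm
  have h2 : MeasurePreserving (Prod.map Prod.swap id :
      ((Fin n → Space d) × Space d) × (Fin N → Space d) → _)
      ((volume.prod volume).prod volume) ((volume.prod volume).prod volume) :=
    Measure.measurePreserving_swap.prod (MeasurePreserving.id _)
  exact (measurePreserving_cons.prod (MeasurePreserving.id _)).comp (h2.comp h1)

theorem measurePreserving_snocHead : MeasurePreserving
    (fun p : (Fin n → Space d) × Space d => (Fin.cons p.2 p.1 : Fin (n + 1) → Space d))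
    (volume.prod volume) volume :=
  measurePreserving_cons.comp Measure.measurePreserving_swap

theorem annihProd_zero (Y : Fin 0 → Pt d k) (Ψ : WaveSeq d k) : annihProd Y Ψ = Ψ := by
  simp [annihProd]

theorem annihProd_succ_apply (y : Fin (N + 1) → Space d) (s' : Fin (N + 1) → Label k)
    (Ψ : WaveSeq d k) (z : Fin n → Space d) (s : Fin n → Label k) :
    annihProd (fun j => (y j, s' j)) Ψ n (fun j => (z j, s j)) = (Real.sqrt (n + 1) : ℂ) *
      annihProd (fun j : Fin N => (y j.succ, s' j.succ)) Ψ (n + 1) fun j =>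
        ((Fin.cons (y 0) z : Fin (n + 1) → Space d) j,
          (Fin.cons (s' 0) s : Fin (n + 1) → Label k) j) := by
  rw [← cons_pair]
  simp [annihProd, List.ofFn_succ, annih]

/-- Sequences of square integrable functions. -/
def IsSquareIntegrable (Ψ : WaveSeq d k) : Prop :=
  ∀ (n : ℕ) (s : Fin n → Label k),
    MemLp (fun z : Fin n → Space d => Ψ n fun j => (z j, s j)) 2 volume

theorem isSquareIntegrable_wave (ψ : Fock d k) : IsSquareIntegrable (wave ψ) := fun n s =>
  (EuclideanSpace.proj (𝕜 := ℂ) s).comp_memLp'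
    ((Lp.memLp (ψ.component n : Sector d k n)).comp_measurePreserving measurePreserving_coords)

/-- Up to a constant, N annihilations at points turn N arguments of the (n+N)-particle function into
parameters; joint square integrability is preserved. -/
theorem IsSquareIntegrable.memLp_annihProd {Ψ : WaveSeq d k} (hΨ : IsSquareIntegrable Ψ)
    (s' : Fin N → Label k) (s : Fin n → Label k) :
    MemLp (fun p : (Fin n → Space d) × (Fin N → Space d) =>
      annihProd (fun j => (p.2 j, s' j)) Ψ n fun j => (p.1 j, s j)) 2
        (volume.prod volume) := by
  induction N generalizing n with
  | zero =>
    simp only [annihProd_zero]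
    rw [Measure.volume_pi_eq_dirac (α := fun _ : Fin 0 => Space d)]
    exact (hΨ n s).comp_fst _
  | succ N ih =>
    have h1 : MeasurePreserving (Prod.map id (MeasurableEquiv.piFinSuccAbove
        (fun _ : Fin (N + 1) => Space d) 0) : (Fin n → Space d) × (Fin (N + 1) → Space d) → _)
        (volume.prod volume) (volume.prod (volume.prod volume)) :=
      (MeasurePreserving.id _).prod (volume_preserving_piFinSuccAbove _ 0)
    have h2 := ((ih (fun j => s' j.succ) (Fin.cons (s' 0) s)).comp_measurePreserving
      (measurePreserving_consTail.comp h1)).const_mul (Real.sqrt (n + 1) : ℂ)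
    refine h2.congr_norm ?_ (Filter.Eventually.of_forall fun p => ?_)
    · refine h2.1.congr (Filter.Eventually.of_forall fun p => ?_)
      exact (annihProd_succ_apply p.2 s' Ψ p.1 s).symm
    · exact congrArg norm (annihProd_succ_apply p.2 s' Ψ p.1 s).symm

/-- The product `a(h_1) ⋯ a(h_N)` of annihilation operators. -/
def annProd (l : Fin N → Label k) (h : Fin N → OneParticle d) : Op d k :=
  (List.ofFn fun j => ann (l j) (h j)).prod

theorem annProd_succ (l : Fin (N + 1) → Label k) (h : Fin (N + 1) → OneParticle d) :
    annProd l h = ann (l 0) (h 0) * annProd (fun j => l j.succ) fun j => h j.succ := by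
  simp [annProd, List.ofFn_succ]

theorem memLp_prod (h : Fin N → OneParticle d) :
    MemLp (fun y : Fin N → Space d => ∏ j, h j (y j)) 2 volume := by
  have hm : AEStronglyMeasurable (fun y : Fin N → Space d => ∏ j, h j (y j)) volume :=
    Finset.aestronglyMeasurable_fun_prod _ fun j _ =>
      (Lp.aestronglyMeasurable (h j)).comp_quasiMeasurePreserving
        (Measure.quasiMeasurePreserving_eval (fun _ => volume) j)
  rw [memLp_two_iff_integrable_sq_norm hm]
  simp only [norm_prod, ← Finset.prod_pow]
  exact Integrable.fintype_prod (f := fun j x => ‖h j x‖ ^ 2)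
    fun j => (memLp_two_iff_integrable_sq_norm (Lp.aestronglyMeasurable (h j))).1 (Lp.memLp (h j))

theorem coords_cons (x : Space d) (z : Fin n → Space d) :
    coords (Fin.cons x z : Fin (n + 1) → Space d) = (splitPos d n).symm (coords z, x) := by
  ext ⟨j, i⟩
  refine Fin.cases ?_ (fun j => ?_) j <;> rfl

/-- The formula a(h) = ∫ conj h(x) a(x) dx, on wave functions and up to null sets. -/
theorem wave_ann_ae (l : Label k) (h : OneParticle d) (ψ : Fock d k) (s : Fin n → Label k) :
    ∀ᵐ z : Fin n → Space d, wave (ann l h ψ) n (fun j => (z j, s j)) = (Real.sqrt (n + 1) : ℂ) *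
      ∫ x, starRingEnd ℂ (h x) * wave ψ (n + 1) fun j =>
        ((Fin.cons x z : Fin (n + 1) → Space d) j,
          (Fin.cons l s : Fin (n + 1) → Label k) j) := by
  let Φ : Sector d k (n + 1) := (ψ.component (n + 1) : Sector d k (n + 1))
  have h1 : ((ann l h ψ).component n : Sector d k n) =ᵐ[volume] fun z => (Real.sqrt (n + 1) : ℂ) •
      ∫ x, starRingEnd ℂ (h x) • labelHead k n l (Φ ((splitPos d n).symm (z, x))) := by
    rw [component_ann, coe_annihSector]
    filter_upwards [Lp.coeFn_smul (Real.sqrt (n + 1) : ℂ) (removeParticle l h Φ),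
      removeParticle_ae l h Φ] with z h1 h2
    rw [h1, Pi.smul_apply, h2]
  have h2 : ∀ᵐ z, MemLp (fun x => labelHead k n l (Φ ((splitPos d n).symm (z, x)))) 2 volume :=
    MemLp.ae_memLp_slice ((labelHead k n l).comp_memLp' (memLp_splitPos_symm Φ))
  have hh : MemLp (fun x => starRingEnd ℂ (h x)) 2 volume := (Lp.memLp h).star
  filter_upwards [measurePreserving_coords.quasiMeasurePreserving.ae h1,
    measurePreserving_coords.quasiMeasurePreserving.ae h2] with z h3 h4
  have h5 := (EuclideanSpace.proj (𝕜 := ℂ) s).integral_comp_comm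
    (MemLp.integrable_smul_two hh h4)
  change ((ann l h ψ).component n : Sector d k n) (coords z) s = _
  rw [h3, PiLp.smul_apply, smul_eq_mul]
  congr 1
  refine h5.symm.trans (integral_congr_ae (Filter.Eventually.of_forall fun x => ?_))
  simp only [wave, coords_cons]
  rfl

/-- Induction on N with Fubini: the first point y_0 becomes an additional argument of the wave
function, to which the hypothesis for the other points applies. -/
theorem integral_annihProd_wave (l : Fin N → Label k) (h : Fin N → OneParticle d) (ψ : Fock d k)
    (s : Fin n → Label k) :
    ∀ᵐ z : Fin n → Space d, ∫ y : Fin N → Space d, starRingEnd ℂ (∏ j, h j (y j)) *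
      annihProd (fun j => (y j, l j)) (wave ψ) n (fun j => (z j, s j)) =
        wave (annProd l h ψ) n fun j => (z j, s j) := by
  induction N generalizing n with
  | zero =>
    refine Filter.Eventually.of_forall fun z => ?_
    rw [Measure.volume_pi_eq_dirac (α := fun _ : Fin 0 => Space d)]
    simp [annihProd_zero, annProd]
  | succ N ih =>
    have h0 := (isSquareIntegrable_wave ψ).memLp_annihProd (fun j => l j.succ) (Fin.cons (l 0) s)
    have h1 := MemLp.ae_memLp_slice (h0.comp_measurePreserving measurePreserving_consTail)
    have h2 := Measure.ae_ae_of_ae_prod (measurePreserving_snocHead.quasiMeasurePreserving.ae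
      (ih (fun j => l j.succ) (fun j => h j.succ) (Fin.cons (l 0) s)))
    have h3 := wave_ann_ae (l 0) (h 0) (annProd (fun j => l j.succ) (fun j => h j.succ) ψ) s
    have hp : MemLp (fun p : Space d × (Fin N → Space d) =>
        starRingEnd ℂ (h 0 p.1 * ∏ j : Fin N, h j.succ (p.2 j))) 2 (volume.prod volume) := by
      have := (MemLp.smul_prod (memLp_prod fun j : Fin N => h j.succ) (Lp.memLp (h 0))).star
      simp only [smul_eq_mul, mul_comm] at this ⊢
      exact this
    filter_upwards [h1, h2, h3] with z h1 h2 h3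
    rw [annProd_succ]
    refine Eq.trans ?_ h3.symm
    have hi := (MemLp.integrable_smul_two hp h1).const_mul (Real.sqrt (n + 1) : ℂ)
    have e : ∀ (x : Space d) (y : Fin N → Space d),
        starRingEnd ℂ (∏ j, h j ((Fin.cons x y : Fin (N + 1) → Space d) j)) *
          annihProd (fun j => ((Fin.cons x y : Fin (N + 1) → Space d) j, l j)) (wave ψ) n
            (fun j => (z j, s j)) = (Real.sqrt (n + 1) : ℂ) *
        (starRingEnd ℂ (h 0 x * ∏ j : Fin N, h j.succ (y j)) •
          annihProd (fun j => (y j, l j.succ)) (wave ψ) (n + 1) fun j =>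
            ((Fin.cons x z : Fin (n + 1) → Space d) j,
              (Fin.cons (l 0) s : Fin (n + 1) → Label k) j)) := by
      intro x y
      rw [annihProd_succ_apply, Fin.prod_univ_succ]
      simp only [Fin.cons_zero, Fin.cons_succ, smul_eq_mul]
      ring
    rw [integral_cons]
    · simp only [e, integral_const_mul]
      congr 1
      refine integral_congr_ae ?_
      filter_upwards [h2] with x h2
      rw [← h2, ← integral_const_mul]
      simp only [map_mul, smul_eq_mul, mul_assoc]
    · simp only [e]
      exact hi

end FreeFermions

end

noncomputable section

namespace FreeFermions

variable {d k n N : ℕ}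

/-! ### Wick monomials of product kernels -/

theorem wave_eq_zero {ψ : Fock d k} (h : ψ.component n = 0) : wave ψ n = 0 := by
  funext X
  have e : ∀ z, ((0 : Sector d k n) : EuclideanSpace ℝ (Fin n × Fin d) → _) z = 0 := fun z =>
    AEEqFun.coeFn_zero_eq (μ := (volume : Measure (EuclideanSpace ℝ (Fin n × Fin d)))) (x := z)
  simp only [wave, h, Submodule.coe_zero, e]
  rfl

theorem annihProd_eq_zero {M : ℕ} {Ψ : WaveSeq d k} (h : ∀ m, M ≤ m → Ψ m = 0)
    (Y : Fin N → Pt d k) : ∀ m, M ≤ m → annihProd Y Ψ m = 0 := by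
  unfold annihProd
  induction List.ofFn Y with
  | nil => exact h
  | cons X l ih =>
    intro m hm
    funext Z
    simp [annih, ih (m + 1) (by omega)]

theorem component_annProd_eq_zero {M : ℕ} {ψ : Fock d k}
    (h : ∀ m, M ≤ m → ψ.component m = 0) (l : Fin N → Label k) (u : Fin N → OneParticle d) :
    ∀ m, M ≤ m → (annProd l u ψ).component m = 0 := by
  induction N with
  | zero => simpa [annProd] using h
  | succ N ih =>
    intro m hm
    rw [annProd_succ, mul_apply_eq_comp, component_ann, ih _ _ (m + 1) (by omega), map_zero]

theorem IsFiniteParticle.exists_bound {ψ : Fock d k} (h : IsFiniteParticle ψ) :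
    ∃ M, ∀ m, M ≤ m → ψ.component m = 0 := by
  obtain ⟨M, hM⟩ := h.bddAbove
  refine ⟨M + 1, fun m hm => ?_⟩
  by_contra h0
  have := hM h0
  omega

theorem waveInner_eq_sum {M : ℕ} {Φ Ψ : WaveSeq d k} (h : ∀ m, M ≤ m → Ψ m = 0) :
    waveInner Φ Ψ = ∑ n ∈ Finset.range M, ∑ s : Fin n → Label k,
      ∫ x : Fin n → EuclideanSpace ℝ (Fin d),
        starRingEnd ℂ (Φ n fun j => (x j, s j)) * Ψ n fun j => (x j, s j) := by
  refine tsum_eq_sum fun n hn => ?_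
  rw [h n (by simpa using hn)]
  simp

theorem inner_eq_waveInner (φ ψ : Fock d k) : ⟪φ, ψ⟫ = waveInner (wave φ) (wave ψ) := by
  rw [Fock.inner_eq]
  refine tsum_congr fun n => ?_
  have h1 := L2.integrable_inner (𝕜 := ℂ) (φ.component n : Sector d k n)
    (ψ.component n : Sector d k n)
  have h2 := integral_map (μ := volume) (φ := coords (ι := Fin n) (d := d))
    measurePreserving_coords.measurable.aemeasurable
    (f := fun x => ⟪(φ.component n : Sector d k n) x, (ψ.component n : Sector d k n) x⟫)
    (by rw [measurePreserving_coords.map_eq]; exact h1.1)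
  rw [measurePreserving_coords.map_eq] at h2
  rw [Submodule.coe_inner, L2.inner_def, h2, ← integral_finsetSum]
  · refine integral_congr_ae (Filter.Eventually.of_forall fun z => ?_)
    simp only [PiLp.inner_apply]
    refine Finset.sum_congr rfl fun s _ => ?_
    rw [RCLike.inner_apply, mul_comm]
    rfl
  · intro s _
    exact MemLp.integrable_smul_two (isSquareIntegrable_wave φ n s).star
      (isSquareIntegrable_wave ψ n s)

/-- The reversal of the order of `N` points. -/
def revPos (d N : ℕ) : (Fin N → Space d) ≃ᵐ (Fin N → Space d) :=
  MeasurableEquiv.ofInvolutive (fun y j => y j.rev) (fun y => by simp) (by fun_prop)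

theorem measurePreserving_revPos : MeasurePreserving (revPos d N) volume volume := by
  refine ⟨(revPos d N).measurable, (Measure.pi_eq fun s hs => ?_).symm⟩
  have e : revPos d N ⁻¹' Set.univ.pi s = Set.univ.pi fun j => s j.rev := by
    ext y
    simp only [Set.mem_preimage, Set.mem_univ_pi]
    refine ⟨fun h j => ?_, fun h j => ?_⟩
    · have := h j.rev
      rwa [show revPos d N y j.rev = y j.rev.rev from rfl, Fin.rev_rev] at this
    · have := h j.rev
      rwa [Fin.rev_rev] at this
  rw [MeasurableEquiv.map_apply, e, volume_pi_pi]
  exact Equiv.prod_comp Fin.revPerm fun j => volume (s j)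

/-- The function `⟨a(X_N) ⋯ a(X_1) φ, a(Y_1) ⋯ a(Y_N) ψ⟩` of the positions. -/
def wickKernel (s s' : Fin N → Label k) (φ ψ : Fock d k)
    (p : (Fin N → Space d) × (Fin N → Space d)) : ℂ :=
  waveInner (annihProd (fun j => (p.1 j.rev, s j.rev)) (wave φ))
    (annihProd (fun j => (p.2 j, s' j)) (wave ψ))

theorem memLp_annihProd_rev (φ : Fock d k) (s : Fin N → Label k) (t : Fin n → Label k) :
    MemLp (fun p : (Fin n → Space d) × (Fin N → Space d) =>
      annihProd (fun j => (p.2 j.rev, s j.rev)) (wave φ) n fun j => (p.1 j, t j)) 2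
        (volume.prod volume) :=
  ((isSquareIntegrable_wave φ).memLp_annihProd (fun j => s j.rev) t).comp_measurePreserving
    ((MeasurePreserving.id _).prod measurePreserving_revPos)

theorem wickKernel_eq_sum {M : ℕ} {ψ : Fock d k} (h : ∀ m, M ≤ m → ψ.component m = 0)
    (s s' : Fin N → Label k) (φ : Fock d k) (p : (Fin N → Space d) × (Fin N → Space d)) :
    wickKernel s s' φ ψ p = ∑ n ∈ Finset.range M, ∑ t : Fin n → Label k,
      ∫ z : Fin n → Space d, starRingEnd ℂ (annihProd (fun j => (p.1 j.rev, s j.rev)) (wave φ) n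
        fun j => (z j, t j)) * annihProd (fun j => (p.2 j, s' j)) (wave ψ) n fun j => (z j, t j) :=
  waveInner_eq_sum (annihProd_eq_zero (fun m hm => wave_eq_zero (h m hm)) _)

/-- For a finite-particle vector the sum over n is finite, and each term is a partial scalar product
of square integrable functions. -/
theorem memLp_wickKernel {ψ : Fock d k} (hψ : IsFiniteParticle ψ) (s s' : Fin N → Label k)
    (φ : Fock d k) : MemLp (wickKernel s s' φ ψ) 2 (volume.prod volume) := by
  obtain ⟨M, hM⟩ := hψ.exists_bound
  rw [funext (wickKernel_eq_sum hM s s' φ)]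
  exact memLp_finsetSum _ fun n _ => memLp_finsetSum _ fun t _ =>
    MemLp.integral_conj_mul (memLp_annihProd_rev φ s t)
      ((isSquareIntegrable_wave ψ).memLp_annihProd s' t)

theorem integrable_wickTerm (φ ψ : Fock d k) (s s' : Fin N → Label k) (t : Fin n → Label k)
    (u h : Fin N → OneParticle d) :
    Integrable (fun p : (Fin N → Space d) × (Fin N → Space d) => ((∏ j, u j (p.1 j)) *
      starRingEnd ℂ (∏ j, h j (p.2 j))) * ∫ z : Fin n → Space d,
        starRingEnd ℂ (annihProd (fun j => (p.1 j.rev, s j.rev)) (wave φ) n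
          fun j => (z j, t j)) * annihProd (fun j => (p.2 j, s' j)) (wave ψ) n
            fun j => (z j, t j)) (volume.prod volume) := by
  have hh : MemLp (fun y : Fin N → Space d => starRingEnd ℂ (∏ j, h j (y j))) 2 volume :=
    (memLp_prod h).star
  exact integrable_mul_integral_conj_mul
    (F := fun p : (Fin n → Space d) × (Fin N → Space d) =>
      annihProd (fun j => (p.2 j.rev, s j.rev)) (wave φ) n fun j => (p.1 j, t j))
    (G := fun p : (Fin n → Space d) × (Fin N → Space d) =>
      annihProd (fun j => (p.2 j, s' j)) (wave ψ) n fun j => (p.1 j, t j))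
    (u := fun x : Fin N → Space d => ∏ j, u j (x j))
    (v := fun y : Fin N → Space d => starRingEnd ℂ (∏ j, h j (y j)))
    (memLp_annihProd_rev φ s t) ((isSquareIntegrable_wave ψ).memLp_annihProd s' t) (memLp_prod u) hh

theorem integral_wickTerm (φ ψ : Fock d k) (s s' : Fin N → Label k) (t : Fin n → Label k)
    (u h : Fin N → OneParticle d) :
    ∫ p : (Fin N → Space d) × (Fin N → Space d), ((∏ j, u j (p.1 j)) *
      starRingEnd ℂ (∏ j, h j (p.2 j))) * (∫ z : Fin n → Space d,
        starRingEnd ℂ (annihProd (fun j => (p.1 j.rev, s j.rev)) (wave φ) n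
          fun j => (z j, t j)) * annihProd (fun j => (p.2 j, s' j)) (wave ψ) n
            fun j => (z j, t j)) ∂(volume.prod volume) =
      ∫ z : Fin n → Space d, starRingEnd ℂ (wave (annProd (fun j => s j.rev)
        (fun j => u j.rev) φ) n fun j => (z j, t j)) *
          wave (annProd s' h ψ) n fun j => (z j, t j) := by
  refine (integral_mul_integral_conj_mul (memLp_annihProd_rev φ s t)
    ((isSquareIntegrable_wave ψ).memLp_annihProd s' t) (memLp_prod u) (memLp_prod h).star).trans ?_
  refine integral_congr_ae ?_
  filter_upwards [integral_annihProd_wave (fun j => s j.rev) (fun j => u j.rev) φ t,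
    integral_annihProd_wave s' h ψ t] with z h1 h2
  rw [← h1, ← h2]
  congr 2
  rw [← measurePreserving_revPos.integral_comp']
  refine integral_congr_ae (Filter.Eventually.of_forall fun x => ?_)
  beta_reduce
  congr 2
  · have e := Equiv.prod_comp Fin.revPerm fun j => u j (x j.rev)
    simp only [Fin.revPerm_apply, Fin.rev_rev] at e
    exact e.symm
  · funext j
    rw [show revPos d N x j.rev = x j.rev.rev from rfl, Fin.rev_rev]

/-- For a product kernel the smearing can be done separately on both sides of the scalar product.
The order on the left is reversed because those operators come from the adjoint of a*(X_1)⋯a*(X_N).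
-/
theorem integral_prod_mul_wickKernel {ψ : Fock d k} (hψ : IsFiniteParticle ψ)
    (s s' : Fin N → Label k) (φ : Fock d k) (u h : Fin N → OneParticle d) :
    ∫ p : (Fin N → Space d) × (Fin N → Space d), ((∏ j, u j (p.1 j)) *
      starRingEnd ℂ (∏ j, h j (p.2 j))) * wickKernel s s' φ ψ p ∂(volume.prod volume) =
      ⟪annProd (fun j => s j.rev) (fun j => u j.rev) φ, annProd s' h ψ⟫ := by
  obtain ⟨M, hM⟩ := hψ.exists_bound
  rw [inner_eq_waveInner, waveInner_eq_sum
    (fun m hm => wave_eq_zero (component_annProd_eq_zero hM s' h m hm))]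
  simp only [wickKernel_eq_sum hM, Finset.mul_sum]
  rw [integral_finsetSum _ fun n _ => integrable_finsetSum _ fun t _ =>
    integrable_wickTerm φ ψ s s' t u h]
  refine Finset.sum_congr rfl fun n _ => ?_
  rw [integral_finsetSum _ fun t _ => integrable_wickTerm φ ψ s s' t u h]
  exact Finset.sum_congr rfl fun t _ => integral_wickTerm φ ψ s s' t u h

theorem star_annProd_rev (l : Fin N → Label k) (u : Fin N → OneParticle d) :
    ContinuousLinearMap.adjoint (annProd (fun j => l j.rev) fun j => u j.rev) =
      (List.ofFn fun j => cre (l j) (u j)).prod := by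
  have h1 : ∀ L : List (Op d k), ContinuousLinearMap.adjoint L.prod =
      (L.map ContinuousLinearMap.adjoint).reverse.prod := by
    intro L
    induction L with
    | nil => exact star_one (Op d k)
    | cons A L ih =>
      rw [List.prod_cons, List.map_cons, List.reverse_cons, List.prod_append, ← ih,
        List.prod_singleton]
      exact star_mul A L.prod
  have h2 : ∀ f : Fin N → Op d k, (List.ofFn fun j => f j.rev).reverse = List.ofFn f := by
    intro f
    refine List.ext_getElem (by simp) fun i hi hi' => ?_
    simp only [List.getElem_reverse, List.getElem_ofFn, List.length_ofFn]
    congr 1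
    ext
    simp only [List.length_ofFn, Fin.val_rev] at hi' ⊢
    omega
  rw [annProd, h1, List.map_ofFn, ← h2 fun j => cre (l j) (u j)]
  rfl

/-- A matrix element is an L² pairing of the kernel, hence a continuous functional of it, and
L²-convergent expansions may be inserted term by term. -/
theorem exists_wickKernel_functional {ψ : Fock d k} (hψ : IsFiniteParticle ψ)
    (s s' : Fin N → Label k) (φ : Fock d k) :
    ∃ L : KernelFun d N →L[ℂ] ℂ, ∀ f : KernelFun d N,
      Integrable (fun p : (Fin N → Space d) × (Fin N → Space d) =>
        f (coords (Sum.elim p.1 p.2)) * wickKernel s s' φ ψ p) (volume.prod volume) ∧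
      L f = ∫ p : (Fin N → Space d) × (Fin N → Space d),
        f (coords (Sum.elim p.1 p.2)) * wickKernel s s' φ ψ p ∂(volume.prod volume) := by
  have hK := (memLp_wickKernel hψ s s' φ).star
  let c := measurePreserving_coords_sumElim (ι := Fin N) (ι' := Fin N) (d := d)
  refine ⟨innerSL ℂ hK.toLp ∘L (Lp.compMeasurePreservingₗᵢ ℂ _ c).toContinuousLinearMap,
    fun f => ⟨?_, ?_⟩⟩
  · exact MemLp.integrable_smul_two ((Lp.memLp f).comp_measurePreserving c)
      (memLp_wickKernel hψ s s' φ)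
  · change ⟪hK.toLp, Lp.compMeasurePreserving _ c f⟫ = _
    rw [L2.inner_def]
    refine integral_congr_ae ?_
    filter_upwards [hK.coeFn_toLp, Lp.coeFn_compMeasurePreserving f c] with p h1 h2
    rw [h1, h2, RCLike.inner_apply]
    simp

end FreeFermions

end

noncomputable section

namespace FreeFermions

variable {d k N : ℕ}

/-! ### Expansion of Wick monomials in Hermite functions -/

/-- The one-particle Hermite function that belongs to one of the particles of a Hermite function
of several particles. -/
def hermLeg {ι : Type} (y : EuclideanSpace ℝ (ι × Fin d)) (n : ι × Fin d → ℕ) (q : ι) :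
    OneParticle d :=
  hermLp (WithLp.toLp 2 fun i => y (q, i)) fun i => n (q, i)

theorem ae_hermLeg {ι : Type} [Fintype ι] (y : EuclideanSpace ℝ (ι × Fin d))
    (n : ι × Fin d → ℕ) (f : Fin N → ι) :
    ∀ᵐ x : Fin N → Space d, ∏ j, hermLeg y n (f j) (x j) =
      ((∏ j, ∏ i, hermFun (n (f j, i)) (x j i - y (f j, i)) : ℝ) : ℂ) := by
  have h : ∀ j : Fin N, ∀ᵐ x : Fin N → Space d, hermLeg y n (f j) (x j) =
      herm (WithLp.toLp 2 fun i => y (f j, i)) (fun i => n (f j, i)) (x j) := by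
    intro j
    have h0 : ∀ᵐ x : Space d, hermLeg y n (f j) x =
        herm (WithLp.toLp 2 fun i => y (f j, i)) (fun i => n (f j, i)) x := hermLp_ae _ _
    exact (Measure.quasiMeasurePreserving_eval (α := fun _ : Fin N => Space d)
      (fun _ => volume) j).ae h0
  filter_upwards [ae_all_iff.2 h] with x hx
  rw [Complex.ofReal_prod]
  refine Finset.prod_congr rfl fun j _ => ?_
  rw [hx j, herm_apply, Complex.ofReal_prod]

/-- Hermite functions factorise over the particles. They are real, so the conjugate needed for the
antilinear a(h) may be inserted. -/
theorem hermLp_coords_ae (y : EuclideanSpace ℝ ((Fin N ⊕ Fin N) × Fin d))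
    (n : (Fin N ⊕ Fin N) × Fin d → ℕ) :
    ∀ᵐ p : (Fin N → Space d) × (Fin N → Space d) ∂(volume.prod volume),
      hermLp y n (coords (Sum.elim p.1 p.2)) = (∏ j, hermLeg y n (Sum.inl j) (p.1 j)) *
        starRingEnd ℂ (∏ j, hermLeg y n (Sum.inr j) (p.2 j)) := by
  filter_upwards [measurePreserving_coords_sumElim.quasiMeasurePreserving.ae (hermLp_ae y n),
    Measure.quasiMeasurePreserving_fst.ae (ae_hermLeg y n (Sum.inl : Fin N → _)),
    Measure.quasiMeasurePreserving_snd.ae (ae_hermLeg y n (Sum.inr : Fin N → _))] with p h1 h2 h3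
  rw [h1, h2, h3, Complex.conj_ofReal, herm_apply, ← Complex.ofReal_mul, ← Complex.ofReal_prod,
    Fintype.prod_prod_type, Fintype.prod_sum_type]
  rfl

/-- The Wick monomial whose kernel is a Hermite function. -/
def hermOp (s s' : Fin N → Label k) (y : EuclideanSpace ℝ ((Fin N ⊕ Fin N) × Fin d))
    (n : (Fin N ⊕ Fin N) × Fin d → ℕ) : Op d k :=
  (List.ofFn fun j => cre (s j) (hermLeg y n (Sum.inl j))).prod *
    annProd s' fun j => hermLeg y n (Sum.inr j)

theorem integral_hermLp_mul_wickKernel {ψ : Fock d k} (hψ : IsFiniteParticle ψ)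
    (s s' : Fin N → Label k) (φ : Fock d k) (y : EuclideanSpace ℝ ((Fin N ⊕ Fin N) × Fin d))
    (n : (Fin N ⊕ Fin N) × Fin d → ℕ) :
    ∫ p : (Fin N → Space d) × (Fin N → Space d), hermLp y n (coords (Sum.elim p.1 p.2)) *
      wickKernel s s' φ ψ p ∂(volume.prod volume) = ⟪φ, hermOp s s' y n ψ⟫ := by
  rw [hermOp, ← star_annProd_rev, mul_apply_eq_comp, ContinuousLinearMap.adjoint_inner_right,
    ← integral_prod_mul_wickKernel hψ s s' φ (fun j => hermLeg y n (Sum.inl j))]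
  refine integral_congr_ae ?_
  filter_upwards [hermLp_coords_ae y n] with p hp
  rw [hp]

/-- The operator series and the Hermite expansion of the kernel in L² give the same series for each
matrix element. -/
theorem isWickMonomial_of_hasSum {w : (Fin N → Label k) → (Fin N → Label k) → KernelFun d N}
    {y : (Fin N → Label k) → (Fin N → Label k) → EuclideanSpace ℝ ((Fin N ⊕ Fin N) × Fin d)}
    {T : (Fin N → Label k) → (Fin N → Label k) → Op d k}
    (hT : ∀ s s', HasSum (fun n => ⟪hermLp (y s s') n, w s s'⟫ • hermOp s s' (y s s') n)
      (T s s')) : IsWickMonomial w (∑ s, ∑ s', T s s') := by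
  intro φ ψ _ hψ
  simp only [sum_apply, inner_sum, wickForm]
  refine Finset.sum_congr rfl fun s _ => Finset.sum_congr rfl fun s' _ => ?_
  obtain ⟨L, hL⟩ := exists_wickKernel_functional hψ s s' φ
  have h1 : HasSum (fun n => ⟪hermLp (y s s') n, w s s'⟫ • ⟪φ, hermOp s s' (y s s') n ψ⟫)
      ⟪φ, T s s' ψ⟫ := by
    have := (hT s s').mapL ((innerSL ℂ φ) ∘L (ContinuousLinearMap.apply ℂ (Fock d k) ψ))
    simpa using this
  have h2 := L.hasSum ((hermBasis (y s s')).hasSum_repr (w s s'))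
  have h3 : ∀ n, L ((hermBasis (y s s')).repr (w s s') n • hermBasis (y s s') n) =
      ⟪hermLp (y s s') n, w s s'⟫ • ⟪φ, hermOp s s' (y s s') n ψ⟫ := by
    intro n
    have e : (hermBasis (y s s')) n = hermLp (y s s') n := by
      simp [hermBasis]
    rw [map_smul, HilbertBasis.repr_apply_apply, e, (hL _).2, integral_hermLp_mul_wickKernel hψ]
  simp only [h3] at h2
  rw [h1.unique h2, (hL _).2, integral_prod _ (hL _).1]
  rfl

end FreeFermions

end

noncomputable section

namespace FreeFermions

variable {d k : ℕ}

/-! ### The fields of the Hermite functions -/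

/-- The index of a creation (`true`) or annihilation (`false`) operator of a particle in the state
of a Hermite function: its label, and the centre and the degree of the Hermite function. -/
abbrev Leg (d k : ℕ) : Type := Bool × Label k × Space d × (Fin d → ℕ)

/-- The Hermite function of a leg. -/
def Leg.state (x : Leg d k) : OneParticle d := hermLp x.2.2.1 x.2.2.2

theorem Leg.norm_state (x : Leg d k) : ‖x.state‖ = 1 := (orthonormal_hermLp x.2.2.1).1 x.2.2.2

/-- The creation and annihilation operators of the Hermite functions at the times `σ t`. -/
def legField (σ : ℝ) (x : Leg d k) (t : ℝ) : Op d k :=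
  bif x.1 then cre x.2.1 (oneEvol (σ * t) x.state) else ann x.2.1 (oneEvol (σ * t) x.state)

/-- The scalar product of the states of two legs. -/
def legInner (σ : ℝ) (x y : Leg d k) (t s : ℝ) : ℂ :=
  if y.2.1 = x.2.1 then ⟪oneEvol (σ * s) y.state, oneEvol (σ * t) x.state⟫ else 0

/-- The anticommutators of the fields. -/
def legComm (σ : ℝ) (x y : Leg d k) (t s : ℝ) : ℂ :=
  bif x.1 then (bif y.1 then 0 else legInner σ x y t s)
  else (bif y.1 then starRingEnd ℂ (legInner σ x y t s) else 0)

theorem legField_car (σ : ℝ) (x y : Leg d k) (t s : ℝ) :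
    legField σ x t * legField σ y s + legField σ y s * legField σ x t =
      legComm σ x y t s • (1 : Op d k) := by
  obtain ⟨bx, lx, cx, nx⟩ := x
  obtain ⟨bt, ly, cy, ny⟩ := y
  cases bx <;> cases bt
  · simp only [legField, legComm, cond_false, zero_smul]
    exact ann_ann _ _ _ _
  · simp only [legField, legComm, legInner, cond_false, cond_true]
    rw [ann_cre]
    simp only [eq_comm (a := ly), apply_ite (starRingEnd ℂ), map_zero, inner_conj_symm]
  · simp only [legField, legComm, legInner, cond_false, cond_true]
    rw [add_comm, ann_cre]
  · simp only [legField, legComm, cond_true, zero_smul]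
    exact cre_cre _ _ _ _

theorem measurable_legInner (σ : ℝ) (x y : Leg d k) (s : ℝ) :
    Measurable fun t => legInner σ x y t s := by
  unfold legInner
  split_ifs
  · exact (continuous_const.inner ((continuous_oneEvol x.state).comp
      (continuous_const.mul continuous_id))).measurable
  · exact measurable_const

/-- By unitarity only the time difference matters. Conjugation, distinct labels and fields of equal
type can only preserve or lower the modulus. -/
theorem enorm_legComm_le (σ : ℝ) (x y : Leg d k) (t s : ℝ) :
    ‖legComm σ x y t s‖ₑ ≤ ‖(⟪y.state, oneEvol (σ * (t - s)) x.state⟫ : ℂ)‖ₑ := by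
  have h : ‖legInner σ x y t s‖ₑ ≤ ‖(⟪y.state, oneEvol (σ * (t - s)) x.state⟫ : ℂ)‖ₑ := by
    unfold legInner
    split_ifs
    · rw [inner_oneEvol, ← mul_sub]
    · simp
  unfold legComm
  cases x.1 <;> cases y.1
  · simp
  · simpa using h
  · simpa using h
  · simp

/-- The fields of the Hermite functions, for the free dynamics in the direction of time given by
the sign `σ`. -/
def legSystem (k : ℕ) (hd : 3 ≤ d) {σ : ℝ} (hσ : |σ| = 1) : FieldSystem (Op d k) (Leg d k) where
  ψ := legField σ
  c := legComm σ
  b x := ENNReal.ofReal (hermWeight x.2.2.2)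
  κ := ENNReal.ofReal (Real.pi * (d / (d - 2)))
  car := legField_car σ
  norm_one_le := ContinuousLinearMap.norm_id_le
  norm_le x t := by
    have h : ‖oneEvol (σ * t) x.state‖ = 1 := by rw [norm_oneEvol, x.norm_state]
    unfold legField
    cases x.1
    · exact (norm_ann_le _ _).trans h.le
    · exact (norm_cre_le _ _).trans h.le
  continuous_ψ x := by
    have h : Continuous fun t => oneEvol (σ * t) x.state :=
      (continuous_oneEvol x.state).comp (continuous_const.mul continuous_id)
    unfold legField
    cases x.1
    · exact (continuous_ann _).comp h
    · exact (continuous_cre _).comp h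
  measurable_c x y s := by
    have h := measurable_legInner σ x y s
    unfold legComm
    cases x.1 <;> cases y.1
    · exact measurable_const
    · exact Complex.continuous_conj.measurable.comp h
    · exact h
    · exact measurable_const
  one_le_b x := by
    rw [← ENNReal.ofReal_one]
    exact ENNReal.ofReal_le_ofReal (one_le_hermWeight _)
  lintegral_c_le x y s := by
    refine (lintegral_mono fun t => enorm_legComm_le σ x y t s).trans ?_
    rw [mul_assoc, mul_comm (ENNReal.ofReal (hermWeight x.2.2.2)), ← mul_assoc]
    exact lintegral_inner_hermLp_le hd _ _ _ _ s σ hσ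

/-! ### Expansion in Hermite functions -/

/-- A choice of centres for all the kernels of a family. -/
abbrev Centres (d k : ℕ) : Type := (N : ℕ+) → (Fin N → Label k) → (Fin N → Label k) →
  EuclideanSpace ℝ ((Fin N ⊕ Fin N) × Fin d)

/-- The norm of a family of kernels with given centres of the weights. -/
def centredNorm (Y : Centres d k) (w : Kernels d k) : ℝ≥0∞ :=
  ∑' N : ℕ+, ((N : ℕ) : ℝ≥0∞) * 2 ^ ((d + 2) * (N : ℕ)) *
    ∑ s : Fin N → Label k, ∑ s' : Fin N → Label k, sobolevNorm (Y N s s') (w N s s')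

/-- The index of a term in the expansion of a family of kernels in Hermite functions. -/
abbrev HermIndex (d k : ℕ) : Type :=
  Σ N : ℕ+, ((Fin N → Label k) × (Fin N → Label k)) × ((Fin N ⊕ Fin N) × Fin d → ℕ)

/-- The coefficients of the expansion of a family of kernels in Hermite functions. -/
def hermCoeff (Y : Centres d k) (w : Kernels d k) (i : HermIndex d k) : ℂ :=
  ⟪hermLp (Y i.1 i.2.1.1 i.2.1.2) i.2.2, w i.1 i.2.1.1 i.2.1.2⟫

/-- The Wick monomials of the Hermite functions. -/
def hermMono (Y : Centres d k) (i : HermIndex d k) : Op d k :=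
  hermOp i.2.1.1 i.2.1.2 (Y i.1 i.2.1.1 i.2.1.2) i.2.2

/-- The legs of a Wick monomial. -/
def hermLegs (Y : Centres d k) (i : HermIndex d k) : List (Leg d k) :=
  (List.ofFn fun j => (true, i.2.1.1 j, WithLp.toLp 2 fun q =>
    Y i.1 i.2.1.1 i.2.1.2 (Sum.inl j, q), fun q => i.2.2 (Sum.inl j, q))) ++
  List.ofFn fun j => (false, i.2.1.2 j, WithLp.toLp 2 fun q =>
    Y i.1 i.2.1.1 i.2.1.2 (Sum.inr j, q), fun q => i.2.2 (Sum.inr j, q))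

theorem length_hermLegs (Y : Centres d k) (i : HermIndex d k) :
    (hermLegs Y i).length = 2 * (i.1 : ℕ) := by
  simp [hermLegs, two_mul]

theorem interactionPicture_list_prod (L : List (Op d k)) (t : ℝ) :
    interactionPicture L.prod t = (L.map fun A => interactionPicture A t).prod := by
  induction L with
  | nil => exact interactionPicture_one t
  | cons A L ih => rw [List.prod_cons, interactionPicture_mul, ih, List.map_cons, List.prod_cons]

variable (hd : 3 ≤ d) {σ : ℝ} (hσ : |σ| = 1)

theorem monoAt_hermLegs (Y : Centres d k) (i : HermIndex d k) (t : ℝ) :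
    (legSystem k hd hσ).monoAt (hermLegs Y i) t = interactionPicture (hermMono Y i) (σ * t) := by
  rw [hermMono, hermOp, annProd, interactionPicture_mul, interactionPicture_list_prod,
    interactionPicture_list_prod, FieldSystem.monoAt, hermLegs, List.map_append,
    FieldSystem.mono_append]
  simp only [FieldSystem.mono, List.map_ofFn]
  exact congrArg₂ (· * ·)
    (congrArg (fun f => (List.ofFn f).prod) (funext fun j => (interactionPicture_cre _ _ _).symm))
    (congrArg (fun f => (List.ofFn f).prod) (funext fun j => (interactionPicture_ann _ _ _).symm))

theorem weight_hermLegs (Y : Centres d k) (i : HermIndex d k) :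
    (legSystem k hd hσ).weight (hermLegs Y i) =
      2 ^ (2 * (i.1 : ℕ)) * ENNReal.ofReal (hermWeight i.2.2) := by
  have e : hermWeight i.2.2 = (∏ j, hermWeight fun q => i.2.2 (Sum.inl j, q)) *
      ∏ j, hermWeight fun q => i.2.2 (Sum.inr j, q) := by
    simp only [hermWeight]
    rw [Fintype.prod_prod_type, Fintype.prod_sum_type]
  have h1 : ∀ (n : Fin i.1 → Fin d → ℕ), ∏ j, (2 * ENNReal.ofReal (hermWeight (n j))) =
      2 ^ (i.1 : ℕ) * ENNReal.ofReal (∏ j, hermWeight (n j)) := by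
    intro n
    rw [Finset.prod_mul_distrib, Finset.prod_const, Finset.card_univ, Fintype.card_fin,
      ENNReal.ofReal_prod_of_nonneg fun j _ => (hermWeight_pos _).le]
  rw [FieldSystem.weight, hermLegs, List.map_append, List.prod_append, List.map_ofFn,
    List.map_ofFn, List.prod_ofFn, List.prod_ofFn, e, ENNReal.ofReal_mul
      (Finset.prod_nonneg fun j _ => (hermWeight_pos _).le), two_mul, pow_add]
  refine (congrArg₂ (· * ·) (h1 fun j q => i.2.2 (Sum.inl j, q))
    (h1 fun j q => i.2.2 (Sum.inr j, q))).trans ?_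
  ring

/-- The bound of the coefficients for M = 2dN variables contributes 2^{dN}; with N 2^{2N} this is
the factor N 2^{(d+2)N} of the norm. -/
theorem tsum_hermCoeff_le (Y : Centres d k) (w : Kernels d k) :
    ∑' i, ‖hermCoeff Y w i‖ₑ * ((i.1 : ℕ) * (2 ^ (2 * (i.1 : ℕ)) *
      ENNReal.ofReal (hermWeight i.2.2))) ≤ centredNorm Y w := by
  rw [ENNReal.tsum_sigma', centredNorm]
  refine ENNReal.tsum_le_tsum fun N => ?_
  rw [ENNReal.tsum_prod', tsum_fintype, Fintype.sum_prod_type, Finset.mul_sum]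
  refine Finset.sum_le_sum fun s _ => ?_
  rw [Finset.mul_sum]
  refine Finset.sum_le_sum fun s' _ => ?_
  have e : (2 : ℝ≥0∞) ^ ((Fintype.card ((Fin N ⊕ Fin N) × Fin d) : ℝ) / 2) =
      2 ^ (d * (N : ℕ)) := by
    rw [← ENNReal.rpow_natCast]
    congr 1
    simp only [Fintype.card_prod, Fintype.card_sum, Fintype.card_fin]
    push_cast
    ring
  calc _ = ((N : ℕ) : ℝ≥0∞) * 2 ^ (2 * (N : ℕ)) * ∑' n, ‖(⟪hermLp (Y N s s') n, w N s s'⟫ : ℂ)‖ₑ *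
        ENNReal.ofReal (hermWeight n) := by
        rw [← ENNReal.tsum_mul_left]
        refine tsum_congr fun n => ?_
        simp only [hermCoeff]
        ring
    _ ≤ ((N : ℕ) : ℝ≥0∞) * 2 ^ (2 * (N : ℕ)) *
        (2 ^ (d * (N : ℕ)) * sobolevNorm (Y N s s') (w N s s')) := by
        gcongr
        rw [← e]
        exact tsum_coeff_le _ _
    _ = _ := by
        rw [add_mul, pow_add]
        ring

theorem tsum_hermCoeff_length_le (Y : Centres d k) (w : Kernels d k) :
    ∑' i, ‖hermCoeff Y w i‖ₑ * ((hermLegs Y i).length *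
      (legSystem k hd hσ).weight (hermLegs Y i)) ≤ 2 * centredNorm Y w := by
  refine le_trans (le_of_eq ?_) (mul_le_mul_right (tsum_hermCoeff_le Y w) 2)
  rw [← ENNReal.tsum_mul_left]
  refine tsum_congr fun i => ?_
  rw [length_hermLegs, weight_hermLegs]
  push_cast
  ring

theorem tsum_hermCoeff_weight_le (Y : Centres d k) (w : Kernels d k) :
    ∑' i, ‖hermCoeff Y w i‖ₑ * (legSystem k hd hσ).weight (hermLegs Y i) ≤ centredNorm Y w := by
  refine (ENNReal.tsum_le_tsum fun i => ?_).trans (tsum_hermCoeff_le Y w)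
  rw [weight_hermLegs]
  refine mul_le_mul_right (le_mul_of_one_le_left bot_le ?_) _
  exact_mod_cast Nat.succ_le_of_lt i.1.pos

theorem tsum_enorm_hermCoeff_le (Y : Centres d k) (w : Kernels d k) :
    ∑' i, ‖hermCoeff Y w i‖ₑ ≤ centredNorm Y w := by
  refine (ENNReal.tsum_le_tsum fun i => ?_).trans (tsum_hermCoeff_le Y w)
  refine le_mul_of_one_le_right bot_le ?_
  have h1 : (1 : ℝ≥0∞) ≤ ((i.1 : ℕ) : ℝ≥0∞) := by exact_mod_cast Nat.succ_le_of_lt i.1.pos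
  have h2 : (1 : ℝ≥0∞) ≤ 2 ^ (2 * (i.1 : ℕ)) := one_le_pow₀ one_le_two
  have h3 : (1 : ℝ≥0∞) ≤ ENNReal.ofReal (hermWeight i.2.2) := by
    rw [← ENNReal.ofReal_one]
    exact ENNReal.ofReal_le_ofReal (one_le_hermWeight _)
  exact one_le_mul h1 (one_le_mul h2 h3)

end FreeFermions

end

noncomputable section

namespace FreeFermions

variable {d k : ℕ}

/-! ### Second quantization of kernels -/

theorem IsWickMonomial.unique {N : ℕ} {w : (Fin N → Label k) → (Fin N → Label k) → KernelFun d N}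
    {S T : Op d k} (hS : IsWickMonomial w S) (hT : IsWickMonomial w T) : S = T :=
  Fock.op_ext fun φ ψ hφ hψ => (hS φ ψ hφ hψ).trans (hT φ ψ hφ hψ).symm

theorem IsSecondQuantization.unique {w : Kernels d k} {V W : Op d k}
    (hV : IsSecondQuantization w V) (hW : IsSecondQuantization w W) : V = W := by
  obtain ⟨S, hS, hSV⟩ := hV
  obtain ⟨T, hT, hTW⟩ := hW
  have e : S = T := funext fun N => (hS N).unique (hT N)
  subst e
  exact hSV.unique hTW

theorem summable_norm_hermCoeff {Y : Centres d k} {w : Kernels d k} (h : centredNorm Y w < ∞) :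
    Summable fun i => ‖hermCoeff Y w i‖ :=
  tsum_enorm_ne_top_iff_summable_norm.1 ((tsum_enorm_hermCoeff_le Y w).trans_lt h).ne

theorem norm_hermMono_le (Y : Centres d k) (i : HermIndex d k) : ‖hermMono Y i‖ ≤ 1 := by
  have h1 : ∀ L : List (Op d k), (∀ A ∈ L, ‖A‖ ≤ 1) → ‖L.prod‖ ≤ 1 := by
    intro L hL
    induction L with
    | nil => exact ContinuousLinearMap.norm_id_le
    | cons A L ih =>
      rw [List.prod_cons]
      exact (norm_mul_le _ _).trans (mul_le_one₀ (hL A List.mem_cons_self) (norm_nonneg _)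
        (ih fun B hB => hL B (List.mem_cons_of_mem A hB)))
  refine (norm_mul_le _ _).trans (mul_le_one₀ (h1 _ fun A hA => ?_) (norm_nonneg _)
    (h1 _ fun A hA => ?_)) <;> obtain ⟨j, rfl⟩ := List.mem_ofFn.1 hA
  · exact (norm_cre_le _ _).trans ((orthonormal_hermLp _).1 _).le
  · exact (norm_ann_le _ _).trans ((orthonormal_hermLp _).1 _).le

theorem summable_hermMono {Y : Centres d k} {w : Kernels d k} (h : centredNorm Y w < ∞) :
    Summable fun i => hermCoeff Y w i • hermMono Y i := by
  refine Summable.of_norm_bounded (summable_norm_hermCoeff h) fun i => ?_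
  rw [norm_smul]
  exact mul_le_of_le_one_right (norm_nonneg _) (norm_hermMono_le Y i)

/-- Existence: the series converges absolutely, so it may be regrouped first by N and then by
labels. -/
theorem isSecondQuantization_tsum {Y : Centres d k} {w : Kernels d k} (h : centredNorm Y w < ∞) :
    IsSecondQuantization w (∑' i, hermCoeff Y w i • hermMono Y i) := by
  have hs := summable_hermMono h
  let f : HermIndex d k → Op d k := fun i => hermCoeff Y w i • hermMono Y i
  have hN : ∀ N : ℕ+, Summable fun q => f ⟨N, q⟩ := fun N =>
    hs.comp_injective sigma_mk_injective
  have hp : ∀ (N : ℕ+) (p : (Fin N → Label k) × (Fin N → Label k)),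
      Summable fun n => f ⟨N, p, n⟩ := fun N p =>
    (hN N).comp_injective (Prod.mk_right_injective p)
  refine ⟨fun N => ∑' q, f ⟨N, q⟩, fun N => ?_, hs.hasSum.sigma fun N => (hN N).hasSum⟩
  have e : ∑' q, f ⟨N, q⟩ = ∑ s, ∑ s', ∑' n, f ⟨N, (s, s'), n⟩ := by
    rw [((hN N).hasSum.prod_fiberwise fun p => (hp N p).hasSum).unique (hasSum_fintype _),
      Fintype.sum_prod_type]
  change IsWickMonomial (w N) (∑' q, f ⟨N, q⟩)
  rw [e]
  exact isWickMonomial_of_hasSum (y := Y N) fun s s' => (hp N (s, s')).hasSum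

theorem IsSecondQuantization.hasSum {Y : Centres d k} {w : Kernels d k} {W : Op d k}
    (hW : IsSecondQuantization w W) (h : centredNorm Y w < ∞) :
    HasSum (fun i => hermCoeff Y w i • hermMono Y i) W := by
  rw [hW.unique (isSecondQuantization_tsum h)]
  exact (summable_hermMono h).hasSum

theorem evol_zero : evol d k 0 = 1 := by
  ext1 ψ
  refine Fock.ext_component fun n => Subtype.ext ?_
  have h : ∀ g : Sector d k n, phaseOp d k n 0 g = g := by
    intro g
    apply Lp.ext
    filter_upwards [phaseOp_ae d k n 0 g] with ξ hξ
    rw [hξ]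
    simp [phaseFun]
  rw [evol_component, sectorEvol_eq, h]
  exact (Lp.fourierTransformₗᵢ (EuclideanSpace ℝ (Fin n × Fin d))
    (EuclideanSpace ℂ (Fin n → Label k))).symm_apply_apply _

theorem interactionPicture_zero (W : Op d k) : interactionPicture W 0 = W := by
  rw [interactionPicture_eq, neg_zero, evol_zero, one_mul, mul_one]

theorem IsSecondQuantization.hasSum_interactionPicture (hd : 3 ≤ d) {σ : ℝ} (hσ : |σ| = 1)
    {Y : Centres d k} {w : Kernels d k}
    {W : Op d k} (hW : IsSecondQuantization w W) (h : centredNorm Y w < ∞) (t : ℝ) :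
    HasSum (fun i => hermCoeff Y w i • (legSystem k hd hσ).monoAt (hermLegs Y i) t)
      (interactionPicture W (σ * t)) := by
  have := (interactionPictureL d k (σ * t)).hasSum (hW.hasSum h)
  simpa only [map_smul, interactionPictureL_apply, monoAt_hermLegs] using this

/-- Continuity in operator norm, which a general bounded W would not have: the series of
norm-continuous monomials converges uniformly in time. -/
theorem IsSecondQuantization.continuous_interactionPicture (hd : 3 ≤ d)
    {Y : Centres d k} {w : Kernels d k}
    {W : Op d k} (hW : IsSecondQuantization w W) (h : centredNorm Y w < ∞) :
    Continuous (interactionPicture W) := by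
  have e : interactionPicture W = fun t => ∑' i, hermCoeff Y w i •
      (legSystem k hd (abs_one (α := ℝ))).monoAt (hermLegs Y i) t := by
    funext t
    rw [(hW.hasSum_interactionPicture hd (abs_one (α := ℝ)) h t).tsum_eq, one_mul]
  rw [e]
  refine continuous_tsum (fun i => (continuous_const_smul (hermCoeff Y w i)).comp
    ((legSystem k hd _).continuous_monoAt (hermLegs Y i)))
    (summable_norm_hermCoeff h) fun i t => ?_
  rw [norm_smul]
  exact mul_le_of_le_one_right (norm_nonneg _) ((legSystem k hd _).norm_monoAt_le _ _)

/-- The tree expansion for the Hermite fields. A monomial of 2N fields is even, and its length 2N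
supplies the factor 2 in the smallness condition on Φ. -/
theorem adMass_interactionPicture_le (hd : 3 ≤ d) {σ : ℝ} (hσ : |σ| = 1)
    {Y Z : Centres d k} {w a : Kernels d k} {W A : Op d k}
    (hW : IsSecondQuantization w W) (hA : IsSecondQuantization a A) (hw : centredNorm Y w < ∞)
    (ha : centredNorm Z a < ∞) {Φ : ℝ≥0∞} (h0 : Φ ≠ 0) (h1 : Φ ≠ ∞)
    (hΦ : ENNReal.ofReal (Real.pi * (d / (d - 2))) * centredNorm Y w ≤ Φ) (m : ℕ) :
    adMass (fun t => interactionPicture W (σ * t)) m 0 A ≤ Φ ^ m * centredNorm Z a := by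
  have hV : Continuous fun t => interactionPicture W (σ * t) :=
    (hW.continuous_interactionPicture hd hw).comp (continuous_const.mul continuous_id)
  have hA0 : HasSum (fun i => hermCoeff Z a i • (legSystem k hd hσ).monoAt (hermLegs Z i) 0) A := by
    have := hA.hasSum_interactionPicture hd hσ ha 0
    rwa [mul_zero, interactionPicture_zero] at this
  refine ((legSystem k hd hσ).adMass_sum_le hV h0 h1 (w := hermCoeff Y w) (ℓ := hermLegs Y) ?_ ?_
    (hW.hasSum_interactionPicture hd hσ hw) (hermCoeff Z a) (hermLegs Z) hA0 m).trans ?_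
  · calc _ ≤ ENNReal.ofReal (Real.pi * (d / (d - 2))) * (2 * centredNorm Y w) :=
          mul_le_mul_right (tsum_hermCoeff_length_le hd hσ Y w) _
      _ = 2 * (ENNReal.ofReal (Real.pi * (d / (d - 2))) * centredNorm Y w) := by ring
      _ ≤ 2 * Φ := mul_le_mul_right hΦ 2
  · intro i
    rw [length_hermLegs]
    exact even_two_mul _
  · exact mul_le_mul_right (tsum_hermCoeff_weight_le hd hσ Z a) _

/-! ### The choice of centres -/

/-- For ‖·‖' all centres are 0 and ε is not needed. For ‖·‖'' the infimum need not be attained, so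
each kernel gets a centre that is optimal up to a summable error. -/
theorem exists_centres {w : Kernels d k} {ν : Kernels d k → ℝ≥0∞}
    (hν : ν = kernelNormP ∨ ν = kernelNormPP) (hw : ν w < ∞) {ε : ℝ≥0∞} (hε : ε ≠ 0) :
    ∃ Y : Centres d k, centredNorm Y w ≤ ν w + ε := by
  rcases hν with rfl | rfl
  · exact ⟨fun _ _ _ => 0, le_self_add⟩
  let c : ℕ+ → ℝ≥0∞ := fun N => ((N : ℕ) : ℝ≥0∞) * 2 ^ ((d + 2) * (N : ℕ))
  have hc0 : ∀ N, c N ≠ 0 := fun N =>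
    mul_ne_zero (by exact_mod_cast N.pos.ne') (pow_ne_zero _ two_ne_zero)
  have hc : ∀ N, c N ≠ ∞ := fun N =>
    ENNReal.mul_ne_top (ENNReal.natCast_ne_top _) (ENNReal.pow_ne_top ENNReal.ofNat_ne_top)
  have hfin : ∀ N s s', normPP (w N s s') ≠ ∞ := by
    intro N s s'
    have h1 := ENNReal.lt_top_of_mul_ne_top_right (ENNReal.ne_top_of_tsum_ne_top hw.ne N) (hc0 N)
    exact (ENNReal.sum_lt_top.1 (ENNReal.sum_lt_top.1 h1 s (Finset.mem_univ s)) s'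
      (Finset.mem_univ s')).ne
  -- The errors are divided by the factors c N of the norm, so that their weighted sum stays below
  -- ε.
  obtain ⟨δ, hδ, hδε⟩ := ENNReal.exists_pos_sum_of_countable' hε
    (Σ N : ℕ+, (Fin N → Label k) × (Fin N → Label k))
  have hY : ∀ N s s', ∃ y, sobolevNorm y (w N s s') ≤
      normPP (w N s s') + δ ⟨N, s, s'⟩ / c N := by
    intro N s s'
    obtain ⟨y, hy⟩ := iInf_lt_iff.1 (ENNReal.lt_add_right (hfin N s s')
      (ENNReal.div_pos (hδ ⟨N, s, s'⟩).ne' (hc N)).ne')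
    exact ⟨y, hy.le⟩
  choose Y hY using hY
  refine ⟨Y, ?_⟩
  calc centredNorm Y w ≤ ∑' N : ℕ+, c N * ∑ s : Fin N → Label k, ∑ s' : Fin N → Label k,
        (normPP (w N s s') + δ ⟨N, s, s'⟩ / c N) := by
        refine ENNReal.tsum_le_tsum fun N => mul_le_mul_right ?_ _
        exact Finset.sum_le_sum fun s _ => Finset.sum_le_sum fun s' _ => hY N s s'
    _ = ∑' N : ℕ+, (c N * ∑ s : Fin N → Label k, ∑ s' : Fin N → Label k, normPP (w N s s') +
        ∑' q : (Fin N → Label k) × (Fin N → Label k), δ ⟨N, q⟩) := by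
        refine tsum_congr fun N => ?_
        simp only [Finset.sum_add_distrib, mul_add]
        congr 1
        rw [tsum_fintype, Fintype.sum_prod_type]
        simp only [Finset.mul_sum, ENNReal.mul_div_cancel (hc0 N) (hc N)]
    _ ≤ kernelNormPP w + ε := by
        rw [ENNReal.tsum_add, ← ENNReal.tsum_sigma']
        exact add_le_add le_rfl hδε.le

end FreeFermions

end

noncomputable section

namespace FreeFermions

variable {d k : ℕ}

/-! ### Time-ordered integrals -/

/-- The set of times `0 < τ_0 < ⋯ < τ_{m-1} < t`. -/
def orderedTimesIn (m : ℕ) (t : ℝ) : Set (Fin m → ℝ) := {τ | StrictMono τ ∧ ∀ j, 0 < τ j ∧ τ j < t}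

theorem measurableSet_orderedTimesIn_prod (m : ℕ) :
    MeasurableSet {p : ℝ × (Fin m → ℝ) | p.2 ∈ orderedTimesIn m p.1} := by
  have e : {p : ℝ × (Fin m → ℝ) | p.2 ∈ orderedTimesIn m p.1} =
      (Prod.snd ⁻¹' {τ : Fin m → ℝ | StrictMono τ}) ∩ ⋂ j, {p | 0 < p.2 j ∧ p.2 j < p.1} := by
    ext p
    simp [orderedTimesIn]
  rw [e]
  have h : ∀ j : Fin m, Measurable fun p : ℝ × (Fin m → ℝ) => p.2 j := fun j =>
    (measurable_pi_apply j).comp measurable_snd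
  exact (measurable_snd (measurableSet_strictMono m)).inter (MeasurableSet.iInter fun j =>
    (measurableSet_lt measurable_const (h j)).inter (measurableSet_lt (h j) measurable_fst))

theorem measurableSet_orderedTimesIn (m : ℕ) (t : ℝ) : MeasurableSet (orderedTimesIn m t) :=
  measurable_prodMk_left (measurableSet_orderedTimesIn_prod m)

theorem orderedTimesIn_subset_Icc (m : ℕ) (t : ℝ) :
    orderedTimesIn m t ⊆ Set.Icc (fun _ => 0) fun _ => t :=
  fun _ h => ⟨fun j => (h.2 j).1.le, fun j => (h.2 j).2.le⟩

theorem snoc_mem_orderedTimes {m : ℕ} {t : ℝ} {τ : Fin m → ℝ} :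
    (Fin.snoc (α := fun _ => ℝ) τ t : Fin (m + 1) → ℝ) ∈ orderedTimes (m + 1) 0 ↔
      0 < t ∧ τ ∈ orderedTimesIn m t := by
  constructor
  · rintro ⟨h1, h2⟩
    refine ⟨by simpa using h2 (Fin.last m), fun i j hij => ?_, fun j => ⟨?_, ?_⟩⟩
    · simpa using h1 (Fin.castSucc_lt_castSucc_iff.2 hij)
    · simpa using h2 j.castSucc
    · simpa using h1 (Fin.castSucc_lt_last j)
  · rintro ⟨h1, h2, h3⟩
    refine ⟨fun i j hij => ?_, fun j => ?_⟩
    · cases j using Fin.lastCases with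
      | last =>
        cases i using Fin.lastCases with
        | last => exact absurd hij (lt_irrefl _)
        | cast i => simpa using (h3 i).2
      | cast j =>
        cases i using Fin.lastCases with
        | last => exact absurd hij (not_lt.2 (Fin.le_last _))
        | cast i => simpa using h2 (Fin.castSucc_lt_castSucc_iff.1 hij)
    · cases j using Fin.lastCases with
      | last => simpa using h1
      | cast j => simpa using (h3 j).1

theorem lintegral_finSnoc {m : ℕ} {f : (Fin (m + 1) → ℝ) → ℝ≥0∞} (hf : Measurable f) :
    ∫⁻ τ, f τ = ∫⁻ t, ∫⁻ τ : Fin m → ℝ, f (Fin.snoc (α := fun _ => ℝ) τ t) := by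
  have h := (volume_preserving_piFinSuccAbove (fun _ : Fin (m + 1) => ℝ) (Fin.last m)).symm
  rw [← h.lintegral_comp hf]
  refine (lintegral_prod _ (hf.comp h.measurable).aemeasurable).trans ?_
  have e : ∀ (t : ℝ) (τ : Fin m → ℝ),
      (MeasurableEquiv.piFinSuccAbove (fun _ : Fin (m + 1) => ℝ) (Fin.last m)).symm (t, τ) =
        Fin.snoc (α := fun _ => ℝ) τ t := fun t τ => Fin.insertNth_last' t τ
  simp only [Function.comp_apply, e]

/-- Here the latest time is singled out: it is the time t of the outer commutator with a Dyson term,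
whose own times lie between 0 and t. -/
theorem setLIntegral_orderedTimes_last {m : ℕ} {f : (Fin (m + 1) → ℝ) → ℝ≥0∞} (hf : Measurable f) :
    ∫⁻ τ in orderedTimes (m + 1) 0, f τ =
      ∫⁻ t in Set.Ioi 0, ∫⁻ τ in orderedTimesIn m t, f (Fin.snoc (α := fun _ => ℝ) τ t) := by
  rw [← lintegral_indicator (measurableSet_orderedTimes _ _),
    lintegral_finSnoc (hf.indicator (measurableSet_orderedTimes _ _)),
    ← lintegral_indicator measurableSet_Ioi]
  refine lintegral_congr fun r => ?_
  by_cases hr : 0 < r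
  · rw [Set.indicator_of_mem (show r ∈ Set.Ioi 0 from hr),
      ← lintegral_indicator (measurableSet_orderedTimesIn _ _)]
    refine lintegral_congr fun τ => ?_
    classical
    simp only [Set.indicator_apply, snoc_mem_orderedTimes, hr, true_and]
  · rw [Set.indicator_of_notMem (show r ∉ Set.Ioi 0 from hr)]
    simp [snoc_mem_orderedTimes, hr]

/-! ### From iterated commutators to commutators with Dyson terms -/

section Dyson

variable {𝔄 : Type*} [NormedRing 𝔄] [NormedAlgebra ℂ 𝔄] {V : ℝ → 𝔄}

theorem integrableOn_iterAd (hV : Continuous V) (m : ℕ) (t : ℝ) (A : 𝔄) :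
    IntegrableOn (fun τ => iterAd V m τ A) (orderedTimesIn m t) :=
  (((continuous_iterAd hV m).clm_apply continuous_const).continuousOn.integrableOn_compact
    isCompact_Icc).mono_set (orderedTimesIn_subset_Icc m t)

theorem stronglyMeasurable_commutator_dyson (hV : Continuous V) (m : ℕ) (A : 𝔄) :
    StronglyMeasurable fun t => ⁅V t, ∫ τ in orderedTimesIn m t, iterAd V m τ A⁆ := by
  have h1 : StronglyMeasurable fun t => ∫ τ in orderedTimesIn m t, iterAd V m τ A := by
    have h2 : StronglyMeasurable fun p : ℝ × (Fin m → ℝ) =>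
        {p : ℝ × (Fin m → ℝ) | p.2 ∈ orderedTimesIn m p.1}.indicator
          (fun p => iterAd V m p.2 A) p :=
      (((continuous_iterAd hV m).comp continuous_snd).clm_apply
        continuous_const).stronglyMeasurable.indicator (measurableSet_orderedTimesIn_prod m)
    have h4 : ∀ t, ∫ τ in orderedTimesIn m t, iterAd V m τ A =
        ∫ τ, {p : ℝ × (Fin m → ℝ) | p.2 ∈ orderedTimesIn m p.1}.indicator
          (fun p => iterAd V m p.2 A) (t, τ) := fun t =>
      (integral_indicator (measurableSet_orderedTimesIn m t)).symm
    simp only [h4]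
    exact h2.integral_prod_right'
  have h3 : StronglyMeasurable V := hV.stronglyMeasurable
  simp only [Ring.lie_def]
  exact (h3.mul h1).sub (h1.mul h3)

/-- The commutator is moved under the time integral and the norm is taken inside; all m + 1 times
together then fill the ordered region. -/
theorem lintegral_commutator_dyson_le [CompleteSpace 𝔄] (hV : Continuous V) (m : ℕ) (A : 𝔄) :
    ∫⁻ t in Set.Ioi 0, ‖⁅V t, ∫ τ in orderedTimesIn m t, iterAd V m τ A⁆‖ₑ ≤
      adMass V (m + 1) 0 A := by
  rw [adMass, setLIntegral_orderedTimes_last (measurable_enorm_iterAd hV _ A)]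
  refine lintegral_mono fun t => ?_
  rw [← adL_apply, ← (adL (V t)).integral_comp_comm (integrableOn_iterAd hV m t A)]
  refine (enorm_integral_le_lintegral_enorm _).trans (le_of_eq ?_)
  simp only [iterAd_succ, Fin.snoc_last, Fin.snoc_castSucc, adL_apply]

theorem iterAd_comp_neg (V : ℝ → 𝔄) (m : ℕ) (τ : Fin m → ℝ) :
    iterAd (fun t => V (-t)) m τ = iterAd V m (-τ) := by
  induction m with
  | zero => rfl
  | succ m ih =>
    simp only [iterAd, ih]
    rfl

end Dyson

theorem multiComm_eq_iterAd (W A : Op d k) (m : ℕ) :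
    multiComm W A m = fun τ => iterAd (interactionPicture W) m τ A := by
  induction m with
  | zero => rfl
  | succ m ih =>
    funext τ
    rw [iterAd_succ, multiComm, ih]

theorem timeSimplex_of_pos (m : ℕ) {t : ℝ} (ht : 0 < t) : timeSimplex m t = orderedTimesIn m t := by
  ext τ
  refine ⟨?_, Or.inl⟩
  rintro (h | ⟨h1, h2⟩)
  · exact h
  · refine ⟨fun i => ?_, fun i => ?_⟩ <;> exact absurd ((h2 i).1.trans (h2 i).2) ht.not_gt

theorem timeSimplex_of_neg (m : ℕ) {t : ℝ} (ht : t < 0) :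
    timeSimplex m t = Neg.neg ⁻¹' orderedTimesIn m (-t) := by
  ext τ
  constructor
  · rintro (⟨h1, h2⟩ | ⟨h1, h2⟩)
    · refine ⟨fun i => ?_, fun i => ?_⟩ <;> exact absurd ((h2 i).1.trans (h2 i).2) ht.not_gt
    · exact ⟨fun i j hij => neg_lt_neg (h1 hij), fun i =>
        ⟨neg_pos.2 (h2 i).2, neg_lt_neg (h2 i).1⟩⟩
  · rintro ⟨h1, h2⟩
    exact Or.inr ⟨fun i j hij => neg_lt_neg_iff.1 (h1 hij), fun i =>
      ⟨neg_lt_neg_iff.1 (h2 i).2, neg_pos.1 (h2 i).1⟩⟩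

theorem timeSimplex_subset_Icc (m : ℕ) (t : ℝ) :
    timeSimplex m t ⊆ Set.Icc (fun _ => -|t|) fun _ => |t| := by
  rintro τ (⟨-, h⟩ | ⟨-, h⟩)
  · exact ⟨fun j => (neg_nonpos.2 (abs_nonneg t)).trans (h j).1.le,
      fun j => (h j).2.le.trans (le_abs_self t)⟩
  · exact ⟨fun j => (neg_abs_le t).trans (h j).1.le, fun j => (h j).2.le.trans (abs_nonneg t)⟩

theorem integrableOn_multiComm {W : Op d k} (hW : Continuous (interactionPicture W)) (A : Op d k)
    (m : ℕ) (t : ℝ) : IntegrableOn (multiComm W A m) (timeSimplex m t) := by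
  rw [multiComm_eq_iterAd]
  exact (((continuous_iterAd hW m).clm_apply continuous_const).continuousOn.integrableOn_compact
    isCompact_Icc).mono_set (timeSimplex_subset_Icc m t)

theorem dyson_of_pos (W A : Op d k) (m : ℕ) {t : ℝ} (ht : 0 < t) :
    dyson W m t A = ∫ τ in orderedTimesIn m t, iterAd (interactionPicture W) m τ A := by
  rw [dyson, timeSimplex_of_pos m ht, multiComm_eq_iterAd]

theorem dyson_of_neg (W A : Op d k) (m : ℕ) {t : ℝ} (ht : t < 0) :
    dyson W m t A = ∫ τ in orderedTimesIn m (-t),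
      iterAd (fun s => interactionPicture W (-s)) m τ A := by
  have h := (Measure.measurePreserving_neg (volume : Measure (Fin m → ℝ))).setIntegral_preimage_emb
    (MeasurableEquiv.neg (Fin m → ℝ)).measurableEmbedding
    (fun τ => iterAd (fun s => interactionPicture W (-s)) m τ A) (orderedTimesIn m (-t))
  rw [dyson, timeSimplex_of_neg m ht, multiComm_eq_iterAd, ← h]
  simp only [iterAd_comp_neg, neg_neg]

/-! ### The main estimate -/

/-- Enlarging the norms by ε > 0 allows nearly optimal centres and keeps Φ nonzero even when w
vanishes; then ε tends to 0. -/
theorem adMass_le_of_norm {w a : Kernels d k} {ν : Kernels d k → ℝ≥0∞} (hd : 3 ≤ d) {σ : ℝ}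
    (hσ : |σ| = 1) (hν : ν = kernelNormP ∨ ν = kernelNormPP) (hw : ν w < ∞) (ha : ν a < ∞)
    {W A : Op d k} (hW : IsSecondQuantization w W) (hA : IsSecondQuantization a A) (m : ℕ) :
    adMass (fun t => interactionPicture W (σ * t)) m 0 A ≤
      (ENNReal.ofReal (Real.pi * (d / (d - 2))) * ν w) ^ m * ν a := by
  have hd' : (3 : ℝ) ≤ d := by exact_mod_cast hd
  have hκ : 0 < Real.pi * (d / ((d : ℝ) - 2)) :=
    mul_pos Real.pi_pos (div_pos (by linarith) (by linarith))
  set κ : ℝ≥0∞ := ENNReal.ofReal (Real.pi * (d / (d - 2))) with hκ'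
  have hκ0 : κ ≠ 0 := (ENNReal.ofReal_pos.2 hκ).ne'
  have key : ∀ ε : NNReal, 0 < ε → adMass (fun t => interactionPicture W (σ * t)) m 0 A ≤
      (κ * (ν w + ε)) ^ m * (ν a + ε) := by
    intro ε hε
    have hε0 : (ε : ℝ≥0∞) ≠ 0 := by exact_mod_cast hε.ne'
    obtain ⟨Y, hY⟩ := exists_centres hν hw hε0
    obtain ⟨Z, hZ⟩ := exists_centres hν ha hε0
    refine (adMass_interactionPicture_le hd hσ hW hA
      (hY.trans_lt (ENNReal.add_lt_top.2 ⟨hw, ENNReal.coe_lt_top⟩))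
      (hZ.trans_lt (ENNReal.add_lt_top.2 ⟨ha, ENNReal.coe_lt_top⟩)) (Φ := κ * (ν w + ε))
      (mul_ne_zero hκ0 (by simp [hε0]))
      (ENNReal.mul_ne_top ENNReal.ofReal_ne_top
        (ENNReal.add_lt_top.2 ⟨hw, ENNReal.coe_lt_top⟩).ne) (by gcongr) m).trans ?_
    gcongr
  have hκt : κ ≠ ∞ := ENNReal.ofReal_ne_top
  clear_value κ
  lift κ to NNReal using hκt
  generalize ν w = x at *
  generalize ν a = y at *
  lift x to NNReal using hw.ne
  lift y to NNReal using ha.ne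
  have hc : Continuous fun ε : NNReal => (κ * (x + ε)) ^ m * (y + ε) := by fun_prop
  have ht : Filter.Tendsto (fun ε : NNReal => ((((κ * (x + ε)) ^ m * (y + ε) : NNReal)) : ℝ≥0∞))
      (nhdsWithin 0 (Set.Ioi 0)) (nhds (((κ * (x + 0)) ^ m * (y + 0) : NNReal) : ℝ≥0∞)) :=
    (ENNReal.continuous_coe.comp hc).continuousWithinAt
  have h := ge_of_tendsto ht (by
    filter_upwards [self_mem_nhdsWithin] with ε hε
    have := key ε hε
    exact_mod_cast this)
  simpa using h

theorem integrableOn_and_integral_le_of_lintegral_le {E : Type*} [NormedAddCommGroup E] {f : ℝ → E}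
    {S : Set ℝ} {B : ℝ≥0∞} (hf : AEStronglyMeasurable f (volume.restrict S))
    (h : ∫⁻ t in S, ‖f t‖ₑ ≤ B) (hB : B ≠ ∞) :
    IntegrableOn (fun t => ‖f t‖) S ∧ ∫ t in S, ‖f t‖ ≤ B.toReal := by
  have hi : Integrable f (volume.restrict S) := ⟨hf, h.trans_lt hB.lt_top⟩
  refine ⟨hi.norm, ?_⟩
  rw [integral_norm_eq_lintegral_enorm hf]
  exact ENNReal.toReal_mono hB h

theorem commutator_dyson_bound_forward {w a : Kernels d k} {ν : Kernels d k → ℝ≥0∞} (hd : 3 ≤ d)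
    {σ : ℝ} (hσ : |σ| = 1) (hν : ν = kernelNormP ∨ ν = kernelNormPP) (hw : ν w < ∞) (ha : ν a < ∞)
    {W A : Op d k} (hW : IsSecondQuantization w W) (hA : IsSecondQuantization a A)
    (hc : Continuous (interactionPicture W)) {m : ℕ} (hm : 1 ≤ m) {F : ℝ → Op d k}
    (hF : ∀ t, F t = ⁅interactionPicture W (σ * t), ∫ τ in orderedTimesIn (m - 1) t,
      iterAd (fun s => interactionPicture W (σ * s)) (m - 1) τ A⁆) :
    IntegrableOn (fun t => ‖F t‖) (Set.Ioi 0) ∧ ∫ t in Set.Ioi 0, ‖F t‖ ≤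
      1 / (m : ℝ) * (8 * Real.pi * d / ((d : ℝ) - 2)) ^ m * (ν a).toReal * (ν w).toReal ^ m := by
  obtain ⟨m, rfl⟩ := Nat.exists_eq_add_of_le' hm
  rw [Nat.add_sub_cancel] at hF
  have hV : Continuous fun t => interactionPicture W (σ * t) :=
    hc.comp (continuous_const.mul continuous_id)
  have hd' : (3 : ℝ) ≤ d := by exact_mod_cast hd
  have hκ : 0 ≤ Real.pi * (d / ((d : ℝ) - 2)) :=
    mul_nonneg Real.pi_pos.le (div_nonneg (by linarith) (by linarith))
  have h1 := (lintegral_commutator_dyson_le hV m A).trans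
    (adMass_le_of_norm hd hσ hν hw ha hW hA (m + 1))
  have h2 := integrableOn_and_integral_le_of_lintegral_le
    (stronglyMeasurable_commutator_dyson hV m A).aestronglyMeasurable h1
    (ENNReal.mul_ne_top (ENNReal.pow_ne_top (ENNReal.mul_ne_top ENNReal.ofReal_ne_top hw.ne)) ha.ne)
  simp only [← hF] at h2
  refine ⟨h2.1, h2.2.trans ?_⟩
  rw [ENNReal.toReal_mul, ENNReal.toReal_pow, ENNReal.toReal_mul, ENNReal.toReal_ofReal hκ]
  -- The estimate obtained has πd/(d-2) to the power m + 1; the factor 8^{m+1}/(m+1) ≥ 1 in the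
  -- claim is room to spare.
  have h8 : ((m + 1 : ℕ) : ℝ) ≤ 8 ^ (m + 1) := by
    exact_mod_cast (Nat.lt_pow_self (by norm_num : 1 < 8)).le
  have hm0 : (0 : ℝ) < ((m + 1 : ℕ) : ℝ) := by positivity
  have e : 1 / ((m + 1 : ℕ) : ℝ) * (8 * Real.pi * d / ((d : ℝ) - 2)) ^ (m + 1) * (ν a).toReal *
      (ν w).toReal ^ (m + 1) = (8 ^ (m + 1) / ((m + 1 : ℕ) : ℝ)) *
        ((Real.pi * (d / ((d : ℝ) - 2)) * (ν w).toReal) ^ (m + 1) * (ν a).toReal) := by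
    have : 8 * Real.pi * d / ((d : ℝ) - 2) = 8 * (Real.pi * (d / ((d : ℝ) - 2))) := by ring
    rw [this, mul_pow, mul_pow _ (ν w).toReal]
    ring
  rw [e]
  exact le_mul_of_one_le_left (by positivity) ((one_le_div hm0).2 h8)

end FreeFermions

end

/-! ### Existence, uniqueness and the bounds in both directions of time -/

theorem mainTheorem1 (d k : ℕ) (hd : 3 ≤ d) (w a : FreeFermions.Kernels d k)
    (ν : FreeFermions.Kernels d k → ℝ≥0∞)
    (hν : ν = FreeFermions.kernelNormP ∨ ν = FreeFermions.kernelNormPP)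
    (hw : ν w < ∞) (ha : ν a < ∞) :
    (∃! W : FreeFermions.Op d k, FreeFermions.IsSecondQuantization w W) ∧
    (∃! A : FreeFermions.Op d k, FreeFermions.IsSecondQuantization a A) ∧
    ∀ W A : FreeFermions.Op d k,
      FreeFermions.IsSecondQuantization w W → FreeFermions.IsSecondQuantization a A →
      (∀ (m : ℕ) (t : ℝ),
        IntegrableOn (FreeFermions.multiComm W A m) (FreeFermions.timeSimplex m t)) ∧
      ∀ m : ℕ, 1 ≤ m →
        (IntegrableOn (fun t : ℝ =>
            ‖⁅FreeFermions.interactionPicture W t, FreeFermions.dyson W (m - 1) t A⁆‖)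
          (Set.Ioi 0) ∧
        ∫ t in Set.Ioi (0 : ℝ),
            ‖⁅FreeFermions.interactionPicture W t, FreeFermions.dyson W (m - 1) t A⁆‖ ≤
          1 / (m : ℝ) * (8 * Real.pi * d / ((d : ℝ) - 2)) ^ m * (ν a).toReal * (ν w).toReal ^ m) ∧
        (IntegrableOn (fun t : ℝ =>
            ‖⁅FreeFermions.interactionPicture W t, FreeFermions.dyson W (m - 1) t A⁆‖)
          (Set.Iio 0) ∧
        ∫ t in Set.Iio (0 : ℝ),
            ‖⁅FreeFermions.interactionPicture W t, FreeFermions.dyson W (m - 1) t A⁆‖ ≤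
          1 / (m : ℝ) * (8 * Real.pi * d / ((d : ℝ) - 2)) ^ m * (ν a).toReal * (ν w).toReal ^ m) := by
  obtain ⟨Y, hY⟩ := FreeFermions.exists_centres hν hw one_ne_zero
  obtain ⟨Z, hZ⟩ := FreeFermions.exists_centres hν ha one_ne_zero
  have hY' := hY.trans_lt (ENNReal.add_lt_top.2 ⟨hw, ENNReal.one_lt_top⟩)
  have hZ' := hZ.trans_lt (ENNReal.add_lt_top.2 ⟨ha, ENNReal.one_lt_top⟩)
  refine ⟨⟨_, FreeFermions.isSecondQuantization_tsum hY', fun V hV =>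
    hV.unique (FreeFermions.isSecondQuantization_tsum hY')⟩,
    ⟨_, FreeFermions.isSecondQuantization_tsum hZ', fun B hB =>
      hB.unique (FreeFermions.isSecondQuantization_tsum hZ')⟩, fun W A hW hA => ?_⟩
  have hc := hW.continuous_interactionPicture hd hY'
  refine ⟨FreeFermions.integrableOn_multiComm hc A, fun m hm => ⟨?_, ?_⟩⟩
  · have h := FreeFermions.commutator_dyson_bound_forward hd (abs_one (α := ℝ)) hν hw ha hW hA hc hm
      (F := fun t => ⁅FreeFermions.interactionPicture W t,
        ∫ τ in FreeFermions.orderedTimesIn (m - 1) t,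
          FreeFermions.iterAd (FreeFermions.interactionPicture W) (m - 1) τ A⁆)
      (fun t => by simp only [one_mul])
    have e : Set.EqOn (fun t =>
        ‖⁅FreeFermions.interactionPicture W t, FreeFermions.dyson W (m - 1) t A⁆‖)
        (fun t => ‖⁅FreeFermions.interactionPicture W t,
          ∫ τ in FreeFermions.orderedTimesIn (m - 1) t,
            FreeFermions.iterAd (FreeFermions.interactionPicture W) (m - 1) τ A⁆‖)
        (Set.Ioi 0) := fun t ht => by
      simp only [FreeFermions.dyson_of_pos W A (m - 1) ht]
    exact ⟨h.1.congr_fun e.symm measurableSet_Ioi,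
      (setIntegral_congr_fun measurableSet_Ioi e).trans_le h.2⟩
  -- Negative times: the substitution t ↦ -t leads to the forward estimate for the reversed dynamics
  -- s ↦ W(-s).
  · have h := FreeFermions.commutator_dyson_bound_forward hd (σ := -1) (by simp) hν hw ha hW hA hc hm
      (F := fun t => ⁅FreeFermions.interactionPicture W (-t),
        ∫ τ in FreeFermions.orderedTimesIn (m - 1) t,
          FreeFermions.iterAd (fun s => FreeFermions.interactionPicture W (-s)) (m - 1) τ A⁆)
      (fun t => by simp only [neg_one_mul])
    have e : Set.EqOn (fun t =>
        ‖⁅FreeFermions.interactionPicture W t, FreeFermions.dyson W (m - 1) t A⁆‖)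
        (fun t => (fun s => ‖⁅FreeFermions.interactionPicture W (-s),
          ∫ τ in FreeFermions.orderedTimesIn (m - 1) s,
            FreeFermions.iterAd (fun s => FreeFermions.interactionPicture W (-s))
              (m - 1) τ A⁆‖) (-t))
        (Set.Iio 0) := fun t ht => by
      simp only [FreeFermions.dyson_of_neg W A (m - 1) ht, neg_neg]
    have hpre : Neg.neg ⁻¹' Set.Ioi (0 : ℝ) = Set.Iio 0 := by
      ext t
      simp
    have hmp := Measure.measurePreserving_neg (volume : Measure ℝ)
    have he := (MeasurableEquiv.neg ℝ).measurableEmbedding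
    have h1 := (hmp.integrableOn_comp_preimage he).2 h.1
    have h2 := hmp.setIntegral_preimage_emb he (fun s => ‖⁅FreeFermions.interactionPicture W (-s),
      ∫ τ in FreeFermions.orderedTimesIn (m - 1) s,
        FreeFermions.iterAd (fun s => FreeFermions.interactionPicture W (-s)) (m - 1) τ A⁆‖)
      (Set.Ioi 0)
    rw [hpre] at h1 h2
    exact ⟨h1.congr_fun e.symm measurableSet_Iio,
      ((setIntegral_congr_fun measurableSet_Iio e).trans h2).trans_le h.2⟩
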